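/- For integers $g,r\ge 0$ let $\mathrm{Feyn}_{\mathfrak k}(\mathrm{Com}_{\mathfrak k})(g,r)$ be the odd graph complex of genus $g$ with $r$ legs. It is the cochain complex of $\mathbb{Q}$-vector spaces spanned by connected graphs of loop order $g$ (self-edges and multiple edges allowed), with $r$ legs numbered $1,\dots,r$ and all vertices of valence at least $3$ (legs are counted, self-edges count twice), together with an orientation, i.e. an ordering of the vertices and a direction of every edge. Isomorphic graphs are identified, up to the sign of the vertex permutation times $-1$ for every reversed edge (in particular, graphs with self-edges vanish). The cohomological degree of a graph $\Gamma$ is $\sum_{v}(\mathrm{val}(v)-3)$, and the differential is the signed sum over all contractions of an edge that is not a self-edge. Let $\mathrm{Feyn}^s_{\mathfrak k}(\mathrm{Com}_{\mathfrak k})(g,r)$ be the quotient of this complex by the subcomplex spanned by the graphs with self-edges or multiple edges. **Proposition.** The projection $$\mathrm{Feyn}_{\mathfrak k}(\mathrm{Com}_{\mathfrak k})(g,r)\to \mathrm{Feyn}^s_{\mathfrak k}(\mathrm{Com}_{\mathfrak k})(g,r)$$ is a quasi-isomorphism for all $(g,r)\neq (2,0),(2,1),(1,2)$. In addition, $$H(\mathrm{Feyn}_{\mathfrak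 k}(\mathrm{Com}_{\mathfrak k})(2,0))\cong\mathbb{Q}\,\Theta,\qquad H(\mathrm{Feyn}_{\mathfrak k}(\mathrm{Com}_{\mathfrak k})(2,1))\cong\mathbb{Q}\,\Theta_1,\qquad H(\mathrm{Feyn}_{\mathfrak k}(\mathrm{Com}_{\mathfrak k})(1,2))\cong\mathbb{Q}\,D,$$ where $\Theta$ is the theta graph (two vertices joined by three edges), $\Theta_1$ is the theta graph with one leg, and $D$ is the graph with two vertices that are joined by two edges and carry one leg each; that is, these graphs are cocycles, of degrees $0$, $1$ and $0$, and the class of each is a basis of the total cohomology. Moreover, $$H(\mathrm{Feyn}^s_{\mathfrak k}(\mathrm{Com}_{\mathfrak k})(2,0))=H(\mathrm{Feyn}^s_{\mathfrak k}(\mathrm{Com}_{\mathfrak k})(2,1))=H(\mathrm{Feyn}^s_{\mathfrak k}(\mathrm{Com}_{\mathfrak k})(1,2))=0.$$ -/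

import Mathlib

/-! # The odd graph complex with legs

`Com_𝔨(S)` is the sign representation of the symmetric group of `S`, placed in cohomological degree
`|S| - 3`. So in `⨂_v Com_𝔨(star v)` every vertex and every half-edge (legs included) is an odd
symbol. A generator of this line is an ordering of the vertices together with an ordering of the
half-edges; as the legs are numbered and edges consist of two half-edges, this is the same as an
ordering of the vertices and a direction of every edge. Isomorphisms of graphs act by the sign of
the vertex permutation times `-1` for every reversed edge; permuting edges gives no sign.

A graph with `n` vertices, `m` edges and `r` legs is represented with vertex set `Fin n` (the
ordering), directed edges indexed by `Fin m`, and legs numbered by `Fin r`. Self-edges and multiple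
edges are allowed. -/

namespace OddGraph

/-- Graphs with ordered vertices, directed edges (self-edges and multiple edges allowed) and
numbered legs. -/
@[ext] structure LegGraph (n m r : ℕ) where
  /-- the tail of an edge -/
  src : Fin m → Fin n
  /-- the head of an edge -/
  tgt : Fin m → Fin n
  /-- the vertex that carries a leg -/
  leg : Fin r → Fin n

namespace LegGraph

variable {n m r : ℕ}

/-- The number of half-edges (including legs) at a vertex; a self-edge counts twice. -/
def valence (Γ : LegGraph n m r) (v : Fin n) : ℕ :=
  (Finset.univ.filter fun j => Γ.src j = v).card + (Finset.univ.filter fun j => Γ.tgt j = v).card +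
    (Finset.univ.filter fun l => Γ.leg l = v).card

/-- Any two vertices are joined by an edge path. -/
def Connected (Γ : LegGraph n m r) : Prop :=
  ∀ u v : Fin n, Relation.EqvGen (fun a b => ∃ j, Γ.src j = a ∧ Γ.tgt j = b) u v

/-- Two edges have the same unordered pair of end points. -/
def Parallel (Γ : LegGraph n m r) (j k : Fin m) : Prop :=
  (Γ.src j = Γ.src k ∧ Γ.tgt j = Γ.tgt k) ∨ (Γ.src j = Γ.tgt k ∧ Γ.tgt j = Γ.src k)

/-- There are neither self-edges nor multiple edges. -/
def Simple (Γ : LegGraph n m r) : Prop :=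
  (∀ j, Γ.src j ≠ Γ.tgt j) ∧ ∀ j k, j ≠ k → ¬ Γ.Parallel j k

/-- There is an isomorphism `Γ → Γ'` with vertex permutation `σ` and edge permutation `τ`, which
respects the numbered legs and reverses exactly the edges `j` with `φ j = true`, and
`s` is the sign by which it acts on orientations. -/
def IsIso (Γ Γ' : LegGraph n m r) (τ : Equiv.Perm (Fin m)) (s : ℤˣ) : Prop :=
  ∃ (σ : Equiv.Perm (Fin n)) (φ : Fin m → Bool),
    (∀ j, Γ'.src (τ j) = σ (if φ j then Γ.tgt j else Γ.src j)) ∧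
    (∀ j, Γ'.tgt (τ j) = σ (if φ j then Γ.src j else Γ.tgt j)) ∧
    (∀ l, Γ'.leg l = σ (Γ.leg l)) ∧
    s = Equiv.Perm.sign σ * ∏ j, (if φ j then (-1 : ℤˣ) else 1)

end LegGraph

/-- The order-preserving renumbering of the elements `v ≠ t` of `Fin (n + 2)`. -/
def rank {n : ℕ} (t v : Fin (n + 2)) : Fin (n + 1) :=
  ⟨if (v : ℕ) < t then v else v - 1, by have := v.2; have := t.2; split_ifs <;> omega⟩

/-- The map on vertices that merges `t` into `s`: the vertex `t` is deleted, and the remaining ones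
are renumbered preserving their order. -/
def collapse {n : ℕ} (s t v : Fin (n + 2)) : Fin (n + 1) :=
  rank t (if v = t then s else v)

namespace LegGraph

variable {n m r : ℕ}

/-- Contraction of the edge `e`: its head is merged into its tail, and `e` is removed. -/
def contract (Γ : LegGraph (n + 2) (m + 1) r) (e : Fin (m + 1)) : LegGraph (n + 1) m r where
  src j := collapse (Γ.src e) (Γ.tgt e) (Γ.src (e.succAbove j))
  tgt j := collapse (Γ.src e) (Γ.tgt e) (Γ.tgt (e.succAbove j))
  leg l := collapse (Γ.src e) (Γ.tgt e) (Γ.leg l)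

end LegGraph

section Lemmas

open LegGraph

variable {n m r : ℕ}

lemma succAbove_rank {t v : Fin (n + 2)} (h : v ≠ t) : t.succAbove (rank t v) = v := by
  have h' : (v : ℕ) ≠ t := fun h' => h (Fin.ext h')
  ext
  simp only [Fin.succAbove, rank, Fin.lt_def, Fin.val_castSucc]
  split_ifs <;> simp <;> omega

lemma rank_succAbove (t : Fin (n + 2)) (x : Fin (n + 1)) : rank t (t.succAbove x) = x :=
  Fin.succAbove_right_injective (succAbove_rank (Fin.succAbove_ne t x))

lemma rank_inj {t v w : Fin (n + 2)} (hv : v ≠ t) (hw : w ≠ t) : rank t v = rank t w ↔ v = w :=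
  ⟨fun h => by rw [← succAbove_rank hv, h, succAbove_rank hw], fun h => h ▸ rfl⟩

lemma collapse_eq_iff {s t : Fin (n + 2)} (h : s ≠ t) (v w : Fin (n + 2)) :
    collapse s t v = collapse s t w ↔ v = w ∨ (v = s ∧ w = t) ∨ (v = t ∧ w = s) := by
  unfold collapse
  rw [rank_inj]
  · split_ifs <;> grind
  · split_ifs <;> assumption
  · split_ifs <;> assumption

lemma sign_succAbove (κ : Equiv.Perm (Fin (n + 2))) (t : Fin (n + 2))
    (σ : Equiv.Perm (Fin (n + 1))) (h : ∀ x, κ (t.succAbove x) = (κ t).succAbove (σ x)) :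
    Equiv.Perm.sign κ = Equiv.Perm.sign σ * ((-1) ^ (t : ℕ) * (-1) ^ (κ t : ℕ)) := by
  have key : (κ t).cycleRange * κ * t.cycleRange⁻¹ = Equiv.Perm.decomposeFin.symm (0, σ) := by
    ext x
    refine Fin.cases ?_ (fun x => ?_) x
    · simp [Equiv.Perm.decomposeFin_symm_apply_zero, Equiv.Perm.inv_def]
    · simp [Equiv.Perm.decomposeFin_symm_apply_succ, Equiv.Perm.inv_def, h]
  have := congrArg Equiv.Perm.sign key
  rw [Equiv.Perm.decomposeFin.symm_sign] at this
  simp only [map_mul, map_inv, Fin.sign_cycleRange, if_true, one_mul] at this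
  rw [← this]
  rcases neg_one_pow_eq_or ℤˣ (t : ℕ) with h1 | h1 <;>
  rcases neg_one_pow_eq_or ℤˣ (κ t : ℕ) with h2 | h2 <;> simp [h1, h2]

/-- The permutation induced on the complements of `t` and `κ t`. -/
def delPerm {k : ℕ} (κ : Equiv.Perm (Fin (k + 1))) (t : Fin (k + 1)) : Equiv.Perm (Fin k) :=
  (finSuccAboveEquiv t).trans
    ((κ.subtypeEquiv fun a => by simp).trans (finSuccAboveEquiv (κ t)).symm)

lemma delPerm_spec {k : ℕ} (κ : Equiv.Perm (Fin (k + 1))) (t : Fin (k + 1)) (x : Fin k) :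
    κ (t.succAbove x) = (κ t).succAbove (delPerm κ t x) := by
  have : finSuccAboveEquiv (κ t) (delPerm κ t x)
      = ⟨κ (t.succAbove x), by simp⟩ := by
    simp [delPerm, finSuccAboveEquiv]
  exact (congrArg Subtype.val this).symm

lemma delPerm_one {k : ℕ} (t : Fin (k + 1)) : delPerm 1 t = 1 := by
  ext x
  have := delPerm_spec 1 t x
  simp at this
  simp [← this]

lemma LegGraph.IsIso.contract {Γ Γ' : LegGraph (n + 2) (m + 1) r} {τ : Equiv.Perm (Fin (m + 1))} {s : ℤˣ}
    (h : IsIso Γ Γ' τ s) (e : Fin (m + 1)) (he : Γ.src e ≠ Γ.tgt e) :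
    IsIso (Γ.contract e) (Γ'.contract (τ e)) (delPerm τ e)
      (s * ((-1) ^ (Γ.tgt e : ℕ) * (-1) ^ (Γ'.tgt (τ e) : ℕ))) := by
  obtain ⟨σ, φ, hs, ht, hl, rfl⟩ := h
  obtain ⟨κ, hκs, hκt, hκ, hsign⟩ : ∃ κ : Equiv.Perm (Fin (n + 2)),
      κ (Γ.src e) = Γ'.src (τ e) ∧ κ (Γ.tgt e) = Γ'.tgt (τ e) ∧
      (∀ v, collapse (Γ'.src (τ e)) (Γ'.tgt (τ e)) (κ v)
        = collapse (Γ'.src (τ e)) (Γ'.tgt (τ e)) (σ v)) ∧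
      Equiv.Perm.sign κ = Equiv.Perm.sign σ * (if φ e then (-1 : ℤˣ) else 1) := by
    by_cases hφ : φ e
    · refine ⟨σ * Equiv.swap (Γ.src e) (Γ.tgt e), ?_, ?_, ?_, ?_⟩
      · simp [hs, hφ]
      · simp [ht, hφ]
      · intro v
        rw [collapse_eq_iff]
        · rw [hs, ht]
          simp only [hφ, if_true, Equiv.Perm.mul_apply, EmbeddingLike.apply_eq_iff_eq]
          rw [Equiv.swap_apply_def]
          split_ifs <;> simp_all
        · rw [hs, ht]
          simpa [hφ] using he.symm
      · simp [hφ, Equiv.Perm.sign_swap he]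
    · exact ⟨σ, by simp [hs, hφ], by simp [ht, hφ], fun _ => rfl, by simp [hφ]⟩
  have hne : Γ'.src (τ e) ≠ Γ'.tgt (τ e) := by
    rw [← hκs, ← hκt]; simpa using he
  have hcol : ∀ v, collapse (Γ'.src (τ e)) (Γ'.tgt (τ e)) (σ v)
      = delPerm κ (Γ.tgt e) (collapse (Γ.src e) (Γ.tgt e) v) := by
    intro v
    rw [← hκ]
    apply Fin.succAbove_right_injective (p := κ (Γ.tgt e))
    rw [← delPerm_spec]
    unfold collapse
    rw [← hκt]
    rw [succAbove_rank, succAbove_rank]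
    · simp only [EmbeddingLike.apply_eq_iff_eq]
      split_ifs
      · exact hκs.symm
      · rfl
    · split_ifs <;> assumption
    · split_ifs with h
      · rw [hκt]; exact hne
      · exact h
  refine ⟨delPerm κ (Γ.tgt e), fun j => φ (e.succAbove j), ?_, ?_, ?_, ?_⟩
  · intro j
    simp only [LegGraph.contract]
    rw [← delPerm_spec, hs (e.succAbove j), hcol]
    split_ifs <;> rfl
  · intro j
    simp only [LegGraph.contract]
    rw [← delPerm_spec, ht (e.succAbove j), hcol]
    split_ifs <;> rfl
  · intro l
    simp only [LegGraph.contract]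
    rw [hl, hcol]
  · have := sign_succAbove κ (Γ.tgt e) _ (delPerm_spec κ _)
    rw [Fin.prod_univ_succAbove _ e, ← mul_assoc (Equiv.Perm.sign σ), ← hsign, this, hκt]
    rcases neg_one_pow_eq_or ℤˣ (Γ.tgt e : ℕ) with h1 | h1 <;>
    rcases neg_one_pow_eq_or ℤˣ (Γ'.tgt (τ e) : ℕ) with h2 | h2 <;> simp [h1, h2]

lemma LegGraph.IsIso.ne_iff {Γ Γ' : LegGraph n m r} {τ : Equiv.Perm (Fin m)} {s : ℤˣ}
    (h : IsIso Γ Γ' τ s) (e : Fin m) : Γ'.src (τ e) ≠ Γ'.tgt (τ e) ↔ Γ.src e ≠ Γ.tgt e := by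
  obtain ⟨σ, φ, hs, ht, -, -⟩ := h
  rw [hs, ht]
  split_ifs
  · simpa using ne_comm
  · simp

lemma LegGraph.Connected.contract {Γ : LegGraph (n + 2) (m + 1) r} (h : Γ.Connected) (e : Fin (m + 1))
    (he : Γ.src e ≠ Γ.tgt e) : (Γ.contract e).Connected := by
  have key : ∀ u v, Relation.EqvGen (fun a b => ∃ j, Γ.src j = a ∧ Γ.tgt j = b) u v →
      Relation.EqvGen (fun a b => ∃ j, (Γ.contract e).src j = a ∧ (Γ.contract e).tgt j = b)
        (collapse (Γ.src e) (Γ.tgt e) u) (collapse (Γ.src e) (Γ.tgt e) v) := by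
    intro u v huv
    induction huv with
    | rel a b hab =>
      obtain ⟨j, rfl, rfl⟩ := hab
      by_cases hj : j = e
      · subst hj
        have : collapse (Γ.src j) (Γ.tgt j) (Γ.src j) = collapse (Γ.src j) (Γ.tgt j) (Γ.tgt j) := by
          rw [collapse_eq_iff he]; simp
        rw [this]
        exact .refl _
      · obtain ⟨k, rfl⟩ := Fin.exists_succAbove_eq hj
        exact .rel _ _ ⟨k, rfl, rfl⟩
    | refl a => exact .refl _
    | symm a b _ ih => exact .symm _ _ ih
    | trans a b c _ _ ih₁ ih₂ => exact .trans _ _ _ ih₁ ih₂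
  have surj : ∀ x, ∃ v, collapse (Γ.src e) (Γ.tgt e) v = x := fun x =>
    ⟨(Γ.tgt e).succAbove x, by simp [collapse, Fin.succAbove_ne, rank_succAbove]⟩
  intro x y
  obtain ⟨u, rfl⟩ := surj x
  obtain ⟨v, rfl⟩ := surj y
  exact key u v (h u v)

lemma collapse_eq_iff_mem {s t : Fin (n + 2)} (h : s ≠ t) (v : Fin (n + 2)) (x : Fin (n + 1)) :
    collapse s t v = x ↔ v = t.succAbove x ∨ (t.succAbove x = s ∧ v = t) := by
  have hx : collapse s t (t.succAbove x) = x := by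
    simp [collapse, Fin.succAbove_ne, rank_succAbove]
  conv_lhs => rw [← hx, collapse_eq_iff h]
  have := Fin.succAbove_ne t x
  tauto

lemma LegGraph.three_le_valence_contract {Γ : LegGraph (n + 2) (m + 1) r} (h : ∀ v, 3 ≤ Γ.valence v)
    (e : Fin (m + 1)) (he : Γ.src e ≠ Γ.tgt e) (x : Fin (n + 1)) :
    3 ≤ (Γ.contract e).valence x := by
  have hv := h ((Γ.tgt e).succAbove x)
  have ht := h (Γ.tgt e)
  unfold LegGraph.valence at *
  simp only [Finset.card_filter] at *
  rw [Fin.sum_univ_succAbove _ e] at hv ht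
  rw [Fin.sum_univ_succAbove (fun i => if Γ.tgt i = _ then 1 else 0) e] at hv ht
  simp only [LegGraph.contract, collapse_eq_iff_mem he]
  have hne := Fin.succAbove_ne (Γ.tgt e) x
  by_cases hs : (Γ.tgt e).succAbove x = Γ.src e
  · have split : ∀ v, (if v = (Γ.tgt e).succAbove x ∨
        ((Γ.tgt e).succAbove x = Γ.src e ∧ v = Γ.tgt e) then 1 else 0)
        = (if v = (Γ.tgt e).succAbove x then 1 else 0) + (if v = Γ.tgt e then 1 else 0) := by
      intro v
      split_ifs <;> simp_all
    simp only [split, Finset.sum_add_distrib]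
    rw [if_pos hs.symm, if_neg hne.symm] at hv
    rw [if_neg he, if_pos rfl] at ht
    omega
  · simp only [hs, false_and, or_false]
    rw [if_neg (Ne.symm hs), if_neg hne.symm] at hv
    omega

lemma LegGraph.not_simple_contract {Γ : LegGraph (n + 2) (m + 1) r} (h : ¬ Γ.Simple) (e : Fin (m + 1))
    (he : Γ.src e ≠ Γ.tgt e) : ¬ (Γ.contract e).Simple := by
  contrapose! h
  obtain ⟨h1, h2⟩ := h
  have loop : ∀ j, j ≠ e → Γ.src j ≠ Γ.tgt j ∧ ¬ Γ.Parallel j e := by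
    intro j hj
    obtain ⟨k, rfl⟩ := Fin.exists_succAbove_eq hj
    have := h1 k
    simp only [LegGraph.contract, ne_eq, collapse_eq_iff he] at this
    unfold LegGraph.Parallel
    tauto
  constructor
  · intro j
    by_cases hj : j = e
    · exact hj ▸ he
    · exact (loop j hj).1
  · intro j k hjk
    by_cases hj : j = e
    · subst hj
      have := (loop k hjk.symm).2
      unfold LegGraph.Parallel at *
      grind
    by_cases hk : k = e
    · subst hk
      exact (loop j hjk).2
    obtain ⟨j, rfl⟩ := Fin.exists_succAbove_eq hj
    obtain ⟨k, rfl⟩ := Fin.exists_succAbove_eq hk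
    have := h2 j k (fun h => hjk (h ▸ rfl))
    contrapose! this
    unfold LegGraph.Parallel at *
    simp only [LegGraph.contract]
    rcases this with ⟨h, h'⟩ | ⟨h, h'⟩ <;> simp [h, h']

lemma rank_rank {b d v : Fin (n + 3)} (h : b ≠ d) (hb : v ≠ b) (hd : v ≠ d) :
    rank (rank b d) (rank b v) = rank (rank d b) (rank d v) := by
  have h' : (b : ℕ) ≠ d := fun h' => h (Fin.ext h')
  have hb' : (v : ℕ) ≠ b := fun h' => hb (Fin.ext h')
  have hd' : (v : ℕ) ≠ d := fun h' => hd (Fin.ext h')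
  ext
  simp only [rank]
  split_ifs <;> omega

lemma sign_rank {b d : Fin (n + 3)} (h : b ≠ d) :
    (-1 : ℤˣ) ^ (b : ℕ) * (-1) ^ (rank b d : ℕ)
      = -((-1) ^ (d : ℕ) * (-1) ^ (rank d b : ℕ)) := by
  have h' : (b : ℕ) ≠ d := fun h' => h (Fin.ext h')
  simp only [rank]
  rcases lt_or_gt_of_ne h' with h1 | h1
  · rw [if_neg (by omega), if_pos h1]
    obtain ⟨k, hk⟩ : ∃ k, (d : ℕ) = k + 1 := ⟨d - 1, by omega⟩
    rw [hk]
    simp [pow_succ, mul_comm]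
  · rw [if_pos h1, if_neg (by omega)]
    obtain ⟨k, hk⟩ : ∃ k, (b : ℕ) = k + 1 := ⟨b - 1, by omega⟩
    rw [hk]
    simp [pow_succ, mul_comm]

lemma collapse_collapse {a b c d : Fin (n + 3)} (hab : a ≠ b) (hcd : c ≠ d) (hbd : b ≠ d)
    (hp : ¬ (a = d ∧ b = c)) (v : Fin (n + 3)) :
    collapse (collapse a b c) (collapse a b d) (collapse a b v)
      = collapse (collapse c d a) (collapse c d b) (collapse c d v) := by
  have e1 : collapse (collapse a b c) (collapse a b d) (collapse a b v)
      = rank (rank b d) (rank b (if (if v = b then a else v) = d then (if c = b then a else c)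
          else (if v = b then a else v))) := by
    unfold collapse
    rw [if_neg hbd.symm]
    by_cases h : (if v = b then a else v) = d
    · rw [if_pos (by rw [h]), if_pos h]
    · rw [if_neg, if_neg h]
      rw [rank_inj (by split_ifs <;> assumption) hbd.symm]
      exact h
  have e2 : collapse (collapse c d a) (collapse c d b) (collapse c d v)
      = rank (rank d b) (rank d (if (if v = d then c else v) = b then (if a = d then c else a)
          else (if v = d then c else v))) := by
    unfold collapse
    rw [if_neg hbd]
    by_cases h : (if v = d then c else v) = b
    · rw [if_pos (by rw [h]), if_pos h]
    · rw [if_neg, if_neg h]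
      rw [rank_inj (by split_ifs <;> assumption) hbd]
      exact h
  rw [e1, e2, rank_rank hbd (by grind) (by grind)]
  congr 2
  grind

/-- Two successive contractions in either order agree if the two heads are different. -/
lemma contract_contract {Γ : LegGraph (n + 3) (m + 2) r} (e : Fin (m + 2)) (f : Fin (m + 1))
    (he : Γ.src e ≠ Γ.tgt e) (hf : Γ.src (e.succAbove f) ≠ Γ.tgt (e.succAbove f))
    (hp : ¬ Γ.Parallel e (e.succAbove f)) (ht : Γ.tgt e ≠ Γ.tgt (e.succAbove f)) :
    (Γ.contract e).contract f
        = (Γ.contract (e.succAbove f)).contract (f.predAbove e) ∧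
      (-1 : ℤˣ) ^ (Γ.tgt e : ℕ) * (-1) ^ ((Γ.contract e).tgt f : ℕ)
        = - ((-1) ^ (Γ.tgt (e.succAbove f) : ℕ) *
            (-1) ^ ((Γ.contract (e.succAbove f)).tgt (f.predAbove e) : ℕ)) := by
  have hE : (e.succAbove f).succAbove (f.predAbove e) = e := Fin.succAbove_succAbove_predAbove e f
  have hcomm : ∀ v, collapse ((Γ.contract e).src f) ((Γ.contract e).tgt f)
        (collapse (Γ.src e) (Γ.tgt e) v)
      = collapse ((Γ.contract (e.succAbove f)).src (f.predAbove e))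
          ((Γ.contract (e.succAbove f)).tgt (f.predAbove e))
          (collapse (Γ.src (e.succAbove f)) (Γ.tgt (e.succAbove f)) v) := by
    intro v
    simp only [LegGraph.contract, hE]
    exact collapse_collapse he hf ht (fun h => hp (Or.inr h)) v
  have hedge : ∀ j, (e.succAbove f).succAbove ((f.predAbove e).succAbove j)
      = e.succAbove (f.succAbove j) := Fin.succAbove_succAbove_succAbove_predAbove e f
  constructor
  · ext j
    · have := hcomm (Γ.src (e.succAbove (f.succAbove j)))
      rw [← hedge] at this
      simpa only [LegGraph.contract, hedge] using congrArg Fin.val this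
    · have := hcomm (Γ.tgt (e.succAbove (f.succAbove j)))
      rw [← hedge] at this
      simpa only [LegGraph.contract, hedge] using congrArg Fin.val this
    · exact congrArg Fin.val (hcomm (Γ.leg j))
  · have := sign_rank ht
    simp only [LegGraph.contract, hE, collapse, if_neg ht, if_neg ht.symm]
    exact this

/-- Reversing one edge. -/
def reverse (Γ : LegGraph n m r) (e : Fin m) : LegGraph n m r where
  src := Function.update Γ.src e (Γ.tgt e)
  tgt := Function.update Γ.tgt e (Γ.src e)
  leg := Γ.leg

lemma isIso_reverse (Γ : LegGraph n m r) (e : Fin m) : IsIso Γ (reverse Γ e) 1 (-1) := by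
  refine ⟨1, fun j => decide (j = e), ?_, ?_, fun _ => rfl, ?_⟩
  · intro j
    by_cases h : j = e
    · subst h; simp [reverse]
    · simp [reverse, h]
  · intro j
    by_cases h : j = e
    · subst h; simp [reverse]
    · simp [reverse, h]
  · simp

lemma contract_loop_iff {Γ : LegGraph (n + 2) (m + 2) r} (e : Fin (m + 2)) (f : Fin (m + 1))
    (he : Γ.src e ≠ Γ.tgt e) : (Γ.contract e).src f ≠ (Γ.contract e).tgt f ↔
      Γ.src (e.succAbove f) ≠ Γ.tgt (e.succAbove f) ∧ ¬ Γ.Parallel e (e.succAbove f) := by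
  simp only [LegGraph.contract, ne_eq, collapse_eq_iff he]
  unfold LegGraph.Parallel
  grind

lemma LegGraph.IsIso.symm {Γ Γ' : LegGraph n m r} {τ : Equiv.Perm (Fin m)} {s : ℤˣ}
    (h : IsIso Γ Γ' τ s) : IsIso Γ' Γ τ⁻¹ s := by
  obtain ⟨σ, φ, hs, ht, hl, rfl⟩ := h
  refine ⟨σ⁻¹, fun j => φ (τ⁻¹ j), ?_, ?_, ?_, ?_⟩
  · intro j
    obtain ⟨k, rfl⟩ := τ.surjective j
    simp only [Equiv.Perm.inv_def, Equiv.symm_apply_apply, hs, ht]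
    split_ifs <;> simp
  · intro j
    obtain ⟨k, rfl⟩ := τ.surjective j
    simp only [Equiv.Perm.inv_def, Equiv.symm_apply_apply, hs, ht]
    split_ifs <;> simp
  · intro l
    simp [hl]
  · rw [Equiv.Perm.sign_inv, Equiv.prod_comp τ⁻¹ (fun j => if φ j then (-1 : ℤˣ) else 1)]

lemma LegGraph.IsIso.trans {Γ Γ' Γ'' : LegGraph n m r} {τ τ' : Equiv.Perm (Fin m)} {s s' : ℤˣ}
    (h : IsIso Γ Γ' τ s) (h' : IsIso Γ' Γ'' τ' s') : IsIso Γ Γ'' (τ' * τ) (s' * s) := by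
  obtain ⟨σ, φ, hs, ht, hl, rfl⟩ := h
  obtain ⟨σ', φ', hs', ht', hl', rfl⟩ := h'
  refine ⟨σ' * σ, fun j => xor (φ j) (φ' (τ j)), ?_, ?_, ?_, ?_⟩
  · intro j
    rcases h1 : φ j <;> rcases h2 : φ' (τ j) <;> simp [hs', hs, ht, h1, h2]
  · intro j
    rcases h1 : φ j <;> rcases h2 : φ' (τ j) <;> simp [ht', hs, ht, h1, h2]
  · intro l
    simp [hl, hl']
  · rw [← Equiv.prod_comp τ (fun j => if φ' j then (-1 : ℤˣ) else 1), Equiv.Perm.sign_mul,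
      mul_mul_mul_comm, ← Finset.prod_mul_distrib]
    congr 1
    refine Finset.prod_congr rfl fun j _ => ?_
    rcases h1 : φ j <;> rcases h2 : φ' (τ j) <;> simp [h1, h2]

lemma sign_aux (x1 x2 x3 x4 y1 y2 y3 y4 : ℤˣ) (h : y1 * y2 = -(y3 * y4)) :
    x3 * x4 * (-1 * (x3 * y3) * (x4 * y4) * (-1 * (x1 * y1) * (x2 * y2))) = -(x1 * x2) := by
  have e : x3 * x4 * (-1 * (x3 * y3) * (x4 * y4) * (-1 * (x1 * y1) * (x2 * y2)))
      = (x3 * x3) * (x4 * x4) * (y3 * y4) * (y1 * y2) * (x1 * x2) := by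
    simp only [neg_mul, one_mul, mul_neg, neg_neg]
    ac_rfl
  rw [e, h, mul_assoc (x3 * x3 * (x4 * x4)), mul_neg, Int.units_mul_self, Int.units_mul_self,
    Int.units_mul_self]
  simp

/-- Contracting two edges in either order gives isomorphic graphs, with opposite orientations. -/
lemma isIso_contract_contract {Γ : LegGraph (n + 3) (m + 2) r} (e : Fin (m + 2))
    (f : Fin (m + 1)) (he : Γ.src e ≠ Γ.tgt e)
    (hf : Γ.src (e.succAbove f) ≠ Γ.tgt (e.succAbove f))
    (hp : ¬ Γ.Parallel e (e.succAbove f)) :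
    ∃ τ s, IsIso ((Γ.contract e).contract f)
        ((Γ.contract (e.succAbove f)).contract (f.predAbove e)) τ s ∧
      (-1 : ℤˣ) ^ (Γ.tgt (e.succAbove f) : ℕ) *
            (-1) ^ ((Γ.contract (e.succAbove f)).tgt (f.predAbove e) : ℕ) * s
        = - ((-1 : ℤˣ) ^ (Γ.tgt e : ℕ) * (-1) ^ ((Γ.contract e).tgt f : ℕ)) := by
  have hE : (e.succAbove f).succAbove (f.predAbove e) = e := Fin.succAbove_succAbove_predAbove e f
  by_cases ht : Γ.tgt e = Γ.tgt (e.succAbove f)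
  · have hne : e.succAbove f ≠ e := Fin.succAbove_ne e f
    have hp' : ¬ Γ.Parallel (e.succAbove f) e := by
      unfold LegGraph.Parallel at *
      grind
    have hc1 := (contract_loop_iff e f he).2 ⟨hf, hp⟩
    have hc2 := (contract_loop_iff (e.succAbove f) (f.predAbove e) hf).2
      (by rw [hE]; exact ⟨he, hp'⟩)
    have h1 := ((isIso_reverse Γ e).contract e he).contract f hc1
    have h2 := ((isIso_reverse Γ e).contract (e.succAbove f) hf).contract (f.predAbove e) hc2
    simp only [delPerm_one, Equiv.Perm.one_apply] at h1 h2
    obtain ⟨h3, h4⟩ := contract_contract (Γ := reverse Γ e) e f (by simpa [reverse] using he.symm)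
      (by simpa [reverse, hne] using hf)
      (by
        unfold LegGraph.Parallel at *
        simp only [reverse, Function.update_self, Function.update_of_ne hne]
        tauto)
      (by
        simp only [reverse, Function.update_self, Function.update_of_ne hne]
        exact fun h => he (h.trans ht.symm))
    rw [h3] at h1
    refine ⟨_, _, h1.trans h2.symm, ?_⟩
    generalize (-1 : ℤˣ) ^ (Γ.tgt e : ℕ) = x1 at *
    generalize (-1 : ℤˣ) ^ ((Γ.contract e).tgt f : ℕ) = x2 at *
    generalize (-1 : ℤˣ) ^ (Γ.tgt (e.succAbove f) : ℕ) = x3 at *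
    generalize (-1 : ℤˣ) ^ ((Γ.contract (e.succAbove f)).tgt (f.predAbove e) : ℕ) = x4 at *
    generalize (-1 : ℤˣ) ^ ((reverse Γ e).tgt e : ℕ) = y1 at *
    generalize (-1 : ℤˣ) ^ (((reverse Γ e).contract e).tgt f : ℕ) = y2 at *
    generalize (-1 : ℤˣ) ^ ((reverse Γ e).tgt (e.succAbove f) : ℕ) = y3 at *
    generalize (-1 : ℤˣ) ^
      (((reverse Γ e).contract (e.succAbove f)).tgt (f.predAbove e) : ℕ) = y4 at *
    clear h1 h2 h3
    exact sign_aux x1 x2 x3 x4 y1 y2 y3 y4 h4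
  · obtain ⟨h1, h2⟩ := contract_contract e f he hf hp ht
    refine ⟨1, 1, ?_, ?_⟩
    · rw [h1]
      exact ⟨1, fun _ => false, by simp, by simp, by simp, by simp⟩
    · rw [h2]; simp

end Lemmas

noncomputable section Complex

open LegGraph

/-- The generators with `i + 1` vertices for genus (loop order) `g` and `r` legs: connected graphs
all of whose vertices have valence at least `3`. The number of edges is `(i + 1) + g - 1`. -/
abbrev Gen (g r i : ℕ) : Type :=
  {Γ : LegGraph (i + 1) (g + i) r // Γ.Connected ∧ ∀ v, 3 ≤ Γ.valence v}

/-- The span of the differences between `Γ'` and `± Γ`, for all isomorphisms `Γ → Γ'`. -/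
def relations (g r i : ℕ) : Submodule ℚ (Gen g r i →₀ ℚ) :=
  Submodule.span ℚ {x | ∃ (Γ Γ' : Gen g r i) (τ : Equiv.Perm (Fin (g + i))) (s : ℤˣ),
    IsIso Γ.1 Γ'.1 τ s ∧ x = Finsupp.single Γ' 1 - Finsupp.single Γ ((s : ℤ) : ℚ)}

/-- The space of graphs with `i + 1` vertices in `Feyn_𝔨(Com_𝔨)(g,r)`. -/
abbrev Graphs (g r i : ℕ) : Type := (Gen g r i →₀ ℚ) ⧸ relations g r i

variable {g r i : ℕ}

/-- The class of a graph. -/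
def cl (Γ : Gen g r i) : Graphs g r i := (relations g r i).mkQ (Finsupp.single Γ 1)

/-- Contraction of an edge which is not a self-edge. -/
def Gen.contract (Γ : Gen g r (i + 1)) (e : Fin (g + (i + 1)))
    (he : Γ.1.src e ≠ Γ.1.tgt e) : Gen g r i :=
  ⟨LegGraph.contract (m := g + i) Γ.1 e,
    Connected.contract (m := g + i) Γ.2.1 e he, three_le_valence_contract (m := g + i) Γ.2.2 e he⟩

/-- The summand of the differential that contracts the edge `e`, zero for self-edges. The sign is
the one that moves the head of `e`, which is deleted, to the front of the ordering of the
vertices. -/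
def contractTerm (Γ : Gen g r (i + 1)) (e : Fin (g + (i + 1))) : Graphs g r i :=
  if he : Γ.1.src e ≠ Γ.1.tgt e then (-1 : ℚ) ^ (Γ.1.tgt e : ℕ) • cl (Γ.contract e he) else 0

lemma cl_eq_of_isIso {Γ Γ' : Gen g r i} {τ : Equiv.Perm (Fin (g + i))} {s : ℤˣ}
    (h : IsIso Γ.1 Γ'.1 τ s) : cl Γ' = ((s : ℤ) : ℚ) • cl Γ := by
  unfold cl
  rw [← map_smul, ← sub_eq_zero, ← map_sub, Submodule.mkQ_apply, Submodule.Quotient.mk_eq_zero]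
  refine Submodule.subset_span ⟨Γ, Γ', τ, s, h, by simp⟩

lemma contractTerm_of_isIso {Γ Γ' : Gen g r (i + 1)} {τ : Equiv.Perm (Fin (g + (i + 1)))} {s : ℤˣ}
    (h : IsIso Γ.1 Γ'.1 τ s) (e : Fin (g + (i + 1))) :
    contractTerm Γ' (τ e) = ((s : ℤ) : ℚ) • contractTerm Γ e := by
  unfold contractTerm
  by_cases he : Γ.1.src e ≠ Γ.1.tgt e
  · have he' := (h.ne_iff e).2 he
    rw [dif_pos he, dif_pos he']
    have := IsIso.contract (m := g + i) h e he
    rw [cl_eq_of_isIso (Γ := Γ.contract e he) (Γ' := Γ'.contract (τ e) he') this, smul_smul,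
      smul_smul]
    congr 1
    push_cast
    rcases neg_one_pow_eq_or ℚ (Γ.1.tgt e : ℕ) with h1 | h1 <;>
    rcases neg_one_pow_eq_or ℚ (Γ'.1.tgt (τ e) : ℕ) with h2 | h2 <;> simp [h1, h2]
  · have he' := mt (h.ne_iff e).1 he
    rw [dif_neg he, dif_neg he', smul_zero]

lemma relations_le_ker {M : Type} [AddCommGroup M] [Module ℚ M] (f : Gen g r i → M)
    (hf : ∀ (Γ Γ' : Gen g r i) (τ : Equiv.Perm (Fin (g + i))) (s : ℤˣ),
      IsIso Γ.1 Γ'.1 τ s → f Γ' = ((s : ℤ) : ℚ) • f Γ) :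
    relations g r i ≤ LinearMap.ker (Finsupp.linearCombination ℚ f) := by
  refine Submodule.span_le.2 ?_
  rintro _ ⟨Γ, Γ', τ, s, h, rfl⟩
  simp [hf Γ Γ' τ s h]

/-- The differential: the sum over all edge contractions. -/
def diff (g r i : ℕ) : Graphs g r (i + 1) →ₗ[ℚ] Graphs g r i :=
  (relations g r (i + 1)).liftQ (Finsupp.linearCombination ℚ fun Γ => ∑ e, contractTerm Γ e) <|
    relations_le_ker _ fun Γ Γ' τ s h => by
      rw [← Equiv.sum_comp τ, Finset.smul_sum]
      exact Finset.sum_congr rfl fun e _ => contractTerm_of_isIso h e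

lemma diff_cl (Γ : Gen g r (i + 1)) : diff g r i (cl Γ) = ∑ e, contractTerm Γ e := by
  simp [diff, cl]

/-- Two successive contractions. -/
def contractTerm₂ (Γ : Gen g r (i + 2)) (e : Fin (g + i + 2)) (f : Fin (g + i + 1)) :
    Graphs g r i :=
  if he : Γ.1.src e ≠ Γ.1.tgt e then
    (-1 : ℚ) ^ (Γ.1.tgt e : ℕ) • contractTerm (Γ.contract e he) f else 0

lemma contractTerm₂_swap (Γ : Gen g r (i + 2)) (e : Fin (g + i + 2)) (f : Fin (g + i + 1)) :
    contractTerm₂ Γ (e.succAbove f) (f.predAbove e) = - contractTerm₂ Γ e f := by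
  have hE : (e.succAbove f).succAbove (f.predAbove e) = e := Fin.succAbove_succAbove_predAbove e f
  have hpar : Γ.1.Parallel (e.succAbove f) e ↔ Γ.1.Parallel e (e.succAbove f) := by
    unfold LegGraph.Parallel
    grind
  by_cases he : Γ.1.src e ≠ Γ.1.tgt e
  · have l1 : (Γ.contract e he).1.src f ≠ (Γ.contract e he).1.tgt f ↔ _ :=
      contract_loop_iff (Γ := Γ.1) (n := i + 1) (m := g + i) e f he
    by_cases hf : Γ.1.src (e.succAbove f) ≠ Γ.1.tgt (e.succAbove f)
    · have l2 : (Γ.contract _ hf).1.src (f.predAbove e) ≠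
          (Γ.contract _ hf).1.tgt (f.predAbove e) ↔ _ := contract_loop_iff (Γ := Γ.1) (n := i + 1) (m := g + i) (e.succAbove f)
        (f.predAbove e) hf
      rw [hE, hpar] at l2
      unfold contractTerm₂
      rw [dif_pos he, dif_pos hf]
      unfold contractTerm
      by_cases hp : Γ.1.Parallel e (e.succAbove f)
      · rw [dif_neg, dif_neg, smul_zero, smul_zero, neg_zero]
        · exact fun h => (l1.1 h).2 hp
        · exact fun h => (l2.1 h).2 hp
      · have c1 := l1.2 ⟨hf, hp⟩
        have c2 := l2.2 ⟨he, hp⟩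
        obtain ⟨τ, s, h1, h2⟩ := isIso_contract_contract (Γ := Γ.1) (n := i) (m := g + i) e f he hf hp
        rw [dif_pos c2, dif_pos c1, smul_smul, smul_smul,
          cl_eq_of_isIso (Γ := (Γ.contract e he).contract f c1)
            (Γ' := (Γ.contract _ hf).contract (f.predAbove e) c2) h1, smul_smul, ← neg_smul]
        congr 1
        have := congrArg (fun x : ℤˣ => ((x : ℤ) : ℚ)) h2
        push_cast at this
        exact this
    · unfold contractTerm₂
      rw [dif_pos he, dif_neg hf]
      unfold contractTerm
      rw [dif_neg (fun h => hf (l1.1 h).1), smul_zero, neg_zero]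
  · unfold contractTerm₂
    rw [dif_neg he, neg_zero]
    by_cases hf : Γ.1.src (e.succAbove f) ≠ Γ.1.tgt (e.succAbove f)
    · have l2 : (Γ.contract _ hf).1.src (f.predAbove e) ≠
          (Γ.contract _ hf).1.tgt (f.predAbove e) ↔ _ := contract_loop_iff (Γ := Γ.1) (n := i + 1) (m := g + i) (e.succAbove f)
        (f.predAbove e) hf
      rw [hE] at l2
      rw [dif_pos hf]
      unfold contractTerm
      rw [dif_neg (fun h => he (l2.1 h).1), smul_zero]
    · rw [dif_neg hf]

lemma diff_contractTerm (Γ : Gen g r (i + 2)) (e : Fin (g + i + 2)) :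
    diff g r i (contractTerm Γ e) = ∑ f, contractTerm₂ Γ e f := by
  unfold contractTerm contractTerm₂
  split_ifs
  · rw [map_smul, diff_cl, Finset.smul_sum]
    rfl
  · simp

lemma graphs_induction (p : Graphs g r i → Prop) (h0 : p 0) (hadd : ∀ x y, p x → p y → p (x + y))
    (hsmul : ∀ (c : ℚ) Γ, p (c • cl Γ)) (x : Graphs g r i) : p x := by
  obtain ⟨x, rfl⟩ := (relations g r i).mkQ_surjective x
  induction x using Finsupp.induction_linear with
  | zero => simpa using h0
  | add x y hx hy => rw [map_add]; exact hadd _ _ hx hy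
  | single Γ c =>
    have := hsmul c Γ
    unfold cl at this
    rwa [← map_smul, Finsupp.smul_single_one] at this

lemma diff_diff (x : Graphs g r (i + 2)) : diff g r i (diff g r (i + 1) x) = 0 := by
  refine graphs_induction (fun x => diff g r i (diff g r (i + 1) x) = 0)
    (by simp) (fun x y hx hy => by simp [hx, hy]) (fun c Γ => ?_) x
  rw [map_smul, map_smul, diff_cl, map_sum]
  have : ∑ e, diff g r i (contractTerm Γ e)
      = ∑ p : Fin (g + i + 2) × Fin (g + i + 1), contractTerm₂ Γ p.1 p.2 := by
    rw [Fintype.sum_prod_type]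
    exact Finset.sum_congr rfl fun e _ => diff_contractTerm Γ e
  rw [this]
  set S := ∑ p : Fin (g + i + 2) × Fin (g + i + 1), contractTerm₂ Γ p.1 p.2 with hS
  let ι : Fin (g + i + 2) × Fin (g + i + 1) → Fin (g + i + 2) × Fin (g + i + 1) :=
    fun p => (p.1.succAbove p.2, p.2.predAbove p.1)
  have hι : Function.Involutive ι := fun p => Prod.ext
    (Fin.succAbove_succAbove_predAbove p.1 p.2) (Fin.predAbove_predAbove_succAbove p.1 p.2)
  have h2 : S = -S := by
    conv_lhs => rw [hS, ← Equiv.sum_comp (Function.Involutive.toPerm ι hι)]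
    rw [hS, ← Finset.sum_neg_distrib]
    exact Finset.sum_congr rfl fun p _ => contractTerm₂_swap Γ p.1 p.2
  have h3 : (2 : ℚ) • S = 0 := by
    rw [two_smul]
    nth_rewrite 1 [h2]
    simp
  rw [(smul_eq_zero.1 h3).resolve_left (by norm_num), smul_zero]

/-- The span of the graphs with self-edges or multiple edges. -/
def nonSimple (g r i : ℕ) : Submodule ℚ (Graphs g r i) :=
  Submodule.span ℚ {x | ∃ Γ : Gen g r i, ¬ Γ.1.Simple ∧ x = cl Γ}

lemma nonSimple_le (g r i : ℕ) :
    nonSimple g r (i + 1) ≤ (nonSimple g r i).comap (diff g r i) := by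
  refine Submodule.span_le.2 ?_
  rintro _ ⟨Γ, hΓ, rfl⟩
  rw [SetLike.mem_coe, Submodule.mem_comap, diff_cl]
  refine Submodule.sum_mem _ fun e _ => ?_
  unfold contractTerm
  split_ifs with he
  · exact Submodule.smul_mem _ _ (Submodule.subset_span
      ⟨_, not_simple_contract (m := g + i) hΓ e he, rfl⟩)
  · exact Submodule.zero_mem _

/-- The quotient by the graphs with self-edges or multiple edges. -/
abbrev SimpleGraphs (g r i : ℕ) : Type := Graphs g r i ⧸ nonSimple g r i

/-- The differential on the quotient. -/
def simpleDiff (g r i : ℕ) : SimpleGraphs g r (i + 1) →ₗ[ℚ] SimpleGraphs g r i :=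
  (nonSimple g r (i + 1)).mapQ (nonSimple g r i) (diff g r i) (nonSimple_le g r i)

lemma simpleDiff_simpleDiff (x : SimpleGraphs g r (i + 2)) :
    simpleDiff g r i (simpleDiff g r (i + 1) x) = 0 := by
  obtain ⟨x, rfl⟩ := (nonSimple g r (i + 2)).mkQ_surjective x
  simp [simpleDiff, diff_diff]

open CategoryTheory

/-- The complex `Feyn_𝔨(Com_𝔨)(g,r)`, indexed by the number of vertices minus one. -/
def chain (g r : ℕ) : ChainComplex (ModuleCat.{0} ℚ) ℕ :=
  ChainComplex.of (fun i => ModuleCat.of ℚ (Graphs g r i))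
    (fun i => ModuleCat.ofHom (diff g r i)) fun _ =>
      ModuleCat.hom_ext (LinearMap.ext fun x => diff_diff x)

/-- The complex `Feyn_𝔨ˢ(Com_𝔨)(g,r)`, indexed by the number of vertices minus one. -/
def simpleChain (g r : ℕ) : ChainComplex (ModuleCat.{0} ℚ) ℕ :=
  ChainComplex.of (fun i => ModuleCat.of ℚ (SimpleGraphs g r i))
    (fun i => ModuleCat.ofHom (simpleDiff g r i)) fun _ =>
      ModuleCat.hom_ext (LinearMap.ext fun x => simpleDiff_simpleDiff x)

lemma chain_d (g r i : ℕ) : (chain g r).d (i + 1) i = ModuleCat.ofHom (diff g r i) :=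
  ChainComplex.of_d (fun i => ModuleCat.of ℚ (Graphs g r i))
    (fun i => ModuleCat.ofHom (diff g r i)) i

lemma simpleChain_d (g r i : ℕ) :
    (simpleChain g r).d (i + 1) i = ModuleCat.ofHom (simpleDiff g r i) :=
  ChainComplex.of_d (fun i => ModuleCat.of ℚ (SimpleGraphs g r i))
    (fun i => ModuleCat.ofHom (simpleDiff g r i)) i

/-- The projection to the quotient, indexed by the number of vertices minus one. -/
def chainProj (g r : ℕ) : chain g r ⟶ simpleChain g r :=
  ChainComplex.ofHom (X := chain g r) (Y := simpleChain g r)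
    (fun i => ModuleCat.ofHom (nonSimple g r i).mkQ) fun i => by
      rw [chain_d, simpleChain_d]
      rfl

/-- The cohomological degree `∑_v (valence v - 3) = 2 E + r - 3 V` of a graph with
`V = i + 1` vertices and `E = g + i` edges is `2 g + r - 3 - i`. -/
def degreeEmbedding (g r : ℕ) :
    ComplexShape.Embedding (ComplexShape.down ℕ) (ComplexShape.up ℤ) where
  f i := 2 * (g : ℤ) + r - 3 - i
  injective_f i j h := by
    simp only at h
    omega
  rel {i j} h := by
    simp only [ComplexShape.down_Rel, ComplexShape.up_Rel] at h ⊢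
    omega

/-- The cochain complex `Feyn_𝔨(Com_𝔨)(g,r)` of graphs with legs, in its cohomological grading. -/
def feyn (g r : ℕ) : CochainComplex (ModuleCat.{0} ℚ) ℤ :=
  (chain g r).extend (degreeEmbedding g r)

/-- The cochain complex `Feyn_𝔨ˢ(Com_𝔨)(g,r)`, the quotient by the non-simple graphs. -/
def simpleFeyn (g r : ℕ) : CochainComplex (ModuleCat.{0} ℚ) ℤ :=
  (simpleChain g r).extend (degreeEmbedding g r)

/-- The projection `Feyn_𝔨(Com_𝔨)(g,r) ⟶ Feyn_𝔨ˢ(Com_𝔨)(g,r)`. -/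
def feynProj (g r : ℕ) : feyn g r ⟶ simpleFeyn g r :=
  HomologicalComplex.extendMap (chainProj g r) (degreeEmbedding g r)

/-- A graph as an element of the complex, in its cohomological degree. -/
def graphElem {g r i : ℕ} (Γ : Gen g r i) : (feyn g r).X (2 * (g : ℤ) + r - 3 - i) :=
  ((chain g r).extendXIso (degreeEmbedding g r)
    (show (degreeEmbedding g r).f i = 2 * (g : ℤ) + r - 3 - i from rfl)).inv (cl Γ)

/-- The element `x` of degree `k` is a cocycle whose class is a basis of the total cohomology
of `K`; in symbols `H(K) = ℚ x`. -/
def CohomologySpannedBy (K : CochainComplex (ModuleCat.{0} ℚ) ℤ) {k : ℤ} (x : K.X k) : Prop :=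
  (∃ z : K.cycles k, K.iCycles k z = x ∧
    ∀ y : K.homology k, ∃! c : ℚ, y = c • K.homologyπ k z) ∧
  ∀ j : ℤ, j ≠ k → Limits.IsZero (K.homology j)

end Complex

section Examples

open LegGraph

lemma connected_of_edge {m r : ℕ} {Γ : LegGraph 2 m r} (j : Fin m) (hs : Γ.src j = 0)
    (ht : Γ.tgt j = 1) : Γ.Connected := by
  have h : Relation.EqvGen (fun a b => ∃ j, Γ.src j = a ∧ Γ.tgt j = b) 0 1 := .rel _ _ ⟨j, hs, ht⟩
  intro u v
  fin_cases u <;> fin_cases v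
  exacts [.refl _, h, h.symm, .refl _]

/-- The theta graph: two vertices joined by three edges, without legs. -/
def theta : Gen 2 0 1 :=
  ⟨⟨fun _ => 0, fun _ => 1, fun l => l.elim0⟩, connected_of_edge 0 rfl rfl, by decide⟩

/-- The theta graph with one leg. -/
def thetaLeg : Gen 2 1 1 :=
  ⟨⟨fun _ => 0, fun _ => 1, fun _ => 0⟩, connected_of_edge 0 rfl rfl, by decide⟩

/-- The double edge with one leg at each of its two vertices. -/
def doubleEdge : Gen 1 2 1 :=
  ⟨⟨fun _ => 0, fun _ => 1, fun l => l⟩, connected_of_edge 0 rfl rfl, by decide⟩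

end Examples

end OddGraph

/-! Reversing a self-edge is an odd automorphism, so graphs with self-edges vanish and the kernel of
the projection is spanned by loopless graphs with multiple edges. By the long exact sequence it
suffices that this kernel is acyclic outside the three exceptional cases.

The contracting homotopy (`homotopy`) runs over ordered pairs of vertices `(a, b)` joined by several
edges. It splits `a`, moving two of these parallel edges to a new vertex attached to `a` by one
edge; the weight is the number `pairs` of disjoint pairs of parallel edges. There is one
modification. If `b` carries a triple edge and nothing else (`Antenna`), moving two edges produces a
graph with an odd automorphism (`isIso_split_of_valence_eq_three`), so all three are moved.

The complex is filtered by `weight`, which counts pairs of parallel edges and antennas. Neither the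
differential nor the homotopy lowers it (`diff_mem_fil`, `homotopy_mem_fil`). Modulo higher weight,
contractions of old edges cancel between `d h` and `h d`, and two diagonal contributions survive:
splitting `a` and contracting the new edge, and, if exactly one half-edge at `a` is not moved and it
belongs to an edge outside the bundle, contracting that edge and splitting it off again. Hence the
Laplacian `d h + h d` is triangular with the natural numbers `eigenvalue` on the diagonal
(`laplacian_cl`).

A graph with multiple edges and eigenvalue zero has two vertices and the numbers of edges and legs
of the theta graph, the theta graph with a leg, or the double edge with two legs
(`eq_two_of_eigenvalue_eq_zero`). In all other cases a polynomial in the Laplacian with nonzero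
constant term kills the non-simple graphs, so the Laplacian is invertible there and the complex is
acyclic (`exists_diff_eq_of_mem_nonSimple`).

In the exceptional cases the whole complex is a line in one degree, spanned by a non-simple graph.
Valence counts remove almost all other degrees; three vertices in the case `(2, 1)` need the
Laplacian once more (`subsingleton_graphs_two_one_two`). -/

namespace OddGraph

/-! ### Bundles of parallel edges, splitting of vertices, and isomorphisms -/

namespace LegGraph

variable {n m r : ℕ}

/-- The edges that join two given vertices. -/
def bundle (Γ : LegGraph n m r) (a b : Fin n) : Finset (Fin m) :=
  Finset.univ.filter fun j => (Γ.src j = a ∧ Γ.tgt j = b) ∨ (Γ.src j = b ∧ Γ.tgt j = a)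

/-- The number of edges that join two given vertices. -/
def mult (Γ : LegGraph n m r) (a b : Fin n) : ℕ := (Γ.bundle a b).card

/-- There are no self-edges. -/
def Loopless (Γ : LegGraph n m r) : Prop := ∀ j, Γ.src j ≠ Γ.tgt j

/-- A new vertex `0` is joined by a new edge `0` to the vertex `a`, and the half-edges at `a` of the
edges in `S` are moved to it. -/
def split (Γ : LegGraph n m r) (a : Fin n) (S : Finset (Fin m)) : LegGraph (n + 1) (m + 1) r where
  src := Fin.cons a.succ fun j => if j ∈ S ∧ Γ.src j = a then 0 else (Γ.src j).succ
  tgt := Fin.cons 0 fun j => if j ∈ S ∧ Γ.tgt j = a then 0 else (Γ.tgt j).succ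
  leg l := (Γ.leg l).succ

lemma mem_bundle {Γ : LegGraph n m r} {a b : Fin n} {j : Fin m} :
    j ∈ Γ.bundle a b ↔ (Γ.src j = a ∧ Γ.tgt j = b) ∨ (Γ.src j = b ∧ Γ.tgt j = a) := by
  simp [bundle]

lemma bundle_comm (Γ : LegGraph n m r) (a b : Fin n) : Γ.bundle a b = Γ.bundle b a := by
  ext j
  simp only [mem_bundle]
  tauto

lemma mult_comm (Γ : LegGraph n m r) (a b : Fin n) : Γ.mult a b = Γ.mult b a := by
  rw [mult, bundle_comm, mult]

@[simp] lemma split_src_zero (Γ : LegGraph n m r) (a : Fin n) (S : Finset (Fin m)) :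
    (Γ.split a S).src 0 = a.succ := rfl

@[simp] lemma split_tgt_zero (Γ : LegGraph n m r) (a : Fin n) (S : Finset (Fin m)) :
    (Γ.split a S).tgt 0 = 0 := rfl

@[simp] lemma split_src_succ (Γ : LegGraph n m r) (a : Fin n) (S : Finset (Fin m)) (j : Fin m) :
    (Γ.split a S).src j.succ = if j ∈ S ∧ Γ.src j = a then 0 else (Γ.src j).succ := rfl

@[simp] lemma split_tgt_succ (Γ : LegGraph n m r) (a : Fin n) (S : Finset (Fin m)) (j : Fin m) :
    (Γ.split a S).tgt j.succ = if j ∈ S ∧ Γ.tgt j = a then 0 else (Γ.tgt j).succ := rfl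

@[simp] lemma split_leg (Γ : LegGraph n m r) (a : Fin n) (S : Finset (Fin m)) (l : Fin r) :
    (Γ.split a S).leg l = (Γ.leg l).succ := rfl

lemma rank_zero_succ (v : Fin (n + 1)) : rank 0 v.succ = v := by
  have := rank_succAbove (0 : Fin (n + 2)) v
  simpa using this

lemma collapse_succ_zero_succ (a v : Fin (n + 1)) : collapse a.succ 0 v.succ = v := by
  simp [collapse, rank_zero_succ]

lemma collapse_succ_zero_zero (a : Fin (n + 1)) : collapse a.succ 0 0 = a := by
  simp [collapse, rank_zero_succ]

/-- The new edge of a split graph contracts to the original graph. -/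
lemma contract_split_zero (Γ : LegGraph (n + 1) m r) (a : Fin (n + 1)) (S : Finset (Fin m)) :
    (Γ.split a S).contract 0 = Γ := by
  ext j
  · simp only [contract, split_src_zero, split_tgt_zero, Fin.succAbove_zero, split_src_succ]
    split_ifs with h
    · rw [collapse_succ_zero_zero, h.2]
    · rw [collapse_succ_zero_succ]
  · simp only [contract, split_src_zero, split_tgt_zero, Fin.succAbove_zero, split_tgt_succ]
    split_ifs with h
    · rw [collapse_succ_zero_zero, h.2]
    · rw [collapse_succ_zero_succ]
  · simp only [contract, split_src_zero, split_tgt_zero, split_leg]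
    rw [collapse_succ_zero_succ]

lemma rank_succ_zero (t : Fin (n + 2)) : rank t.succ (0 : Fin (n + 3)) = 0 := by
  ext
  simp [rank]

lemma rank_succ_succ {t v : Fin (n + 2)} (h : v ≠ t) : rank t.succ v.succ = (rank t v).succ := by
  have h' : (v : ℕ) ≠ t := fun h' => h (Fin.ext h')
  ext
  simp only [rank, Fin.val_succ]
  split_ifs <;> omega

lemma collapse_succ_succ_zero (s t : Fin (n + 2)) : collapse s.succ t.succ 0 = 0 := by
  simp [collapse, rank_succ_zero, (Fin.succ_ne_zero t).symm]

lemma collapse_succ_succ_succ {s t : Fin (n + 2)} (h : s ≠ t) (v : Fin (n + 2)) :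
    collapse s.succ t.succ v.succ = (collapse s t v).succ := by
  unfold collapse
  simp only [Fin.succ_inj]
  split_ifs with hv
  · rw [rank_succ_succ h]
  · rw [rank_succ_succ hv]

/-- The set of edges after removal of the edge `e`. -/
def eraseEdge (S : Finset (Fin (m + 1))) (e : Fin (m + 1)) : Finset (Fin m) :=
  Finset.univ.filter fun j => e.succAbove j ∈ S

lemma mem_eraseEdge {S : Finset (Fin (m + 1))} {e : Fin (m + 1)} {j : Fin m} :
    j ∈ eraseEdge S e ↔ e.succAbove j ∈ S := by
  simp [eraseEdge]

lemma card_eraseEdge {S : Finset (Fin (m + 1))} {e : Fin (m + 1)} (h : e ∉ S) :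
    (eraseEdge S e).card = S.card := by
  refine Finset.card_bij (fun j _ => e.succAbove j) (fun j hj => mem_eraseEdge.1 hj)
    (fun j _ k _ h => Fin.succAbove_right_injective h) fun k hk => ?_
  obtain ⟨j, rfl⟩ := Fin.exists_succAbove_eq (show k ≠ e from fun h' => h (h' ▸ hk))
  exact ⟨j, mem_eraseEdge.2 hk, rfl⟩

/-- Splitting a vertex commutes with the contraction of another edge. -/
lemma contract_split_succ {Γ : LegGraph (n + 2) (m + 1) r} {a b : Fin (n + 2)}
    {S : Finset (Fin (m + 1))} {e : Fin (m + 1)} (hS : S ⊆ Γ.bundle a b) (he : e ∉ S)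
    (hne : Γ.src e ≠ Γ.tgt e)
    (hab : collapse (Γ.src e) (Γ.tgt e) a ≠ collapse (Γ.src e) (Γ.tgt e) b) :
    (Γ.split a S).contract e.succ
      = (Γ.contract e).split (collapse (Γ.src e) (Γ.tgt e) a) (eraseEdge S e) := by
  have hab' : a ≠ b := fun h => hab (h ▸ rfl)
  -- Edges of `S` have ends `a` and `b`, which stay distinct after the contraction, so the test
  -- whether an end is `a` gives the same answer before and after.
  have key : ∀ j ∈ S, ((Γ.src j = a ↔ collapse (Γ.src e) (Γ.tgt e) (Γ.src j) =
      collapse (Γ.src e) (Γ.tgt e) a)) ∧ ((Γ.tgt j = a ↔ collapse (Γ.src e) (Γ.tgt e) (Γ.tgt j) =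
      collapse (Γ.src e) (Γ.tgt e) a)) := by
    intro j hj
    rcases mem_bundle.1 (hS hj) with ⟨h1, h2⟩ | ⟨h1, h2⟩ <;> rw [h1, h2] <;>
      simp [hab'.symm, hab.symm]
  have hs : (Γ.split a S).src e.succ = (Γ.src e).succ := by simp [he]
  have ht : (Γ.split a S).tgt e.succ = (Γ.tgt e).succ := by simp [he]
  have hz : ∀ l, collapse (Γ.src e).succ (Γ.tgt e).succ l.succ =
      (collapse (Γ.src e) (Γ.tgt e) l).succ := collapse_succ_succ_succ hne
  ext1
  · funext j
    refine Fin.cases ?_ (fun j => ?_) j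
    · simp only [contract, hs, ht, Fin.succ_succAbove_zero, split_src_zero, hz]
    · simp only [contract, hs, ht, Fin.succ_succAbove_succ, split_src_succ, mem_eraseEdge]
      by_cases hj : e.succAbove j ∈ S
      · simp only [hj, true_and, (key _ hj).1]
        split_ifs <;> simp [collapse_succ_succ_zero, hz]
      · simp [hj, hz]
  · funext j
    refine Fin.cases ?_ (fun j => ?_) j
    · simp only [contract, hs, ht, Fin.succ_succAbove_zero, split_tgt_zero, collapse_succ_succ_zero]
    · simp only [contract, hs, ht, Fin.succ_succAbove_succ, split_tgt_succ, mem_eraseEdge]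
      by_cases hj : e.succAbove j ∈ S
      · simp only [hj, true_and, (key _ hj).2]
        split_ifs <;> simp [collapse_succ_succ_zero, hz]
      · simp [hj, hz]
  · funext l
    simp only [contract, hs, ht, split_leg, hz]

/-- The extension of a permutation by a fixed point `0`. -/
def consPerm (σ : Equiv.Perm (Fin n)) : Equiv.Perm (Fin (n + 1)) :=
  Equiv.Perm.decomposeFin.symm (0, σ)

@[simp] lemma consPerm_zero (σ : Equiv.Perm (Fin n)) : consPerm σ 0 = 0 := by
  simp [consPerm]

@[simp] lemma consPerm_succ (σ : Equiv.Perm (Fin n)) (x : Fin n) :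
    consPerm σ x.succ = (σ x).succ := by
  simp [consPerm, Equiv.Perm.decomposeFin_symm_apply_succ]

@[simp] lemma sign_consPerm (σ : Equiv.Perm (Fin n)) :
    Equiv.Perm.sign (consPerm σ) = Equiv.Perm.sign σ := by
  simp [consPerm, Equiv.Perm.decomposeFin.symm_sign]

/-- The isomorphism of graphs given by the permutations `σ` and `τ` of vertices and edges, which
reverses the edges in `φ`. -/
structure IsoVia (Γ Γ' : LegGraph n m r) (σ : Equiv.Perm (Fin n)) (τ : Equiv.Perm (Fin m))
    (φ : Fin m → Bool) : Prop where
  src : ∀ j, Γ'.src (τ j) = σ (if φ j then Γ.tgt j else Γ.src j)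
  tgt : ∀ j, Γ'.tgt (τ j) = σ (if φ j then Γ.src j else Γ.tgt j)
  leg : ∀ l, Γ'.leg l = σ (Γ.leg l)

lemma IsoVia.isIso {Γ Γ' : LegGraph n m r} {σ : Equiv.Perm (Fin n)} {τ : Equiv.Perm (Fin m)}
    {φ : Fin m → Bool} (h : IsoVia Γ Γ' σ τ φ) :
    IsIso Γ Γ' τ (Equiv.Perm.sign σ * ∏ j, (if φ j then (-1 : ℤˣ) else 1)) :=
  ⟨σ, φ, h.src, h.tgt, h.leg, rfl⟩

lemma IsIso.exists_isoVia {Γ Γ' : LegGraph n m r} {τ : Equiv.Perm (Fin m)} {s : ℤˣ}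
    (h : IsIso Γ Γ' τ s) : ∃ σ φ, IsoVia Γ Γ' σ τ φ ∧
      s = Equiv.Perm.sign σ * ∏ j, (if φ j then (-1 : ℤˣ) else 1) := by
  obtain ⟨σ, φ, hs, ht, hl, h⟩ := h
  exact ⟨σ, φ, ⟨hs, ht, hl⟩, h⟩

/-- An isomorphism induces an isomorphism of split graphs. -/
lemma IsoVia.split {Γ Γ' : LegGraph n m r} {σ : Equiv.Perm (Fin n)} {τ : Equiv.Perm (Fin m)}
    {φ : Fin m → Bool} (h : IsoVia Γ Γ' σ τ φ) (a : Fin n) (S : Finset (Fin m)) :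
    IsIso (Γ.split a S) (Γ'.split (σ a) (S.map τ.toEmbedding)) (consPerm τ)
      (Equiv.Perm.sign σ * ∏ j, (if φ j then (-1 : ℤˣ) else 1)) := by
  refine ⟨consPerm σ, Fin.cons false φ, ?_, ?_, ?_, ?_⟩
  · intro j
    refine Fin.cases ?_ (fun j => ?_) j
    · simp
    · simp only [consPerm_succ, split_src_succ, h.src, Fin.cons_succ, split_tgt_succ]
      by_cases hφ : φ j <;> by_cases hj : j ∈ S <;> simp [hφ, hj] <;> split_ifs <;> simp
  · intro j
    refine Fin.cases ?_ (fun j => ?_) j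
    · simp
    · simp only [consPerm_succ, split_src_succ, h.tgt, Fin.cons_succ, split_tgt_succ]
      by_cases hφ : φ j <;> by_cases hj : j ∈ S <;> simp [hφ, hj] <;> split_ifs <;> simp
  · intro l
    simp [h.leg]
  · rw [Fin.prod_univ_succ]
    simp

lemma IsoVia.map_bundle {Γ Γ' : LegGraph n m r} {σ : Equiv.Perm (Fin n)} {τ : Equiv.Perm (Fin m)}
    {φ : Fin m → Bool} (h : IsoVia Γ Γ' σ τ φ) (a b : Fin n) :
    (Γ.bundle a b).map τ.toEmbedding = Γ'.bundle (σ a) (σ b) := by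
  ext j
  obtain ⟨k, rfl⟩ := τ.surjective j
  simp only [Finset.mem_map_equiv, Equiv.symm_apply_apply, mem_bundle, h.src, h.tgt]
  split_ifs <;> simp <;> tauto

lemma IsoVia.mult {Γ Γ' : LegGraph n m r} {σ : Equiv.Perm (Fin n)} {τ : Equiv.Perm (Fin m)}
    {φ : Fin m → Bool} (h : IsoVia Γ Γ' σ τ φ) (a b : Fin n) :
    Γ'.mult (σ a) (σ b) = Γ.mult a b := by
  rw [LegGraph.mult, ← h.map_bundle, Finset.card_map, LegGraph.mult]

lemma valence_eq_sum (Γ : LegGraph n m r) (v : Fin n) :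
    Γ.valence v = ∑ j, ((if Γ.src j = v then 1 else 0) + (if Γ.tgt j = v then 1 else 0)) +
      ∑ l, (if Γ.leg l = v then 1 else 0) := by
  simp only [valence, Finset.card_filter, Finset.sum_add_distrib]

lemma IsoVia.valence {Γ Γ' : LegGraph n m r} {σ : Equiv.Perm (Fin n)} {τ : Equiv.Perm (Fin m)}
    {φ : Fin m → Bool} (h : IsoVia Γ Γ' σ τ φ) (a : Fin n) :
    Γ'.valence (σ a) = Γ.valence a := by
  rw [valence_eq_sum, valence_eq_sum, ← Equiv.sum_comp τ]
  congr 1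
  · refine Finset.sum_congr rfl fun j _ => ?_
    rw [h.src, h.tgt]
    by_cases hφ : φ j <;> simp [hφ, add_comm]
  · simp [h.leg]

/-- Parallel edges can be permuted, without a sign. -/
lemma exists_isoVia_of_bundle (Γ : LegGraph n m r) {a b : Fin n} (hab : a ≠ b)
    {S S' : Finset (Fin m)} (hS : S ⊆ Γ.bundle a b) (hS' : S' ⊆ Γ.bundle a b)
    (hc : S.card = S'.card) :
    ∃ τ φ, IsoVia Γ Γ 1 τ φ ∧ S.map τ.toEmbedding = S' ∧
      ∏ j, (if φ j then (-1 : ℤˣ) else 1) = 1 := by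
  classical
  -- A bijection from `S` to `S'` is extended to a permutation of the bundle, and by the identity to
  -- all edges.
  obtain ⟨τ, hτ, hτb⟩ : ∃ τ : Equiv.Perm (Fin m), S.map τ.toEmbedding = S' ∧
      ∀ j, τ j = j ∨ (j ∈ Γ.bundle a b ∧ τ j ∈ Γ.bundle a b) := by
    let T : Finset {j // j ∈ Γ.bundle a b} := S.subtype _
    let T' : Finset {j // j ∈ Γ.bundle a b} := S'.subtype _
    have hT : T.card = T'.card := by
      simp only [T, T', Finset.card_subtype]
      rw [Finset.filter_true_of_mem (fun x hx => hS hx),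
        Finset.filter_true_of_mem (fun x hx => hS' hx), hc]
    let e : {x // x ∈ T} ≃ {x // x ∈ T'} := Finset.equivOfCardEq hT
    let p : Equiv.Perm {j // j ∈ Γ.bundle a b} := e.extendSubtype
    refine ⟨Equiv.Perm.ofSubtype p, ?_, fun j => ?_⟩
    · refine Finset.eq_of_subset_of_card_le ?_ (by rw [Finset.card_map, hc])
      intro x hx
      obtain ⟨j, hj, rfl⟩ := Finset.mem_map.1 hx
      have h1 : (⟨j, hS hj⟩ : {j // j ∈ Γ.bundle a b}) ∈ T := by simpa [T] using hj
      have h2 := e.extendSubtype_mem _ h1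
      rw [Equiv.coe_toEmbedding, Equiv.Perm.ofSubtype_apply_of_mem p (hS hj)]
      simpa [T'] using h2
    · by_cases hj : j ∈ Γ.bundle a b
      · right
        refine ⟨hj, ?_⟩
        rw [Equiv.Perm.ofSubtype_apply_of_mem p hj]
        exact (p ⟨j, hj⟩).2
      · left
        exact Equiv.Perm.ofSubtype_apply_of_not_mem p hj
  refine ⟨τ, fun j => decide (Γ.src (τ j) ≠ Γ.src j), ⟨?_, ?_, fun l => rfl⟩, hτ, ?_⟩
  · intro j
    rcases hτb j with h | ⟨h1, h2⟩
    · simp [h]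
    · rw [mem_bundle] at h1 h2
      rcases h1 with ⟨h1, h1'⟩ | ⟨h1, h1'⟩ <;> rcases h2 with ⟨h2, h2'⟩ | ⟨h2, h2'⟩ <;>
        simp [h1, h1', h2, hab, hab.symm]
  · intro j
    rcases hτb j with h | ⟨h1, h2⟩
    · simp [h]
    · rw [mem_bundle] at h1 h2
      rcases h1 with ⟨h1, h1'⟩ | ⟨h1, h1'⟩ <;> rcases h2 with ⟨h2, h2'⟩ | ⟨h2, h2'⟩ <;>
        simp [h1, h1', h2, h2', hab, hab.symm]
  -- The reversal sign of `j` is the coboundary `o j * o (τ j)` of the direction `o`, so the product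
  -- over the permutation `τ` is a square.
  · let o : Fin m → ℤˣ := fun j => if Γ.src j = a then -1 else 1
    have ho : ∀ j, (if decide (Γ.src (τ j) ≠ Γ.src j) then (-1 : ℤˣ) else 1) = o j * o (τ j) := by
      intro j
      rcases hτb j with h | ⟨h1, h2⟩
      · simp [h, Int.units_mul_self]
      · rw [mem_bundle] at h1 h2
        rcases h1 with ⟨h1, h1'⟩ | ⟨h1, h1'⟩ <;> rcases h2 with ⟨h2, h2'⟩ | ⟨h2, h2'⟩ <;>
          simp [o, h1, h2, hab, hab.symm]
    rw [Finset.prod_congr rfl fun j _ => ho j, Finset.prod_mul_distrib, Equiv.prod_comp τ o,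
      Int.units_mul_self]

end LegGraph

/-! ### Valences and multiplicities of split graphs -/

namespace LegGraph

variable {n m r : ℕ}

/-- Edges and legs incident to a vertex are counted by its valence. -/
lemma card_add_card_le_valence (Γ : LegGraph n m r) (b : Fin n) (S : Finset (Fin m))
    (L : Finset (Fin r)) (hS : ∀ j ∈ S, Γ.src j = b ∨ Γ.tgt j = b) (hL : ∀ l ∈ L, Γ.leg l = b) :
    S.card + L.card ≤ Γ.valence b := by
  classical
  have h1 : S ⊆ (Finset.univ.filter fun j => Γ.src j = b) ∪ Finset.univ.filter fun j => Γ.tgt j = b :=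
    fun j hj => by simpa using hS j hj
  have h2 : L ⊆ Finset.univ.filter fun l => Γ.leg l = b := fun l hl => by simpa using hL l hl
  have h3 := (Finset.card_le_card h1).trans (Finset.card_union_le _ _)
  have h4 := Finset.card_le_card h2
  unfold valence
  omega

lemma incident_of_mem_bundle {Γ : LegGraph n m r} {a b : Fin n} {j : Fin m}
    (h : j ∈ Γ.bundle a b) : Γ.src j = a ∨ Γ.tgt j = a := by
  rw [mem_bundle] at h
  tauto

lemma incident_of_mem_bundle' {Γ : LegGraph n m r} {a b : Fin n} {j : Fin m}
    (h : j ∈ Γ.bundle a b) : Γ.src j = b ∨ Γ.tgt j = b := by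
  rw [mem_bundle] at h
  tauto

lemma mult_le_valence (Γ : LegGraph n m r) (a b : Fin n) : Γ.mult a b ≤ Γ.valence b := by
  have := Γ.card_add_card_le_valence b (Γ.bundle a b) ∅
    (fun j hj => incident_of_mem_bundle' hj) (by simp)
  simpa [mult] using this

/-- The only half-edges at `a` belong to `S` or to `e`. -/
lemma not_incident_of_valence {Γ : LegGraph n m r} {a : Fin n} {S : Finset (Fin m)}
    (hS : ∀ j ∈ S, Γ.src j = a ∨ Γ.tgt j = a) (hv : Γ.valence a = S.card) :
    (∀ j ∉ S, Γ.src j ≠ a ∧ Γ.tgt j ≠ a) ∧ ∀ l, Γ.leg l ≠ a := by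
  classical
  constructor
  · intro j hj
    by_contra h
    have := Γ.card_add_card_le_valence a (insert j S) ∅ (by
      intro k hk
      rcases Finset.mem_insert.1 hk with rfl | hk
      · tauto
      · exact hS k hk) (by simp)
    rw [Finset.card_insert_of_notMem hj] at this
    simp at this
    omega
  · intro l hl
    have := Γ.card_add_card_le_valence a S {l} hS (by simpa using hl)
    simp at this
    omega

section Split

variable {Γ : LegGraph n m r} {a b : Fin n} {S : Finset (Fin m)}

lemma valence_split_zero (hab : a ≠ b) (hS : S ⊆ Γ.bundle a b) :
    (Γ.split a S).valence 0 = S.card + 1 := by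
  rw [valence_eq_sum, Fin.sum_univ_succ]
  have : ∀ j, ((if (Γ.split a S).src j.succ = 0 then 1 else 0) +
      (if (Γ.split a S).tgt j.succ = 0 then 1 else 0)) = if j ∈ S then 1 else 0 := by
    intro j
    by_cases hj : j ∈ S
    · rcases mem_bundle.1 (hS hj) with ⟨h1, h2⟩ | ⟨h1, h2⟩ <;>
        simp [hj, h1, h2, hab.symm]
    · simp [hj]
  rw [Finset.sum_congr rfl fun j _ => this j]
  simp [add_comm]

/-- The vertex `a` loses one half-edge for each edge in `S` and gains the new edge; the additive
form avoids truncated subtraction. -/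
lemma valence_split_succ (hab : a ≠ b) (hS : S ⊆ Γ.bundle a b) (v : Fin n) :
    (Γ.split a S).valence v.succ + (if v = a then S.card else 0)
      = Γ.valence v + if v = a then 1 else 0 := by
  rw [valence_eq_sum, valence_eq_sum, Fin.sum_univ_succ]
  have : ∀ j, ((if (Γ.split a S).src j.succ = v.succ then 1 else 0) +
      (if (Γ.split a S).tgt j.succ = v.succ then 1 else 0)) +
        (if v = a then if j ∈ S then 1 else 0 else 0) =
        (if Γ.src j = v then 1 else 0) + (if Γ.tgt j = v then 1 else 0) := by
    intro j
    by_cases hj : j ∈ S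
    · rcases mem_bundle.1 (hS hj) with ⟨h1, h2⟩ | ⟨h1, h2⟩ <;> rcases eq_or_ne v a with rfl | hv <;>
        simp [hab.symm, (Fin.succ_ne_zero _).symm, *, Ne.symm]
    · simp [hj]
  have hc : (if v = a then S.card else 0) = ∑ j, if v = a then if j ∈ S then 1 else 0 else 0 := by
    split_ifs <;> simp
  rw [← Finset.sum_congr rfl fun j _ => this j, Finset.sum_add_distrib (g := fun j => if v = a then
    if j ∈ S then 1 else 0 else 0), ← hc]
  simp only [split_src_zero, split_tgt_zero, split_leg, Fin.succ_inj, (Fin.succ_ne_zero v).symm,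
    if_false, @eq_comm _ a v]
  omega

lemma bundle_split_succ (x y : Fin n) (hS : S ⊆ Γ.bundle a b) :
    (Γ.split a S).bundle x.succ y.succ = (Γ.bundle x y \ S).map (Fin.succEmb m) := by
  ext j
  refine Fin.cases ?_ (fun j => ?_) j
  · simp [mem_bundle, (Fin.succ_ne_zero _).symm]
  · simp only [mem_bundle, split_src_succ, split_tgt_succ, Finset.mem_map, Finset.mem_sdiff,
      Fin.coe_succEmb, Fin.succ_inj, exists_eq_right]
    by_cases hj : j ∈ S
    · rcases mem_bundle.1 (hS hj) with ⟨h1, h2⟩ | ⟨h1, h2⟩ <;>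
        simp [hj, h1, h2, (Fin.succ_ne_zero _).symm]
    · simp [hj]

lemma mult_split_succ (x y : Fin n) (hS : S ⊆ Γ.bundle a b) :
    (Γ.split a S).mult x.succ y.succ = (Γ.bundle x y \ S).card := by
  rw [mult, bundle_split_succ x y hS, Finset.card_map]

lemma bundle_disjoint {x y : Fin n} (h : ¬ ((x = a ∧ y = b) ∨ (x = b ∧ y = a)))
    : Disjoint (Γ.bundle x y) (Γ.bundle a b) := by
  rw [Finset.disjoint_left]
  intro j h1 h2
  rw [mem_bundle] at h1 h2
  grind

lemma mult_split_succ_of_ne {x y : Fin n} (h : ¬ ((x = a ∧ y = b) ∨ (x = b ∧ y = a)))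
    (hS : S ⊆ Γ.bundle a b) : (Γ.split a S).mult x.succ y.succ = Γ.mult x y := by
  rw [mult_split_succ x y hS, Finset.sdiff_eq_self_of_disjoint
    (Disjoint.mono_right hS (bundle_disjoint h)), mult]

lemma mult_split_succ_self (hS : S ⊆ Γ.bundle a b) :
    (Γ.split a S).mult a.succ b.succ = Γ.mult a b - S.card := by
  rw [mult_split_succ a b hS, Finset.card_sdiff_of_subset hS, mult]

lemma mult_split_zero_succ (hab : a ≠ b) (hS : S ⊆ Γ.bundle a b) :
    (Γ.split a S).mult 0 b.succ = S.card := by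
  rw [mult]
  have : (Γ.split a S).bundle 0 b.succ = S.map (Fin.succEmb m) := by
    ext j
    refine Fin.cases ?_ (fun j => ?_) j
    · simp [mem_bundle, (Fin.succ_ne_zero _).symm, hab]
    · simp only [mem_bundle, split_src_succ, split_tgt_succ, Finset.mem_map,
        Fin.coe_succEmb, Fin.succ_inj, exists_eq_right]
      by_cases hj : j ∈ S
      · rcases mem_bundle.1 (hS hj) with ⟨h1, h2⟩ | ⟨h1, h2⟩ <;>
          simp [hj, h1, h2, hab.symm]
      · simp [hj]
  rw [this, Finset.card_map]

/-- A moved edge is replaced by the path that first crosses the new edge. -/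
lemma Connected.split (h : Γ.Connected) (hab : a ≠ b) (hS : S ⊆ Γ.bundle a b) :
    (Γ.split a S).Connected := by
  set R := Relation.EqvGen fun x y => ∃ j, (Γ.split a S).src j = x ∧ (Γ.split a S).tgt j = y
  have h0 : R a.succ 0 := .rel _ _ ⟨0, rfl, rfl⟩
  have key : ∀ u v, Relation.EqvGen (fun x y => ∃ j, Γ.src j = x ∧ Γ.tgt j = y) u v →
      R u.succ v.succ := by
    intro u v huv
    induction huv with
    | rel x y hxy =>
      obtain ⟨j, rfl, rfl⟩ := hxy
      have hj : R ((Γ.split a S).src j.succ) ((Γ.split a S).tgt j.succ) := .rel _ _ ⟨_, rfl, rfl⟩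
      by_cases hjS : j ∈ S
      · rcases mem_bundle.1 (hS hjS) with ⟨h1, h2⟩ | ⟨h1, h2⟩
        · simp only [split_src_succ, split_tgt_succ, hjS, h1, h2, hab.symm, and_true, and_false,
            if_true, if_false] at hj
          rw [h1, h2]
          exact .trans _ _ _ h0 hj
        · simp only [split_src_succ, split_tgt_succ, hjS, h1, h2, hab.symm, and_true, and_false,
            if_true, if_false] at hj
          rw [h1, h2]
          exact .trans _ _ _ hj (.symm _ _ h0)
      · simpa [hjS] using hj
    | refl a => exact .refl _
    | symm a b _ ih => exact .symm _ _ ih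
    | trans a b c _ _ ih₁ ih₂ => exact .trans _ _ _ ih₁ ih₂
  intro u v
  refine Fin.cases ?_ (fun u => ?_) u <;> refine Fin.cases ?_ (fun v => ?_) v
  · exact .refl _
  · exact .trans _ _ _ (.symm _ _ h0) (key _ _ (h _ _))
  · exact .trans _ _ _ (key _ _ (h _ _)) h0
  · exact key _ _ (h _ _)

/-- The condition `hc` serves the new vertex, and `hv` leaves two old half-edges at `a` besides the
new edge. -/
lemma three_le_valence_split (h : ∀ v, 3 ≤ Γ.valence v) (hab : a ≠ b) (hS : S ⊆ Γ.bundle a b)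
    (hc : 2 ≤ S.card) (hv : S.card + 2 ≤ Γ.valence a) (v : Fin (n + 1)) :
    3 ≤ (Γ.split a S).valence v := by
  refine Fin.cases ?_ (fun v => ?_) v
  · rw [valence_split_zero hab hS]
    omega
  · have := valence_split_succ hab hS v
    have := h v
    split_ifs at * with h1
    · subst h1
      omega
    · omega

lemma Loopless.split (h : Γ.Loopless) (hab : a ≠ b) (hS : S ⊆ Γ.bundle a b) :
    (Γ.split a S).Loopless := by
  intro j
  refine Fin.cases ?_ (fun j => ?_) j
  · simp
  · by_cases hj : j ∈ S
    · rcases mem_bundle.1 (hS hj) with ⟨h1, h2⟩ | ⟨h1, h2⟩ <;>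
        simp [hj, h1, h2, hab.symm, (Fin.succ_ne_zero _).symm]
    · simpa [hj] using h j

end Split

/-- A graph in which two vertices of valence three are joined to a third vertex and, by a double
edge, to each other, has an odd automorphism. -/
lemma isIso_split_of_valence_eq_three {Γ : LegGraph n m r} {a b : Fin n} {S : Finset (Fin m)}
    (hab : a ≠ b) (hS : S ⊆ Γ.bundle a b) (hc : S.card = 2) (hm : Γ.mult a b = 3)
    (hv : Γ.valence b = 3) : ∃ τ, IsIso (Γ.split a S) (Γ.split a S) τ (-1) := by
  classical
  obtain ⟨f, hf⟩ : ∃ f, Γ.bundle a b \ S = {f} := by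
    rw [← Finset.card_eq_one, Finset.card_sdiff_of_subset hS, hc]
    have : (Γ.bundle a b).card = 3 := hm
    omega
  obtain ⟨hfB, hfS⟩ := Finset.mem_sdiff.1 (show f ∈ Γ.bundle a b \ S by simp [hf])
  have hB : ∀ j, j ∈ Γ.bundle a b → j ∈ S ∨ j = f := by
    intro j hj
    by_cases h : j ∈ S
    · exact .inl h
    · right
      have : j ∈ Γ.bundle a b \ S := by simp [hj, h]
      simpa [hf] using this
  obtain ⟨h1, h2⟩ := not_incident_of_valence (Γ := Γ) (a := b) (S := Γ.bundle a b)
    (fun j hj => incident_of_mem_bundle' hj) (hv.trans hm.symm)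
  -- The automorphism exchanges the new vertex with `b` and the new edge with the remaining edge
  -- `f`. Both edges in `S` are reversed, and the new edge and `f` are reversed together or not at
  -- all. So the reversals cancel and the sign is that of the transposition of vertices.
  let φ : Fin (m + 1) → Bool := Fin.cons (decide (Γ.src f = b))
    fun j => decide (j ∈ S ∨ (j = f ∧ Γ.src f = b))
  have hsw : ∀ v, v ≠ b → Equiv.swap (0 : Fin (n + 1)) b.succ v.succ = v.succ := fun v hv =>
    Equiv.swap_apply_of_ne_of_ne (Fin.succ_ne_zero _) (by simpa using hv)
  have hsw' : ∀ j, j ≠ f → Equiv.swap (0 : Fin (m + 1)) f.succ j.succ = j.succ := fun v hv =>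
    Equiv.swap_apply_of_ne_of_ne (Fin.succ_ne_zero _) (by simpa using hv)
  refine ⟨Equiv.swap 0 f.succ, Equiv.swap 0 b.succ, φ, ?_, ?_, ?_, ?_⟩
  · intro j
    refine Fin.cases ?_ (fun j => ?_) j
    · rcases mem_bundle.1 hfB with ⟨h, h'⟩ | ⟨h, h'⟩ <;> simp [φ, h, hfS, hab, hsw]
    · by_cases hj : j ∈ S
      · have hjf : j ≠ f := fun h => hfS (h ▸ hj)
        rcases mem_bundle.1 (hS hj) with ⟨h, h'⟩ | ⟨h, h'⟩ <;>
          simp [φ, h, h', hab.symm, hsw' j hjf, hj]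
      · by_cases hjf : j = f
        · subst hjf
          rcases mem_bundle.1 hfB with ⟨h, h'⟩ | ⟨h, h'⟩ <;> simp [φ, h, h', hfS, hab, hsw]
        · have hjB : j ∉ Γ.bundle a b := fun h => (hB j h).elim hj hjf
          simp [φ, hj, hjf, hsw' j hjf, hsw _ (h1 j hjB).1]
  · intro j
    refine Fin.cases ?_ (fun j => ?_) j
    · rcases mem_bundle.1 hfB with ⟨h, h'⟩ | ⟨h, h'⟩ <;> simp [φ, h, h', hfS, hab, hsw]
    · by_cases hj : j ∈ S
      · have hjf : j ≠ f := fun h => hfS (h ▸ hj)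
        rcases mem_bundle.1 (hS hj) with ⟨h, h'⟩ | ⟨h, h'⟩ <;>
          simp [φ, h, h', hab.symm, hsw' j hjf, hj]
      · by_cases hjf : j = f
        · subst hjf
          rcases mem_bundle.1 hfB with ⟨h, h'⟩ | ⟨h, h'⟩ <;> simp [φ, h, h', hfS, hab]
        · have hjB : j ∉ Γ.bundle a b := fun h => (hB j h).elim hj hjf
          simp [φ, hj, hjf, hsw' j hjf, hsw _ (h1 j hjB).2]
  · intro l
    simp [hsw _ (h2 l)]
  · have : ∀ j : Fin m, (if φ j.succ then (-1 : ℤˣ) else 1) = (if j ∈ S then -1 else 1) *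
        (if j = f then if φ 0 then -1 else 1 else 1) := by
      intro j
      by_cases hj : j ∈ S
      · have hjf : j ≠ f := fun h => hfS (h ▸ hj)
        simp [φ, hj, hjf]
      · simp [φ, hj, ite_and]
    rw [Fin.prod_univ_succ, Finset.prod_congr rfl fun j _ => this j, Finset.prod_mul_distrib,
      Finset.prod_ite_eq' Finset.univ f, Equiv.Perm.sign_swap (Fin.succ_ne_zero b).symm,
      Finset.prod_ite_mem, Finset.univ_inter, Finset.prod_const, hc,
      if_pos (Finset.mem_univ f)]
    split_ifs <;> simp

/-- A vertex all of whose half-edges, except one, belong to edges `S` with the same other end point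
arises by splitting. -/
lemma isIso_split_contract {Γ : LegGraph (n + 2) (m + 1) r} {a b : Fin (n + 2)}
    {S : Finset (Fin (m + 1))} {e : Fin (m + 1)} (hab : a ≠ b) (hS : S ⊆ Γ.bundle a b)
    (he : e ∉ Γ.bundle a b) (hea : Γ.src e = a ∨ Γ.tgt e = a) (hne : Γ.src e ≠ Γ.tgt e)
    (hv : Γ.valence a = S.card + 1) :
    ∃ τ, IsIso ((Γ.contract e).split (collapse (Γ.src e) (Γ.tgt e) a) (eraseEdge S e)) Γ τ
      ((-1) ^ (Γ.tgt e : ℕ)) := by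
  classical
  have heS : e ∉ S := fun h => he (hS h)
  obtain ⟨h1, h2⟩ := not_incident_of_valence (Γ := Γ) (a := a) (S := insert e S)
    (fun j hj => by
      rcases Finset.mem_insert.1 hj with rfl | hj
      · exact hea
      · exact incident_of_mem_bundle (hS hj)) (by rw [Finset.card_insert_of_notMem heS, hv])
  have hπ : collapse (Γ.src e) (Γ.tgt e) (Γ.src e) = collapse (Γ.src e) (Γ.tgt e) (Γ.tgt e) := by
    rw [collapse_eq_iff hne]
    simp
  have hπb : collapse (Γ.src e) (Γ.tgt e) b ≠ collapse (Γ.src e) (Γ.tgt e) a := by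
    rw [Ne, collapse_eq_iff hne]
    rw [mem_bundle] at he
    grind
  -- The inverse cycle undoes the renumbering and inserts the new vertex at the place of the head of
  -- `e`. If `a` is the tail of `e` instead, a transposition is needed as well; its sign is
  -- compensated by the reversal of `e`.
  obtain ⟨σ, h0, hσ, hs⟩ : ∃ σ : Equiv.Perm (Fin (n + 2)), σ 0 = a ∧
      (∀ v, v ≠ a → σ (collapse (Γ.src e) (Γ.tgt e) v).succ = v) ∧
      Equiv.Perm.sign σ * (if Γ.src e = a then -1 else 1) = (-1) ^ (Γ.tgt e : ℕ) := by
    have hcol : ∀ v, (Γ.tgt e).cycleRange.symm (collapse (Γ.src e) (Γ.tgt e) v).succ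
        = if v = Γ.tgt e then Γ.src e else v := by
      intro v
      rw [Fin.cycleRange_symm_succ, collapse, succAbove_rank]
      split_ifs with h
      · exact hne
      · exact h
    by_cases hsrc : Γ.src e = a
    · refine ⟨Equiv.swap a (Γ.tgt e) * (Γ.tgt e).cycleRange.symm, ?_, ?_, ?_⟩
      · simp
      · intro v hv
        rw [Equiv.Perm.mul_apply, hcol]
        split_ifs with h
        · rw [hsrc, Equiv.swap_apply_left, h]
        · exact Equiv.swap_apply_of_ne_of_ne hv h
      · rw [Equiv.Perm.sign_mul, Equiv.Perm.sign_swap (hsrc ▸ hne), Equiv.Perm.sign_symm,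
          Fin.sign_cycleRange]
        simp [hsrc]
    · have htgt : Γ.tgt e = a := hea.resolve_left hsrc
      refine ⟨(Γ.tgt e).cycleRange.symm, ?_, ?_, ?_⟩
      · simp [htgt]
      · intro v hv
        rw [hcol, if_neg (htgt ▸ hv)]
      · rw [Equiv.Perm.sign_symm, Fin.sign_cycleRange]
        simp [hsrc]
  refine ⟨e.cycleRange.symm, σ, Fin.cons (decide (Γ.src e = a)) fun _ => false, ?_, ?_, ?_, ?_⟩
  · intro j
    refine Fin.cases ?_ (fun j => ?_) j
    · by_cases hsrc : Γ.src e = a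
      · simp [hsrc, h0]
      · have htgt : Γ.tgt e = a := hea.resolve_left hsrc
        have := hσ _ hsrc
        rw [hπ, htgt] at this
        simp [hsrc, htgt, this]
    · simp only [Fin.cycleRange_symm_succ, Fin.cons_succ, Bool.false_eq_true, if_false,
        split_src_succ, mem_eraseEdge, contract]
      by_cases hj : e.succAbove j ∈ S
      · rcases mem_bundle.1 (hS hj) with ⟨h, h'⟩ | ⟨h, h'⟩
        · simp [hj, h, h0]
        · simp [hj, h, hπb, hσ b hab.symm]
      · have := h1 (e.succAbove j) (by simp [hj, Fin.succAbove_ne])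
        simp [hj, hσ _ this.1]
  · intro j
    refine Fin.cases ?_ (fun j => ?_) j
    · by_cases hsrc : Γ.src e = a
      · have := hσ (Γ.tgt e) (hsrc ▸ hne.symm)
        rw [← hπ, hsrc] at this
        simp [hsrc, this]
      · have htgt : Γ.tgt e = a := hea.resolve_left hsrc
        simp [hsrc, htgt, h0]
    · simp only [Fin.cycleRange_symm_succ, Fin.cons_succ, Bool.false_eq_true, if_false,
        split_tgt_succ, mem_eraseEdge, contract]
      by_cases hj : e.succAbove j ∈ S
      · rcases mem_bundle.1 (hS hj) with ⟨h, h'⟩ | ⟨h, h'⟩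
        · simp [hj, h', hπb, hσ b hab.symm]
        · simp [hj, h', h0]
      · have := h1 (e.succAbove j) (by simp [hj, Fin.succAbove_ne])
        simp [hj, hσ _ this.2]
  · intro l
    simp only [split_leg, contract]
    rw [hσ _ (h2 l)]
  · rw [Fin.prod_univ_succ, ← hs]
    simp

end LegGraph

/-! ### The weight under splitting and contraction -/

namespace LegGraph

variable {n m r : ℕ}

/-- The number of disjoint pairs of edges that join two different vertices. -/
def pairs (Γ : LegGraph n m r) (a b : Fin n) : ℕ := if a = b then 0 else Γ.mult a b / 2

/-- The vertex `b` has three half-edges, and they form a triple edge. -/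
def Antenna (Γ : LegGraph n m r) (b : Fin n) : Prop :=
  Γ.valence b = 3 ∧ ∃ a, a ≠ b ∧ Γ.mult a b = 3

open Classical in
/-- The vertices at the end of a triple edge without further half-edges. -/
noncomputable def antennas (Γ : LegGraph n m r) : Finset (Fin n) := Finset.univ.filter Γ.Antenna

/-- The weight by which the complex is filtered. -/
noncomputable def weight (Γ : LegGraph n m r) : ℕ :=
  ∑ p : Fin n × Fin n, Γ.pairs p.1 p.2 + Γ.antennas.card

lemma mem_antennas {Γ : LegGraph n m r} {b : Fin n} : b ∈ Γ.antennas ↔ Γ.Antenna b := by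
  simp [antennas]

/-- The number of edges from `a` to `b` that are moved when `a` is split. -/
def pullSize (Γ : LegGraph n m r) (a b : Fin n) : ℕ :=
  if Γ.mult a b = 3 ∧ Γ.valence b = 3 then 3 else 2

lemma pullSize_eq (Γ : LegGraph n m r) (a b : Fin n) : Γ.pullSize a b = 2 ∨ Γ.pullSize a b = 3 := by
  unfold pullSize
  split_ifs <;> simp

lemma pairs_comm (Γ : LegGraph n m r) (a b : Fin n) : Γ.pairs a b = Γ.pairs b a := by
  unfold pairs
  rw [mult_comm]
  simp [eq_comm]

lemma pullSize_le_mult {Γ : LegGraph n m r} {a b : Fin n} (h : Γ.pairs a b ≠ 0) :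
    a ≠ b ∧ Γ.pullSize a b ≤ Γ.mult a b := by
  unfold pairs at h
  unfold pullSize
  split_ifs at * <;> simp_all
  omega

lemma exists_subset_bundle {Γ : LegGraph n m r} {a b : Fin n} (h : Γ.pairs a b ≠ 0) :
    ∃ S ⊆ Γ.bundle a b, S.card = Γ.pullSize a b :=
  Finset.exists_subset_card_eq (pullSize_le_mult h).2

/-- Splitting does not decrease the weight. -/
lemma weight_le_split {Γ : LegGraph n m r} {a b : Fin n} {S : Finset (Fin m)} (hab : a ≠ b)
    (hS : S ⊆ Γ.bundle a b) (hc : S.card = Γ.pullSize a b) (hv : S.card + 2 ≤ Γ.valence a) :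
    Γ.weight ≤ (Γ.split a S).weight := by
  classical
  have hc' : S.card = 2 ∨ S.card = 3 := hc ▸ Γ.pullSize_eq a b
  refine Nat.add_le_add ?_ ?_
  · rw [Fintype.sum_prod_type, Fintype.sum_prod_type, Fin.sum_univ_succ, Fin.sum_univ_succ]
    -- The bundle between `a` and `b` loses at most one pair, counted in both orders. The new bundle
    -- between `0` and `b` has exactly one pair and makes up for this.
    have h1 : ∀ x y, Γ.pairs x y ≤ (Γ.split a S).pairs x.succ y.succ +
        ((if x = a then if y = b then 1 else 0 else 0) +
          (if x = b then if y = a then 1 else 0 else 0)) := by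
      intro x y
      by_cases h : (x = a ∧ y = b) ∨ (x = b ∧ y = a)
      · have key : Γ.pairs a b ≤ (Γ.split a S).pairs a.succ b.succ + 1 := by
          unfold pairs
          rw [mult_split_succ_self hS]
          simp only [hab, if_false, Fin.succ_inj]
          rw [hc]
          unfold pullSize
          split_ifs with h3
          · omega
          · omega
        rcases h with ⟨rfl, rfl⟩ | ⟨rfl, rfl⟩
        · simpa [hab] using key
        · rw [pairs_comm Γ, pairs_comm (Γ.split _ _)]
          simpa [hab.symm] using key
      · refine le_add_right (le_of_eq ?_)
        unfold pairs
        rw [mult_split_succ_of_ne h hS]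
        simp
    have h2 : ∑ x, ∑ y, Γ.pairs x y ≤ ∑ x : Fin n, ∑ y : Fin n,
        (Γ.split a S).pairs x.succ y.succ + 2 := by
      refine (Finset.sum_le_sum fun x _ => Finset.sum_le_sum fun y _ => h1 x y).trans_eq ?_
      simp [Finset.sum_add_distrib]
    have h3 : (Γ.split a S).pairs 0 b.succ = 1 := by
      unfold pairs
      rw [mult_split_zero_succ hab hS, if_neg (Fin.succ_ne_zero b).symm]
      omega
    have h4 : 1 ≤ ∑ y : Fin n, (Γ.split a S).pairs 0 y.succ :=
      h3.symm.le.trans (Finset.single_le_sum (f := fun y : Fin n => (Γ.split a S).pairs 0 y.succ)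
        (fun _ _ => Nat.zero_le _) (Finset.mem_univ b))
    simp only [fun x : Fin n => Fin.sum_univ_succ (fun y => (Γ.split a S).pairs x.succ y),
      Finset.sum_add_distrib]
    have h5 : ∑ x : Fin n, (Γ.split a S).pairs x.succ 0 = ∑ y : Fin n, (Γ.split a S).pairs 0 y.succ :=
      Finset.sum_congr rfl fun x _ => pairs_comm _ _ _
    omega
  · rw [← Finset.card_map (Fin.succEmb n)]
    refine Finset.card_le_card fun x hx => ?_
    obtain ⟨c, hc1, rfl⟩ := Finset.mem_map.1 hx
    obtain ⟨hc1, v, hvc, hm⟩ := mem_antennas.1 hc1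
    rw [mem_antennas]
    -- The vertex `a` has valence at least four, so it is not an antenna.
    have hca : c ≠ a := by
      rintro rfl
      omega
    refine ⟨?_, ?_⟩
    · have := valence_split_succ hab hS c
      simpa [hca, hc1] using this
    -- An antenna `b` hanging from `a` has all three edges moved, and then hangs from the new
    -- vertex.
    · by_cases h : (v = a ∧ c = b) ∨ (v = b ∧ c = a)
      · rcases h with ⟨rfl, rfl⟩ | ⟨rfl, rfl⟩
        · refine ⟨0, by simpa using (Fin.succ_ne_zero c).symm, ?_⟩
          rw [Fin.coe_succEmb, mult_split_zero_succ hab hS, hc]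
          simp [pullSize, hm, hc1]
        · exact absurd rfl hca
      · exact ⟨v.succ, by simpa using hvc, by
          rw [Fin.coe_succEmb, mult_split_succ_of_ne h hS, hm]⟩

section Contract

/-- The map on vertices of the contraction of an edge. -/
abbrev proj (Γ : LegGraph (n + 2) m r) (e : Fin m) (v : Fin (n + 2)) : Fin (n + 1) :=
  collapse (Γ.src e) (Γ.tgt e) v

variable {Γ : LegGraph (n + 2) (m + 1) r} {e : Fin (m + 1)}

/-- Half-edges are counted over the fibre of `x`; only the two halves of `e` disappear, and they are
added back on the left. -/
lemma valence_contract (x : Fin (n + 1)) :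
    (Γ.contract e).valence x + ((if Γ.proj e (Γ.src e) = x then 1 else 0) +
      (if Γ.proj e (Γ.tgt e) = x then 1 else 0)) =
      ∑ v with Γ.proj e v = x, Γ.valence v := by
  have h : ∀ w : Fin (n + 2), ∑ v with Γ.proj e v = x, (if w = v then 1 else 0)
      = if Γ.proj e w = x then 1 else 0 := by
    intro w
    rw [Finset.sum_ite_eq]
    simp
  simp only [valence_eq_sum, Finset.sum_add_distrib]
  rw [Finset.sum_comm, Finset.sum_comm (t := Finset.univ (α := Fin (m + 1))),
    Finset.sum_comm (t := Finset.univ (α := Fin r))]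
  simp only [h]
  rw [Fin.sum_univ_succAbove _ e, Fin.sum_univ_succAbove
    (fun j => if Γ.proj e (Γ.tgt j) = x then 1 else 0) e]
  have h1 : ∑ j, (if (Γ.contract e).src j = x then 1 else 0)
      = ∑ j, if Γ.proj e (Γ.src (e.succAbove j)) = x then 1 else 0 := rfl
  have h2 : ∑ j, (if (Γ.contract e).tgt j = x then 1 else 0)
      = ∑ j, if Γ.proj e (Γ.tgt (e.succAbove j)) = x then 1 else 0 := rfl
  have h3 : ∑ j, (if (Γ.contract e).leg j = x then 1 else 0)
      = ∑ j, if Γ.proj e (Γ.leg j) = x then 1 else 0 := rfl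
  rw [h1, h2, h3]
  ring

lemma valence_contract_of_ne (hne : Γ.src e ≠ Γ.tgt e) {v : Fin (n + 2)} (hs : v ≠ Γ.src e)
    (ht : v ≠ Γ.tgt e) : (Γ.contract e).valence (Γ.proj e v) = Γ.valence v := by
  have h := valence_contract (Γ := Γ) (e := e) (Γ.proj e v)
  have hf : (Finset.univ.filter fun w => Γ.proj e w = Γ.proj e v) = {v} := by
    ext w
    simp only [Finset.mem_filter, Finset.mem_univ, true_and, Finset.mem_singleton,
      collapse_eq_iff hne]
    tauto
  rw [hf, Finset.sum_singleton, if_neg, if_neg] at h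
  · simpa using h
  · rw [collapse_eq_iff hne]; grind
  · rw [collapse_eq_iff hne]; grind

lemma proj_src (hne : Γ.src e ≠ Γ.tgt e) : Γ.proj e (Γ.src e) = Γ.proj e (Γ.tgt e) := by
  rw [collapse_eq_iff hne]
  simp

lemma valence_contract_tgt (hne : Γ.src e ≠ Γ.tgt e) :
    (Γ.contract e).valence (Γ.proj e (Γ.tgt e)) + 2
      = Γ.valence (Γ.src e) + Γ.valence (Γ.tgt e) := by
  have h := valence_contract (Γ := Γ) (e := e) (Γ.proj e (Γ.tgt e))
  have hf : (Finset.univ.filter fun w => Γ.proj e w = Γ.proj e (Γ.tgt e))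
      = {Γ.src e, Γ.tgt e} := by
    ext w
    simp only [Finset.mem_filter, Finset.mem_univ, true_and, Finset.mem_insert,
      Finset.mem_singleton, collapse_eq_iff hne]
    grind
  rw [hf, Finset.sum_pair hne, if_pos (proj_src hne), if_pos rfl] at h
  exact h

/-- The bundles of a contracted graph are the unions of bundles of the graph. -/
lemma mult_contract {x y : Fin (n + 1)} (hxy : x ≠ y) (hne : Γ.src e ≠ Γ.tgt e) :
    (Γ.contract e).mult x y = ∑ p : Fin (n + 2) × Fin (n + 2) with
      (Γ.proj e p.1, Γ.proj e p.2) = (x, y), Γ.mult p.1 p.2 := by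
  classical
  -- The end points of an edge in the bundle are ordered so that the first one lies over `x`; this
  -- is unambiguous because `x ≠ y`.
  let f : Fin m → Fin (n + 2) × Fin (n + 2) := fun j =>
    if Γ.proj e (Γ.src (e.succAbove j)) = x then (Γ.src (e.succAbove j), Γ.tgt (e.succAbove j))
    else (Γ.tgt (e.succAbove j), Γ.src (e.succAbove j))
  rw [mult, Finset.card_eq_sum_card_fiberwise (f := f)
    (t := Finset.univ.filter fun p : Fin (n + 2) × Fin (n + 2) =>
      (Γ.proj e p.1, Γ.proj e p.2) = (x, y))]
  · refine Finset.sum_congr rfl fun p hp => ?_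
    obtain ⟨a, b⟩ := p
    simp only [Finset.mem_filter, Finset.mem_univ, true_and, Prod.mk.injEq] at hp
    obtain ⟨rfl, rfl⟩ := hp
    have hab : a ≠ b := fun h => hxy (h ▸ rfl)
    refine Finset.card_bij (fun j _ => e.succAbove j) ?_
      (fun j _ k _ h => Fin.succAbove_right_injective h) ?_
    · intro j hj
      obtain ⟨hj, hf⟩ := Finset.mem_filter.1 hj
      rw [mem_bundle]
      simp only [f] at hf
      split_ifs at hf
      · simp only [Prod.mk.injEq] at hf
        exact .inl hf
      · simp only [Prod.mk.injEq] at hf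
        exact .inr hf.symm
    · intro k hk
      have hke : k ≠ e := by
        rintro rfl
        have := proj_src hne
        rcases mem_bundle.1 hk with ⟨rfl, rfl⟩ | ⟨rfl, rfl⟩
        · exact hxy this
        · exact hxy this.symm
      obtain ⟨j, rfl⟩ := Fin.exists_succAbove_eq hke
      refine ⟨j, ?_, rfl⟩
      rw [Finset.mem_filter, mem_bundle]
      rcases mem_bundle.1 hk with ⟨h1, h2⟩ | ⟨h1, h2⟩
      · refine ⟨.inl (by simp [contract, h1, h2]), ?_⟩
        simp [f, h1, h2]
      · refine ⟨.inr (by simp [contract, h1, h2]), ?_⟩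
        simp only [f, h1, h2, if_neg hxy.symm]
  · intro j hj
    simp only [Finset.coe_filter, Finset.mem_univ, true_and, Set.mem_ofPred_eq]
    rcases mem_bundle.1 hj with ⟨h1, h2⟩ | ⟨h1, h2⟩
    · simp only [f]
      rw [if_pos (show Γ.proj e (Γ.src (e.succAbove j)) = x from h1)]
      exact Prod.ext h1 h2
    · simp only [f]
      rw [if_neg (by rw [show Γ.proj e (Γ.src (e.succAbove j)) = y from h1]; exact hxy.symm)]
      exact Prod.ext h2 h1

/-- If there is no edge parallel to `e`, then pairs of parallel edges stay so when `e` is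
contracted. -/
lemma pairs_contract_le (hne : Γ.src e ≠ Γ.tgt e) (he : Γ.mult (Γ.src e) (Γ.tgt e) = 1)
    (x y : Fin (n + 1)) :
    ∑ p : Fin (n + 2) × Fin (n + 2) with (Γ.proj e p.1, Γ.proj e p.2) = (x, y),
      Γ.pairs p.1 p.2 ≤ (Γ.contract e).pairs x y := by
  by_cases hxy : x = y
  · subst hxy
    refine (Finset.sum_eq_zero fun p hp => ?_).trans_le (Nat.zero_le _)
    obtain ⟨a, b⟩ := p
    simp only [Finset.mem_filter, Finset.mem_univ, true_and, Prod.mk.injEq] at hp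
    have h := hp.1.trans hp.2.symm
    rw [collapse_eq_iff hne] at h
    rcases h with rfl | ⟨rfl, rfl⟩ | ⟨rfl, rfl⟩
    · simp [pairs]
    · simp [pairs, he]
    · rw [pairs_comm]
      simp [pairs, he]
  -- The sum of the rounded halves is at most the rounded half of the sum.
  · rw [pairs, if_neg hxy, mult_contract hxy hne, Nat.le_div_iff_mul_le two_pos, Finset.sum_mul]
    refine Finset.sum_le_sum fun p _ => ?_
    unfold pairs
    split_ifs <;> omega

lemma sum_pairs_eq : ∑ p : Fin (n + 2) × Fin (n + 2), Γ.pairs p.1 p.2 =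
    ∑ q : Fin (n + 1) × Fin (n + 1), ∑ p : Fin (n + 2) × Fin (n + 2) with
      (Γ.proj e p.1, Γ.proj e p.2) = (q.1, q.2), Γ.pairs p.1 p.2 :=
  (Finset.sum_fiberwise Finset.univ
    (fun p : Fin (n + 2) × Fin (n + 2) => (Γ.proj e p.1, Γ.proj e p.2)) _).symm

/-- The triple edge exhausts the three half-edges at `b`. -/
lemma Antenna.mem_bundle {Γ : LegGraph n m r} {b : Fin n} (h : Γ.Antenna b) {j : Fin m}
    (hj : Γ.src j = b ∨ Γ.tgt j = b) : ∃ a, a ≠ b ∧ j ∈ Γ.bundle a b ∧ Γ.mult a b = 3 := by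
  obtain ⟨hv, a, hab, hm⟩ := h
  refine ⟨a, hab, ?_, hm⟩
  have := (not_incident_of_valence (Γ := Γ) (a := b) (S := Γ.bundle a b)
    (fun j hj => incident_of_mem_bundle' hj) (hv.trans hm.symm)).1 j
  by_contra h
  have := this h
  tauto

lemma mult_eq_of_mem_bundle {Γ : LegGraph n m r} {a b : Fin n} {j : Fin m} (h : j ∈ Γ.bundle a b) :
    Γ.mult (Γ.src j) (Γ.tgt j) = Γ.mult a b := by
  rcases LegGraph.mem_bundle.1 h with ⟨rfl, rfl⟩ | ⟨rfl, rfl⟩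
  · rfl
  · exact mult_comm _ _ _

/-- Every edge at an antenna has multiplicity three, so an edge without parallels does not meet one.
-/
lemma Antenna.ne (he : Γ.mult (Γ.src e) (Γ.tgt e) = 1) {b : Fin (n + 2)} (h : Γ.Antenna b) :
    b ≠ Γ.src e ∧ b ≠ Γ.tgt e := by
  by_contra hb
  obtain ⟨a, -, hj, hm⟩ := h.mem_bundle (j := e) (by tauto)
  have := mult_eq_of_mem_bundle hj
  omega

lemma mult_le_contract (hne : Γ.src e ≠ Γ.tgt e) {a b : Fin (n + 2)}
    (hab : Γ.proj e a ≠ Γ.proj e b) :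
    Γ.mult a b ≤ (Γ.contract e).mult (Γ.proj e a) (Γ.proj e b) := by
  rw [mult_contract hab hne]
  exact Finset.single_le_sum (f := fun p : Fin (n + 2) × Fin (n + 2) => Γ.mult p.1 p.2) (a := (a, b))
    (fun _ _ => Nat.zero_le _) (by simp)

/-- The contraction happens away from `b`, so the valence stays three. The multiplicity does not
decrease and is bounded by the valence. -/
lemma Antenna.contract (hne : Γ.src e ≠ Γ.tgt e) (he : Γ.mult (Γ.src e) (Γ.tgt e) = 1)
    {b : Fin (n + 2)} (h : Γ.Antenna b) : (Γ.contract e).Antenna (Γ.proj e b) := by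
  obtain ⟨h1, h2⟩ := h.ne he
  obtain ⟨hv, a, hab, hm⟩ := h
  have hv' := valence_contract_of_ne hne h1 h2
  have hab' : Γ.proj e a ≠ Γ.proj e b := by
    rw [Ne, collapse_eq_iff hne]
    tauto
  refine ⟨hv'.trans hv, Γ.proj e a, hab', le_antisymm ?_ ?_⟩
  · rw [← hv, ← hv']
    exact mult_le_valence _ _ _
  · rw [← hm]
    exact mult_le_contract hne hab'

open Classical in
lemma card_image_antennas (hne : Γ.src e ≠ Γ.tgt e) (he : Γ.mult (Γ.src e) (Γ.tgt e) = 1) :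
    (Γ.antennas.image (Γ.proj e)).card = Γ.antennas.card := by
  refine Finset.card_image_of_injOn fun x hx y hy hxy => ?_
  have h1 := (mem_antennas.1 hx).ne he
  have h2 := (mem_antennas.1 hy).ne he
  simp only [collapse_eq_iff hne] at hxy
  tauto

open Classical in
lemma image_antennas_subset (hne : Γ.src e ≠ Γ.tgt e) (he : Γ.mult (Γ.src e) (Γ.tgt e) = 1) :
    Γ.antennas.image (Γ.proj e) ⊆ (Γ.contract e).antennas := by
  intro x hx
  obtain ⟨b, hb, rfl⟩ := Finset.mem_image.1 hx
  exact mem_antennas.2 ((mem_antennas.1 hb).contract hne he)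

/-- Contraction does not decrease the weight. -/
lemma weight_le_contract (hne : Γ.src e ≠ Γ.tgt e) (he : Γ.mult (Γ.src e) (Γ.tgt e) = 1) :
    Γ.weight ≤ (Γ.contract e).weight := by
  classical
  refine Nat.add_le_add ?_ ?_
  · rw [sum_pairs_eq (e := e)]
    exact Finset.sum_le_sum fun q _ => pairs_contract_le hne he q.1 q.2
  · rw [← card_image_antennas hne he]
    exact Finset.card_le_card (image_antennas_subset hne he)

/-- If contraction preserves the weight, then it merges no pairs of bundles of odd multiplicity. -/
lemma pairs_contract_of_weight_eq (hne : Γ.src e ≠ Γ.tgt e)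
    (he : Γ.mult (Γ.src e) (Γ.tgt e) = 1) (hw : (Γ.contract e).weight = Γ.weight)
    (q : Fin (n + 1) × Fin (n + 1)) :
    (Γ.contract e).pairs q.1 q.2 = ∑ p : Fin (n + 2) × Fin (n + 2) with
      (Γ.proj e p.1, Γ.proj e p.2) = (q.1, q.2), Γ.pairs p.1 p.2 := by
  classical
  have h1 : ∀ q ∈ Finset.univ (α := Fin (n + 1) × Fin (n + 1)), _ :=
    fun q _ => pairs_contract_le hne he q.1 q.2
  have h2 := Finset.card_le_card (image_antennas_subset hne he)
  rw [card_image_antennas hne he] at h2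
  have h3 := Finset.sum_le_sum h1
  rw [← sum_pairs_eq] at h3
  unfold weight at hw
  -- Both parts of the weight can only grow, so equal totals force equality in each part and then in
  -- each term of the first.
  have h4 := (Finset.sum_eq_sum_iff_of_le h1).1 (by rw [← sum_pairs_eq]; omega)
  exact (h4 q (Finset.mem_univ q)).symm

/-- If contraction preserves the weight, then it creates no antennas. -/
lemma antennas_contract_of_weight_eq (hne : Γ.src e ≠ Γ.tgt e)
    (he : Γ.mult (Γ.src e) (Γ.tgt e) = 1) (hw : (Γ.contract e).weight ≤ Γ.weight)
    {b : Fin (n + 2)} : (Γ.contract e).Antenna (Γ.proj e b) ↔ Γ.Antenna b := by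
  classical
  refine ⟨fun hb => ?_, fun hb => hb.contract hne he⟩
  have h2 := image_antennas_subset hne he
  have h3 : ∑ p : Fin (n + 2) × Fin (n + 2), Γ.pairs p.1 p.2 ≤
      ∑ q : Fin (n + 1) × Fin (n + 1), (Γ.contract e).pairs q.1 q.2 := by
    rw [sum_pairs_eq (e := e)]
    exact Finset.sum_le_sum fun q _ => pairs_contract_le hne he q.1 q.2
  unfold weight at hw
  have h4 := Finset.eq_of_subset_of_card_le h2 (by rw [card_image_antennas hne he]; omega)
  have h5 := mem_antennas.2 hb
  rw [← h4] at h5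
  obtain ⟨c, hc, hcb⟩ := Finset.mem_image.1 h5
  have hc' := mem_antennas.1 hc
  have h6 := hc'.ne he
  rw [collapse_eq_iff hne] at hcb
  have : c = b := by tauto
  exact this ▸ hc'

/-- Any edge from `a` to an antenna `b` belongs to its triple edge. Hence, between multiply joined
vertices, `pullSize` depends only on whether `b` is an antenna. -/
lemma antenna_iff {Γ : LegGraph n m r} {a b : Fin n} (hab : a ≠ b) (h : 2 ≤ Γ.mult a b) :
    (Γ.mult a b = 3 ∧ Γ.valence b = 3) ↔ Γ.Antenna b := by
  refine ⟨fun h => ⟨h.2, a, hab, h.1⟩, fun h' => ⟨?_, h'.1⟩⟩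
  obtain ⟨j, hj⟩ : (Γ.bundle a b).Nonempty := Finset.card_pos.1 (by unfold mult at h; omega)
  obtain ⟨c, -, hc, hm⟩ := h'.mem_bundle (j := j) (incident_of_mem_bundle' hj)
  rw [← mult_eq_of_mem_bundle hj, mult_eq_of_mem_bundle hc, hm]

lemma pullSize_eq_ite {Γ : LegGraph n m r} {a b : Fin n} (hab : a ≠ b) (h : 2 ≤ Γ.mult a b)
    [Decidable (Γ.Antenna b)] : Γ.pullSize a b = if Γ.Antenna b then 3 else 2 := by
  unfold pullSize
  simp only [antenna_iff hab h]

/-- Edges with a parallel one cannot be contracted. -/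
lemma proj_ne_of_two_le_mult (hne : Γ.src e ≠ Γ.tgt e) (he : Γ.mult (Γ.src e) (Γ.tgt e) = 1)
    {a b : Fin (n + 2)} (hab : a ≠ b) (h : 2 ≤ Γ.mult a b) : Γ.proj e a ≠ Γ.proj e b := by
  rw [Ne, collapse_eq_iff hne]
  rintro (h' | ⟨rfl, rfl⟩ | ⟨rfl, rfl⟩)
  · exact hab h'
  · omega
  · rw [mult_comm] at h
    omega

/-- This is what the antenna term in the weight is for: at equal weight no antenna is created, so
the rule for the number of moved edges does not change. -/
lemma pullSize_contract (hne : Γ.src e ≠ Γ.tgt e)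
    (he : Γ.mult (Γ.src e) (Γ.tgt e) = 1) (hw : (Γ.contract e).weight = Γ.weight)
    {a b : Fin (n + 2)} (hab : a ≠ b) (h : 2 ≤ Γ.mult a b) :
    (Γ.contract e).pullSize (Γ.proj e a) (Γ.proj e b) = Γ.pullSize a b := by
  classical
  have hp := proj_ne_of_two_le_mult hne he hab h
  rw [pullSize_eq_ite hab h, pullSize_eq_ite hp (h.trans (mult_le_contract hne hp))]
  simp only [antennas_contract_of_weight_eq hne he hw.le]

lemma not_loopless_contract (hne : Γ.src e ≠ Γ.tgt e) (he : Γ.mult (Γ.src e) (Γ.tgt e) ≠ 1) :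
    ∃ j, (Γ.contract e).src j = (Γ.contract e).tgt j := by
  have h1 : e ∈ Γ.bundle (Γ.src e) (Γ.tgt e) := by simp [LegGraph.mem_bundle]
  have h2 : 1 < (Γ.bundle (Γ.src e) (Γ.tgt e)).card := by
    have : 0 < (Γ.bundle (Γ.src e) (Γ.tgt e)).card := Finset.card_pos.2 ⟨e, h1⟩
    unfold mult at he
    omega
  obtain ⟨f, hf, hfe⟩ := Finset.exists_mem_ne h2 e
  obtain ⟨j, rfl⟩ := Fin.exists_succAbove_eq hfe
  refine ⟨j, ?_⟩
  simp only [LegGraph.contract]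
  rw [collapse_eq_iff hne]
  rcases LegGraph.mem_bundle.1 hf with h | h <;> simp [h]

end Contract

end LegGraph

/-! ### Admissible splittings, and the contractions after them that raise the weight -/

open LegGraph

namespace LegGraph

variable {n m r : ℕ}

/-- The conditions under which a vertex can be split. -/
structure CanSplit (Γ : LegGraph n m r) (a b : Fin n) (S : Finset (Fin m)) : Prop where
  ne : a ≠ b
  subset : S ⊆ Γ.bundle a b
  two_le : 2 ≤ S.card
  le_valence : S.card + 2 ≤ Γ.valence a

open Classical in
/-- A choice of the edges that are moved when `a` is split. -/
noncomputable def pullSet (Γ : LegGraph n m r) (a b : Fin n) : Finset (Fin m) :=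
  if h : Γ.pairs a b ≠ 0 then (exists_subset_bundle h).choose else ∅

lemma pullSet_subset (Γ : LegGraph n m r) (a b : Fin n) : Γ.pullSet a b ⊆ Γ.bundle a b := by
  unfold pullSet
  split_ifs with h
  · exact (exists_subset_bundle h).choose_spec.1
  · simp

lemma card_pullSet {Γ : LegGraph n m r} {a b : Fin n} (h : Γ.pairs a b ≠ 0) :
    (Γ.pullSet a b).card = Γ.pullSize a b := by
  unfold pullSet
  rw [dif_pos h]
  exact (exists_subset_bundle h).choose_spec.2

lemma IsoVia.canSplit {Γ Γ' : LegGraph n m r} {σ : Equiv.Perm (Fin n)} {τ : Equiv.Perm (Fin m)}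
    {φ : Fin m → Bool} (h : IsoVia Γ Γ' σ τ φ) {a b : Fin n} {S : Finset (Fin m)} :
    Γ'.CanSplit (σ a) (σ b) (S.map τ.toEmbedding) ↔ Γ.CanSplit a b S := by
  constructor
  · rintro ⟨h1, h2, h3, h4⟩
    rw [← h.map_bundle, Finset.map_subset_map] at h2
    rw [Finset.card_map] at h3 h4
    exact ⟨fun hab => h1 (hab ▸ rfl), h2, h3, h.valence a ▸ h4⟩
  · rintro ⟨h1, h2, h3, h4⟩
    refine ⟨by simpa using h1, ?_, by simpa using h3, ?_⟩
    · rw [← h.map_bundle, Finset.map_subset_map]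
      exact h2
    · rw [Finset.card_map, h.valence]
      exact h4

lemma IsoVia.pairs {Γ Γ' : LegGraph n m r} {σ : Equiv.Perm (Fin n)} {τ : Equiv.Perm (Fin m)}
    {φ : Fin m → Bool} (h : IsoVia Γ Γ' σ τ φ) (a b : Fin n) :
    Γ'.pairs (σ a) (σ b) = Γ.pairs a b := by
  unfold LegGraph.pairs
  simp [h.mult]

lemma IsoVia.pullSize {Γ Γ' : LegGraph n m r} {σ : Equiv.Perm (Fin n)} {τ : Equiv.Perm (Fin m)}
    {φ : Fin m → Bool} (h : IsoVia Γ Γ' σ τ φ) (a b : Fin n) :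
    Γ'.pullSize (σ a) (σ b) = Γ.pullSize a b := by
  unfold LegGraph.pullSize
  rw [h.mult, h.valence]

lemma eraseEdge_subset {Γ : LegGraph (n + 2) (m + 1) r} {a b : Fin (n + 2)}
    {S : Finset (Fin (m + 1))} (hS : S ⊆ Γ.bundle a b) (e : Fin (m + 1)) :
    eraseEdge S e ⊆ (Γ.contract e).bundle (Γ.proj e a) (Γ.proj e b) := by
  intro j hj
  have := mem_bundle.1 (hS (mem_eraseEdge.1 hj))
  rw [mem_bundle]
  simp only [contract]
  rcases this with ⟨h1, h2⟩ | ⟨h1, h2⟩ <;> simp [h1, h2]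

/-- Two half-edges are lost in a merger, but the other vertex contributes at least three. -/
lemma valence_le_contract {Γ : LegGraph (n + 2) (m + 1) r} {e : Fin (m + 1)}
    (h : ∀ v, 3 ≤ Γ.valence v) (hne : Γ.src e ≠ Γ.tgt e) (a : Fin (n + 2)) :
    Γ.valence a ≤ (Γ.contract e).valence (Γ.proj e a) := by
  have h1 := valence_contract_tgt hne
  by_cases hs : a = Γ.src e
  · subst hs
    have := h (Γ.tgt e)
    rw [proj_src hne]
    omega
  · by_cases ht : a = Γ.tgt e
    · subst ht
      have := h (Γ.src e)
      omega
    · exact (valence_contract_of_ne hne hs ht).ge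

lemma mult_ne_one_of_parallel {Γ : LegGraph n m r} {e f : Fin m} (hef : e ≠ f)
    (h : f ∈ Γ.bundle (Γ.src e) (Γ.tgt e)) : Γ.mult (Γ.src e) (Γ.tgt e) ≠ 1 := by
  intro h1
  obtain ⟨k, hk⟩ := Finset.card_eq_one.1 h1
  have h2 : e ∈ Γ.bundle (Γ.src e) (Γ.tgt e) := by simp [mem_bundle]
  rw [hk, Finset.mem_singleton] at h h2
  exact hef (h2.trans h.symm)

/-- Splitting and contracting an edge parallel to the ones that are moved increases the weight. -/
lemma weight_lt_contract_split {Γ : LegGraph (n + 1) m r} {a b : Fin (n + 1)} {S : Finset (Fin m)}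
    {e : Fin m} (h : Γ.CanSplit a b S) (hc : S.card = Γ.pullSize a b)
    (hl : Γ.Loopless) (he : Γ.mult (Γ.src e) (Γ.tgt e) ≠ 1)
    (he' : (Γ.split a S).mult ((Γ.split a S).src e.succ) ((Γ.split a S).tgt e.succ) = 1) :
    Γ.weight < ((Γ.split a S).contract e.succ).weight := by
  classical
  obtain ⟨hab, hS, h2, hv⟩ := h
  -- A moved edge keeps a parallel companion, as at least two edges are moved together.
  have heS : e ∉ S := by
    intro heS
    obtain ⟨f, hf, hfe⟩ := Finset.exists_mem_ne (show 1 < S.card by omega) e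
    refine mult_ne_one_of_parallel (f := f.succ) (by simpa using hfe.symm) ?_ he'
    have h1 := mem_bundle.1 (hS heS)
    have h2 := mem_bundle.1 (hS hf)
    rw [mem_bundle]
    rcases h1 with ⟨h1, h1'⟩ | ⟨h1, h1'⟩ <;> rcases h2 with ⟨h2, h2'⟩ | ⟨h2, h2'⟩ <;>
      simp [heS, hf, h1, h1', h2, h2', hab.symm]
  have heq : (Γ.split a S).mult (Γ.src e).succ (Γ.tgt e).succ = 1 := by
    simpa [heS] using he'
  have heB : e ∈ Γ.bundle a b := by
    by_contra heB
    rw [mult_split_succ_of_ne (fun h => heB (mem_bundle.2 h)) hS] at heq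
    exact he heq
  have heq' : (Γ.split a S).mult a.succ b.succ = 1 := by
    rcases mem_bundle.1 heB with ⟨h1, h2⟩ | ⟨h1, h2⟩
    · rwa [h1, h2] at heq
    · rw [h1, h2, mult_comm] at heq
      exact heq
  rw [mult_split_succ_self hS] at heq'
  -- If three edges were moved, the bundle had exactly three edges and none would be left.
  have hc2 : S.card = 2 := by
    rw [hc] at heq' ⊢
    unfold pullSize at *
    split_ifs at * with h3
    · omega
    · rfl
  refine (weight_le_split hab hS hc hv).trans_lt ?_
  -- Without an increase of weight the contraction would create no antenna. But the new vertex has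
  -- one edge to `a` and two to `b`, so it becomes an antenna when `a` and `b` are merged.
  by_contra hw
  have hne := (hl.split hab hS) e.succ
  have key := antennas_contract_of_weight_eq (Γ := Γ.split a S) (e := e.succ) hne he'
    (not_lt.1 hw) (b := 0)
  have h0 : ¬ (Γ.split a S).Antenna 0 := by
    rintro ⟨h3, v, hv0, hm⟩
    have h4 := (not_incident_of_valence (Γ := Γ.split a S) (a := 0)
      (S := (Γ.split a S).bundle v 0) (fun j hj => incident_of_mem_bundle' hj)
      (h3.trans hm.symm)).1
    obtain ⟨j, hj⟩ : S.Nonempty := Finset.card_pos.1 (by omega)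
    have h5 : (0 : Fin (m + 1)) ∈ (Γ.split a S).bundle v 0 := by
      by_contra h
      exact (h4 _ h).2 rfl
    have h6 : j.succ ∈ (Γ.split a S).bundle v 0 := by
      by_contra h
      have h7 := h4 _ h
      rcases mem_bundle.1 (hS hj) with ⟨h1, h1'⟩ | ⟨h1, h1'⟩ <;> simp [hj, h1, h1'] at h7
    have h7 : v = a.succ := by
      rcases mem_bundle.1 h5 with ⟨h, -⟩ | ⟨h, -⟩
      · exact h.symm
      · exact absurd h (Fin.succ_ne_zero a)
    rw [mem_bundle, h7] at h6
    rcases mem_bundle.1 (hS hj) with ⟨h1, h1'⟩ | ⟨h1, h1'⟩ <;>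
      simp [hj, h1, h1', hab.symm, (Fin.succ_ne_zero _).symm] at h6
  refine h0 (key.1 ?_)
  have hs : (Γ.split a S).src e.succ = (Γ.src e).succ := by simp [heS]
  have ht : (Γ.split a S).tgt e.succ = (Γ.tgt e).succ := by simp [heS]
  have hval : ((Γ.split a S).contract e.succ).valence ((Γ.split a S).proj e.succ 0) = 3 := by
    rw [valence_contract_of_ne hne (by rw [hs]; exact (Fin.succ_ne_zero _).symm)
      (by rw [ht]; exact (Fin.succ_ne_zero _).symm), valence_split_zero hab hS, hc2]
  have hpr : (Γ.split a S).proj e.succ a.succ = (Γ.split a S).proj e.succ b.succ := by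
    rw [collapse_eq_iff hne, hs, ht]
    rcases mem_bundle.1 heB with ⟨h1, h2⟩ | ⟨h1, h2⟩ <;> simp [h1, h2]
  have hpr0 : (Γ.split a S).proj e.succ b.succ ≠ (Γ.split a S).proj e.succ 0 := by
    rw [Ne, collapse_eq_iff hne, hs, ht]
    simp [(Fin.succ_ne_zero _).symm]
  refine ⟨hval, (Γ.split a S).proj e.succ b.succ, hpr0, le_antisymm ?_ ?_⟩
  · rw [← hval]
    exact mult_le_valence _ _ _
  · rw [mult_contract hpr0 hne]
    have hsub : ({(a.succ, 0), (b.succ, 0)} : Finset (Fin (n + 2) × Fin (n + 2))) ⊆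
        Finset.univ.filter fun p => ((Γ.split a S).proj e.succ p.1, (Γ.split a S).proj e.succ p.2)
          = ((Γ.split a S).proj e.succ b.succ, (Γ.split a S).proj e.succ 0) := by
      intro p hp
      simp only [Finset.mem_insert, Finset.mem_singleton] at hp
      rcases hp with rfl | rfl
      · simp [hpr]
      · simp
    refine le_trans ?_ (Finset.sum_le_sum_of_subset (f := fun p : Fin (n + 2) × Fin (n + 2) =>
      (Γ.split a S).mult p.1 p.2) hsub)
    rw [Finset.sum_pair (by simpa using hab)]
    change 3 ≤ (Γ.split a S).mult a.succ 0 + (Γ.split a S).mult b.succ 0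
    rw [mult_comm _ b.succ, mult_split_zero_succ hab hS, hc2]
    have : 0 < (Γ.split a S).mult a.succ 0 :=
      Finset.card_pos.2 ⟨0, mem_bundle.2 (.inl ⟨rfl, rfl⟩)⟩
    omega

end LegGraph

/-! ### The weight filtration and the homotopy -/

noncomputable section

variable {g r i : ℕ}

lemma cl_eq_zero_of_isIso {Γ : Gen g r i} {τ : Equiv.Perm (Fin (g + i))}
    (h : IsIso Γ.1 Γ.1 τ (-1)) : cl Γ = 0 := by
  have := cl_eq_of_isIso h
  simp only [Units.val_neg, Units.val_one, Int.cast_neg, Int.cast_one, neg_smul, one_smul] at this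
  have h2 : (2 : ℚ) • cl Γ = 0 := by
    rw [two_smul]
    nth_rewrite 1 [this]
    simp
  exact (smul_eq_zero.1 h2).resolve_left two_ne_zero

/-- Reversing a self-edge fixes the graph and changes the orientation. -/
lemma cl_eq_zero_of_loop {Γ : Gen g r i} (h : ¬ Γ.1.Loopless) : cl Γ = 0 := by
  unfold Loopless at h
  push Not at h
  obtain ⟨j, hj⟩ := h
  have h1 := isIso_reverse Γ.1 j
  have h2 : reverse Γ.1 j = Γ.1 := by
    ext k
    · by_cases hk : k = j
      · subst hk; simp [reverse, hj]
      · simp [reverse, hk]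
    · by_cases hk : k = j
      · subst hk; simp [reverse, hj]
      · simp [reverse, hk]
    · rfl
  rw [h2] at h1
  exact cl_eq_zero_of_isIso h1

/-- The filtration of the complex by the weight. -/
def fil (g r i k : ℕ) : Submodule ℚ (Graphs g r i) :=
  Submodule.span ℚ {x | ∃ Γ : Gen g r i, Γ.1.Loopless ∧ k ≤ Γ.1.weight ∧ x = cl Γ}

lemma cl_mem_fil {Γ : Gen g r i} {k : ℕ} (h : k ≤ Γ.1.weight) : cl Γ ∈ fil g r i k := by
  by_cases hl : Γ.1.Loopless
  · exact Submodule.subset_span ⟨Γ, hl, h, rfl⟩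
  · rw [cl_eq_zero_of_loop hl]
    exact Submodule.zero_mem _

lemma fil_anti {k l : ℕ} (h : k ≤ l) : fil g r i l ≤ fil g r i k := by
  refine Submodule.span_le.2 ?_
  rintro _ ⟨Γ, -, hw, rfl⟩
  exact cl_mem_fil (h.trans hw)

/-- Splitting of a vertex of a generator. -/
def Gen.split (Γ : Gen g r i) {a b : Fin (i + 1)} {S : Finset (Fin (g + i))}
    (h : Γ.1.CanSplit a b S) : Gen g r (i + 1) :=
  ⟨Γ.1.split a S, Γ.2.1.split h.ne h.subset,
    three_le_valence_split Γ.2.2 h.ne h.subset h.two_le h.le_valence⟩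

open Classical in
/-- The class of a split graph, zero if the vertex cannot be split. -/
def splitCl (Γ : Gen g r i) (a b : Fin (i + 1)) (S : Finset (Fin (g + i))) : Graphs g r (i + 1) :=
  if h : Γ.1.CanSplit a b S then cl (Γ.split h) else 0

lemma splitCl_of_isoVia {Γ Γ' : Gen g r i} {σ : Equiv.Perm (Fin (i + 1))}
    {τ : Equiv.Perm (Fin (g + i))} {φ : Fin (g + i) → Bool} (h : IsoVia Γ.1 Γ'.1 σ τ φ)
    (a b : Fin (i + 1)) (S : Finset (Fin (g + i))) :
    splitCl Γ' (σ a) (σ b) (S.map τ.toEmbedding) =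
      (((Equiv.Perm.sign σ * ∏ j, (if φ j then (-1 : ℤˣ) else 1) : ℤˣ) : ℤ) : ℚ) •
        splitCl Γ a b S := by
  unfold splitCl
  by_cases hS : Γ.1.CanSplit a b S
  · have hS' := h.canSplit.2 hS
    rw [dif_pos hS, dif_pos hS']
    exact cl_eq_of_isIso (Γ := Γ.split hS) (Γ' := Γ'.split hS') (h.split a S)
  · rw [dif_neg hS, dif_neg (mt h.canSplit.1 hS), smul_zero]

/-- The class of a split graph depends only on the number of parallel edges that are moved. -/
lemma splitCl_eq {Γ : Gen g r i} {a b : Fin (i + 1)} {S S' : Finset (Fin (g + i))}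
    (hab : a ≠ b) (hS : S ⊆ Γ.1.bundle a b) (hS' : S' ⊆ Γ.1.bundle a b) (hc : S.card = S'.card) :
    splitCl Γ a b S = splitCl Γ a b S' := by
  obtain ⟨τ, φ, h, rfl, hs⟩ := exists_isoVia_of_bundle Γ.1 hab hS hS' hc
  have := splitCl_of_isoVia h a b S
  rw [hs] at this
  simpa using this.symm

/-- The homotopy on generators. -/
def pullSum (Γ : Gen g r i) : Graphs g r (i + 1) :=
  ∑ p : Fin (i + 1) × Fin (i + 1), (Γ.1.pairs p.1 p.2 : ℚ) •
    splitCl Γ p.1 p.2 (Γ.1.pullSet p.1 p.2)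

/-- The chosen sets `pullSet` need not correspond under the isomorphism, but their sizes do, and by
`splitCl_eq` only the sizes matter. -/
lemma pullSum_of_isIso {Γ Γ' : Gen g r i} {τ : Equiv.Perm (Fin (g + i))} {s : ℤˣ}
    (h : IsIso Γ.1 Γ'.1 τ s) : pullSum Γ' = ((s : ℤ) : ℚ) • pullSum Γ := by
  obtain ⟨σ, φ, hv, rfl⟩ := h.exists_isoVia
  clear h
  unfold pullSum
  rw [← Equiv.sum_comp (Equiv.prodCongr σ σ), Finset.smul_sum]
  refine Finset.sum_congr rfl fun p _ => ?_
  obtain ⟨a, b⟩ := p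
  simp only [Equiv.prodCongr_apply, Prod.map_apply, hv.pairs]
  by_cases hp : Γ.1.pairs a b = 0
  · simp [hp]
  · have hab := (pullSize_le_mult hp).1
    have hp' : Γ'.1.pairs (σ a) (σ b) ≠ 0 := by rwa [hv.pairs]
    rw [splitCl_eq (S' := (Γ.1.pullSet a b).map τ.toEmbedding) (by simpa using hab)
      (pullSet_subset _ _ _), splitCl_of_isoVia hv, smul_comm]
    · rw [← hv.map_bundle, Finset.map_subset_map]
      exact pullSet_subset _ _ _
    · rw [Finset.card_map, card_pullSet hp, card_pullSet hp', hv.pullSize]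

/-- The homotopy, which splits off pairs of parallel edges (and triple edges without further
half-edges at one end). -/
def homotopy (g r i : ℕ) : Graphs g r i →ₗ[ℚ] Graphs g r (i + 1) :=
  (relations g r i).liftQ (Finsupp.linearCombination ℚ pullSum) <|
    relations_le_ker _ fun _ _ _ _ h => pullSum_of_isIso h

lemma homotopy_cl (Γ : Gen g r i) : homotopy g r i (cl Γ) = pullSum Γ := by
  simp [homotopy, cl]

/-- Besides the prescribed size, two edges are allowed where three are prescribed: the split graph
then has an odd automorphism and vanishes. This occurs when a contraction has turned `b` into an
antenna. -/
lemma splitCl_mem_fil {Γ : Gen g r i} {a b : Fin (i + 1)} {S : Finset (Fin (g + i))}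
    (hab : a ≠ b) (hS : S ⊆ Γ.1.bundle a b)
    (hc : S.card = 2 ∨ (S.card = 3 ∧ Γ.1.pullSize a b = 3)) :
    splitCl Γ a b S ∈ fil g r (i + 1) Γ.1.weight := by
  unfold splitCl
  split_ifs with h
  · by_cases hp : S.card = Γ.1.pullSize a b
    · exact cl_mem_fil (weight_le_split hab hS hp h.le_valence)
    · have h3 : Γ.1.pullSize a b = 3 ∧ S.card = 2 := by
        have := Γ.1.pullSize_eq a b
        omega
      have h4 : Γ.1.mult a b = 3 ∧ Γ.1.valence b = 3 := by
        by_contra h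
        simp [pullSize, h] at h3
      obtain ⟨τ, hτ⟩ := isIso_split_of_valence_eq_three hab hS h3.2 h4.1 h4.2
      rw [cl_eq_zero_of_isIso (Γ := Γ.split h) hτ]
      exact Submodule.zero_mem _
  · exact Submodule.zero_mem _

lemma pullSum_mem_fil (Γ : Gen g r i) : pullSum Γ ∈ fil g r (i + 1) Γ.1.weight := by
  refine Submodule.sum_mem _ fun p _ => ?_
  by_cases hp : Γ.1.pairs p.1 p.2 = 0
  · simp [hp]
  · refine Submodule.smul_mem _ _ (splitCl_mem_fil (pullSize_le_mult hp).1 (pullSet_subset _ _ _) ?_)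
    rw [card_pullSet hp]
    have := Γ.1.pullSize_eq p.1 p.2
    omega

lemma map_mem_of_mem_fil {j k : ℕ} {M : Submodule ℚ (Graphs g r j)}
    (f : Graphs g r i →ₗ[ℚ] Graphs g r j)
    (h : ∀ Γ : Gen g r i, Γ.1.Loopless → k ≤ Γ.1.weight → f (cl Γ) ∈ M)
    {x : Graphs g r i} (hx : x ∈ fil g r i k) : f x ∈ M := by
  suffices fil g r i k ≤ M.comap f from this hx
  refine Submodule.span_le.2 ?_
  rintro _ ⟨Γ, hl, hw, rfl⟩
  exact h Γ hl hw

lemma homotopy_mem_fil {k : ℕ} {x : Graphs g r i} (hx : x ∈ fil g r i k) :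
    homotopy g r i x ∈ fil g r (i + 1) k := by
  refine map_mem_of_mem_fil (homotopy g r i) (fun Γ _ hw => ?_) hx
  rw [homotopy_cl]
  exact fil_anti hw (pullSum_mem_fil Γ)

/-- An edge parallel to `e` becomes a self-edge. -/
lemma contractTerm_eq_zero {Γ : Gen g r (i + 1)} {e : Fin (g + (i + 1))}
    (he : Γ.1.mult (Γ.1.src e) (Γ.1.tgt e) ≠ 1) : contractTerm Γ e = 0 := by
  unfold contractTerm
  split_ifs with hne
  · rw [cl_eq_zero_of_loop, smul_zero]
    obtain ⟨j, hj⟩ := not_loopless_contract (Γ := Γ.1) (n := i) (m := g + i) hne he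
    exact fun h => h j hj
  · rfl

lemma contractTerm_mem_fil {Γ : Gen g r (i + 1)} {e : Fin (g + (i + 1))} :
    contractTerm Γ e ∈ fil g r i Γ.1.weight := by
  by_cases he : Γ.1.mult (Γ.1.src e) (Γ.1.tgt e) = 1
  · unfold contractTerm
    split_ifs with hne
    · exact Submodule.smul_mem _ _ (cl_mem_fil
        (weight_le_contract (Γ := Γ.1) (n := i) (m := g + i) hne he))
    · exact Submodule.zero_mem _
  · rw [contractTerm_eq_zero he]
    exact Submodule.zero_mem _

lemma diff_mem_fil {k : ℕ} {x : Graphs g r (i + 1)} (hx : x ∈ fil g r (i + 1) k) :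
    diff g r i x ∈ fil g r i k := by
  refine map_mem_of_mem_fil (diff g r i) (fun Γ _ hw => ?_) hx
  rw [diff_cl]
  exact Submodule.sum_mem _ fun e _ => fil_anti hw contractTerm_mem_fil

end

/-! ### The Laplacian modulo higher weight -/

open LegGraph

namespace LegGraph

variable {n m r : ℕ}

/-- All half-edges at `a`, except one that belongs to the edge `e`, are moved when `a` is split. -/
def Thin (Γ : LegGraph n m r) (a b : Fin n) (e : Fin m) : Prop :=
  Γ.valence a = Γ.pullSize a b + 1 ∧ (Γ.src e = a ∨ Γ.tgt e = a) ∧ e ∉ Γ.bundle a b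

open Classical in
/-- The eigenvalue of the commutator of homotopy and differential, up to higher weight. -/
noncomputable def eigenvalue (Γ : LegGraph n m r) : ℕ :=
  ∑ p : Fin n × Fin n, Γ.pairs p.1 p.2 *
    ((if Γ.pullSize p.1 p.2 + 2 ≤ Γ.valence p.1 then 1 else 0) +
      ∑ e, if Γ.Thin p.1 p.2 e then 1 else 0)

lemma canSplit_pullSet_iff {Γ : LegGraph n m r} {a b : Fin n} (hp : Γ.pairs a b ≠ 0) :
    Γ.CanSplit a b (Γ.pullSet a b) ↔ Γ.pullSize a b + 2 ≤ Γ.valence a := by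
  refine ⟨fun h => card_pullSet hp ▸ h.le_valence, fun h => ⟨(pullSize_le_mult hp).1,
    pullSet_subset _ _ _, ?_, ?_⟩⟩
  · rw [card_pullSet hp]
    have := Γ.pullSize_eq a b
    omega
  · rwa [card_pullSet hp]

/-- Two parallel edges at `a` outside the bundle, together with the bundle, need at least `pullSize
+ 2` half-edges. -/
lemma not_thin_of_mult_ne_one {Γ : LegGraph n m r} {a b : Fin n} {e : Fin m}
    (hp : Γ.pairs a b ≠ 0) (he : Γ.mult (Γ.src e) (Γ.tgt e) ≠ 1) : ¬ Γ.Thin a b e := by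
  classical
  rintro ⟨hv, hea, heb⟩
  have h2 : 2 ≤ (Γ.bundle (Γ.src e) (Γ.tgt e)).card := by
    have : 0 < (Γ.bundle (Γ.src e) (Γ.tgt e)).card := Finset.card_pos.2 ⟨e, by simp [mem_bundle]⟩
    unfold mult at he
    omega
  have h3 := (pullSize_le_mult hp).2
  have hd : Disjoint (Γ.bundle a b) (Γ.bundle (Γ.src e) (Γ.tgt e)) := by
    rw [Finset.disjoint_left]
    intro j h4 h5
    rw [mem_bundle] at heb h4 h5
    grind
  have h4 := Γ.card_add_card_le_valence a (Γ.bundle a b ∪ Γ.bundle (Γ.src e) (Γ.tgt e)) ∅ (by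
    intro j hj
    rcases Finset.mem_union.1 hj with hj | hj
    · exact incident_of_mem_bundle hj
    · rw [mem_bundle] at hj
      rcases hea with rfl | rfl <;> tauto) (by simp)
  rw [Finset.card_union_of_disjoint hd, Finset.card_empty] at h4
  change Γ.mult a b + _ + 0 ≤ _ at h4
  omega

end LegGraph

noncomputable section

variable {g r i : ℕ}

open Classical in
/-- A summand of the differential of a split graph. -/
def splitContractTerm (Γ : Gen g r i) (a b : Fin (i + 1)) (S : Finset (Fin (g + i)))
    (e : Fin (g + i)) : Graphs g r i :=
  if h : Γ.1.CanSplit a b S then contractTerm (Γ.split h) (Fin.succ e : Fin (g + i + 1)) else 0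

-- The first summand is the contraction of the new edge. Its head is the vertex `0`, so it returns
-- `Γ` with sign `+1`.
open Classical in
lemma diff_splitCl (Γ : Gen g r i) (a b : Fin (i + 1)) (S : Finset (Fin (g + i))) :
    diff g r i (splitCl Γ a b S) = (if Γ.1.CanSplit a b S then cl Γ else 0) +
      ∑ e, splitContractTerm Γ a b S e := by
  unfold splitCl splitContractTerm
  split_ifs with h
  · rw [diff_cl]
    refine (Fin.sum_univ_succ (n := g + i) _).trans ?_
    congr 1
    unfold contractTerm
    have hne : (Γ.split h).1.src (0 : Fin (g + i + 1)) ≠ (Γ.split h).1.tgt (0 : Fin (g + i + 1)) :=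
      Fin.succ_ne_zero a
    rw [dif_pos hne]
    have h1 : (Γ.split h).1.tgt (0 : Fin (g + i + 1)) = 0 := rfl
    have h2 : (Γ.split h).contract (0 : Fin (g + i + 1)) hne = Γ :=
      Subtype.ext (contract_split_zero Γ.1 a S)
    rw [h2, h1]
    simp
  · simp

/-- Splitting and contraction commute on graphs; the sign arises because the new vertex `0` shifts
the position of the head of `e` by one. -/
lemma splitContractTerm_eq (Γ : Gen g r (i + 1)) {a b : Fin (i + 2)}
    {S : Finset (Fin (g + (i + 1)))} {e : Fin (g + (i + 1))} (h : Γ.1.CanSplit a b S) (he : e ∉ S)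
    (hne : Γ.1.src e ≠ Γ.1.tgt e) (hab : Γ.1.proj e a ≠ Γ.1.proj e b) :
    splitContractTerm Γ a b S e = -((-1 : ℚ) ^ (Γ.1.tgt e : ℕ) •
      splitCl (Γ.contract e hne) (Γ.1.proj e a) (Γ.1.proj e b) (eraseEdge (m := g + i) S e)) := by
  have hcard := card_eraseEdge (m := g + i) he
  have h' : (Γ.contract e hne).1.CanSplit (Γ.1.proj e a) (Γ.1.proj e b)
      (eraseEdge (m := g + i) S e) :=
    ⟨hab, eraseEdge_subset (Γ := Γ.1) (n := i) (m := g + i) h.subset e, hcard.symm ▸ h.two_le, by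
      rw [hcard]
      exact h.le_valence.trans
        (valence_le_contract (Γ := Γ.1) (n := i) (m := g + i) Γ.2.2 hne a)⟩
  unfold splitContractTerm splitCl
  rw [dif_pos h, dif_pos h']
  unfold contractTerm
  have hs : (Γ.split h).1.src (Fin.succ e : Fin (g + (i + 1) + 1)) = (Γ.1.src e).succ := by
    change (Γ.1.split a S).src (Fin.succ e) = _
    simp [he]
  have ht : (Γ.split h).1.tgt (Fin.succ e : Fin (g + (i + 1) + 1)) = (Γ.1.tgt e).succ := by
    change (Γ.1.split a S).tgt (Fin.succ e) = _
    simp [he]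
  have hne' : (Γ.split h).1.src (Fin.succ e : Fin (g + (i + 1) + 1)) ≠
      (Γ.split h).1.tgt (Fin.succ e : Fin (g + (i + 1) + 1)) := by
    rw [hs, ht]
    simpa using hne
  have h2 : (Γ.split h).contract (Fin.succ e : Fin (g + (i + 1) + 1)) hne'
      = (Γ.contract e hne).split h' :=
    Subtype.ext (contract_split_succ (Γ := Γ.1) (n := i) (m := g + i) h.subset he hne hab)
  rw [dif_pos hne', h2, ht, Fin.val_succ, pow_succ, mul_neg_one, neg_smul]

/-- Here `e` holds the only half-edge at `a` outside `S`. Contracting it merges `a` into its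
neighbour, and splitting `S` off from there recreates `a`. The split is admissible because the
neighbour has valence at least three. -/
lemma smul_splitCl_contract (Γ : Gen g r (i + 1)) {a b : Fin (i + 2)}
    {S : Finset (Fin (g + (i + 1)))} {e : Fin (g + (i + 1))} (hS : S ⊆ Γ.1.bundle a b)
    (h2 : 2 ≤ S.card) (he : e ∉ Γ.1.bundle a b) (hea : Γ.1.src e = a ∨ Γ.1.tgt e = a)
    (hne : Γ.1.src e ≠ Γ.1.tgt e) (hab : Γ.1.proj e a ≠ Γ.1.proj e b)
    (hv : Γ.1.valence a = S.card + 1) :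
    (-1 : ℚ) ^ (Γ.1.tgt e : ℕ) • splitCl (Γ.contract e hne) (Γ.1.proj e a) (Γ.1.proj e b)
      (eraseEdge (m := g + i) S e) = cl Γ := by
  have hcard := card_eraseEdge (m := g + i) (fun h => he (hS h))
  have hv' : (Γ.contract e hne).1.valence (Γ.1.proj e a) + 2 =
      Γ.1.valence (Γ.1.src e) + Γ.1.valence (Γ.1.tgt e) := by
    have := valence_contract_tgt (Γ := Γ.1) (n := i) (m := g + i) hne
    rcases hea with rfl | rfl
    · rw [proj_src (n := i) (m := g + i) hne]
      exact this
    · exact this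
  have h' : (Γ.contract e hne).1.CanSplit (Γ.1.proj e a) (Γ.1.proj e b)
      (eraseEdge (m := g + i) S e) :=
    ⟨hab, eraseEdge_subset (Γ := Γ.1) (n := i) (m := g + i) hS e, hcard.symm ▸ h2, by
      rw [hcard]
      have h3 := Γ.2.2 (Γ.1.src e)
      have h4 := Γ.2.2 (Γ.1.tgt e)
      rcases hea with rfl | rfl <;> omega⟩
  unfold splitCl
  rw [dif_pos h']
  obtain ⟨τ, hτ⟩ := isIso_split_contract (Γ := Γ.1) (n := i) (m := g + i)
    (fun h => hab (congrArg _ h)) hS he hea hne hv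
  rw [cl_eq_of_isIso (Γ := (Γ.contract e hne).split h') (Γ' := Γ) hτ]
  simp

/-- If `e` still has a parallel edge after the splitting, its contraction vanishes; otherwise the
splitting has isolated it, and `weight_lt_contract_split` applies. -/
lemma splitContractTerm_mem_fil (Γ : Gen g r (i + 1)) (hl : Γ.1.Loopless) {a b : Fin (i + 2)}
    {S : Finset (Fin (g + (i + 1)))} {e : Fin (g + (i + 1))} (hc : S.card = Γ.1.pullSize a b)
    (he : Γ.1.mult (Γ.1.src e) (Γ.1.tgt e) ≠ 1) :
    splitContractTerm Γ a b S e ∈ fil g r (i + 1) (Γ.1.weight + 1) := by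
  unfold splitContractTerm
  split_ifs with h
  · by_cases he' : (Γ.split h).1.mult ((Γ.split h).1.src (Fin.succ e : Fin (g + (i + 1) + 1)))
        ((Γ.split h).1.tgt (Fin.succ e : Fin (g + (i + 1) + 1))) = 1
    · unfold contractTerm
      split_ifs with hne
      · exact Submodule.smul_mem _ _ (cl_mem_fil (weight_lt_contract_split h hc hl he he'))
      · exact Submodule.zero_mem _
    · rw [contractTerm_eq_zero he']
      exact Submodule.zero_mem _
  · exact Submodule.zero_mem _

-- Three cases. If `a` can be split, `e` is not thin and the operations commute. If `e` is thin,
-- only contracting first is possible, and this returns `Γ`. Otherwise `e` does not meet `a`, whose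
-- valence remains too small, and everything is zero.
open Classical in
lemma splitContractTerm_sub {Γ : Gen g r (i + 1)} {a b : Fin (i + 2)} {e : Fin (g + (i + 1))}
    (hp : Γ.1.pairs a b ≠ 0) (hne : Γ.1.src e ≠ Γ.1.tgt e)
    (he : Γ.1.mult (Γ.1.src e) (Γ.1.tgt e) = 1) :
    splitContractTerm Γ a b (Γ.1.pullSet a b) e - (if Γ.1.Thin a b e then cl Γ else 0) =
      -((-1 : ℚ) ^ (Γ.1.tgt e : ℕ) • splitCl (Γ.contract e hne) (Γ.1.proj e a) (Γ.1.proj e b)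
        (eraseEdge (m := g + i) (Γ.1.pullSet a b) e)) := by
  obtain ⟨hab, hm⟩ := pullSize_le_mult hp
  have h2 := Γ.1.pullSize_eq a b
  have hS := pullSet_subset Γ.1 a b
  have hc := card_pullSet hp
  have heB : e ∉ Γ.1.bundle a b := by
    intro h
    have := mult_eq_of_mem_bundle h
    omega
  have hpab := proj_ne_of_two_le_mult (n := i) (m := g + i) hne he hab (by omega)
  by_cases hcs : Γ.1.CanSplit a b (Γ.1.pullSet a b)
  · have ht : ¬ Γ.1.Thin a b e := by
      rintro ⟨h, -⟩
      have := (canSplit_pullSet_iff hp).1 hcs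
      omega
    rw [if_neg ht, sub_zero, splitContractTerm_eq Γ hcs (fun h => heB (hS h)) hne hpab]
  · have h0 : splitContractTerm Γ a b (Γ.1.pullSet a b) e = 0 := by
      unfold splitContractTerm
      rw [dif_neg hcs]
    rw [h0, zero_sub, neg_inj]
    by_cases ht : Γ.1.Thin a b e
    · obtain ⟨hv, hea, -⟩ := ht
      rw [if_pos ⟨hv, hea, heB⟩, smul_splitCl_contract Γ hS (by omega) heB hea hne hpab (by omega)]
    · rw [if_neg ht]
      have hea : ¬ (Γ.1.src e = a ∨ Γ.1.tgt e = a) := by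
        intro hea
        have hv : Γ.1.valence a ≤ Γ.1.pullSize a b + 1 := by
          rw [canSplit_pullSet_iff hp] at hcs
          omega
        have := Γ.1.card_add_card_le_valence a (insert e (Γ.1.bundle a b)) ∅ (by
          intro j hj
          rcases Finset.mem_insert.1 hj with rfl | hj
          · exact hea
          · exact incident_of_mem_bundle hj) (by simp)
        rw [Finset.card_insert_of_notMem heB] at this
        change Γ.1.mult a b + 1 + 0 ≤ _ at this
        exact ht ⟨by omega, hea, heB⟩
      have hv := valence_contract_of_ne (Γ := Γ.1) (n := i) (m := g + i) (v := a) hne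
        (fun h => hea (.inl h.symm)) (fun h => hea (.inr h.symm))
      unfold splitCl
      rw [dif_neg, smul_zero]
      rintro ⟨-, -, -, h4⟩
      rw [card_eraseEdge (m := g + i) (fun h => heB (hS h)), hc] at h4
      exact hcs ((canSplit_pullSet_iff hp).2 (h4.trans_eq hv))

-- The cancellation between `d h` and `h d` holds separately for each edge `e` of `Γ`. If `e` has a
-- parallel edge, its contraction is zero, and contractions of `e` after splitting have higher
-- weight.
open Classical in
lemma sum_splitContractTerm_mem_fil (Γ : Gen g r (i + 1)) (hl : Γ.1.Loopless)
    (e : Fin (g + (i + 1))) :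
    ∑ p : Fin (i + 2) × Fin (i + 2), (Γ.1.pairs p.1 p.2 : ℚ) •
        (splitContractTerm Γ p.1 p.2 (Γ.1.pullSet p.1 p.2) e -
          if Γ.1.Thin p.1 p.2 e then cl Γ else 0) +
      homotopy g r i (contractTerm Γ e) ∈ fil g r (i + 1) (Γ.1.weight + 1) := by
  by_cases he : Γ.1.mult (Γ.1.src e) (Γ.1.tgt e) = 1
  · have hne := hl e
    set Q : Fin (i + 2) × Fin (i + 2) → Graphs g r (i + 1) := fun p =>
      splitCl (Γ.contract e hne) (Γ.1.proj e p.1) (Γ.1.proj e p.2)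
        (eraseEdge (m := g + i) (Γ.1.pullSet p.1 p.2) e) with hQ
    have h1 : ∑ p : Fin (i + 2) × Fin (i + 2), (Γ.1.pairs p.1 p.2 : ℚ) •
        (splitContractTerm Γ p.1 p.2 (Γ.1.pullSet p.1 p.2) e -
          if Γ.1.Thin p.1 p.2 e then cl Γ else 0) =
        -((-1 : ℚ) ^ (Γ.1.tgt e : ℕ) • ∑ p : Fin (i + 2) × Fin (i + 2),
          (Γ.1.pairs p.1 p.2 : ℚ) • Q p) := by
      rw [Finset.smul_sum, ← Finset.sum_neg_distrib]
      refine Finset.sum_congr rfl fun p _ => ?_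
      by_cases hp : Γ.1.pairs p.1 p.2 = 0
      · simp [hp]
      · rw [splitContractTerm_sub hp hne he, smul_neg, smul_comm]
    have h2 : contractTerm Γ e = (-1 : ℚ) ^ (Γ.1.tgt e : ℕ) • cl (Γ.contract e hne) := by
      unfold contractTerm
      rw [dif_pos hne]
    rw [h1, h2, map_smul, homotopy_cl, neg_add_eq_sub, ← smul_sub]
    refine Submodule.smul_mem _ _ ?_
    have hS : ∀ p : Fin (i + 2) × Fin (i + 2), eraseEdge (m := g + i) (Γ.1.pullSet p.1 p.2) e ⊆
        (Γ.contract e hne).1.bundle (Γ.1.proj e p.1) (Γ.1.proj e p.2) := fun p =>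
      eraseEdge_subset (Γ := Γ.1) (n := i) (m := g + i) (pullSet_subset _ _ _) e
    have hfacts : ∀ p : Fin (i + 2) × Fin (i + 2), Γ.1.pairs p.1 p.2 ≠ 0 →
        p.1 ≠ p.2 ∧ 2 ≤ Γ.1.mult p.1 p.2 ∧ Γ.1.proj e p.1 ≠ Γ.1.proj e p.2 ∧
        (eraseEdge (m := g + i) (Γ.1.pullSet p.1 p.2) e).card = Γ.1.pullSize p.1 p.2 := by
      intro p hp
      obtain ⟨hab, hm⟩ := pullSize_le_mult hp
      have h2 := Γ.1.pullSize_eq p.1 p.2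
      refine ⟨hab, by omega, proj_ne_of_two_le_mult (n := i) (m := g + i) hne he hab (by omega), ?_⟩
      rw [card_eraseEdge (m := g + i), card_pullSet hp]
      intro h
      have := mult_eq_of_mem_bundle (pullSet_subset _ _ _ h)
      omega
    -- At equal weight the coefficients `pairs` add up over the fibres of the contraction and the
    -- numbers of moved edges agree, so the two sums coincide. If the weight rises, each sum lies in
    -- the higher filtration step by itself.
    rcases (weight_le_contract (n := i) (m := g + i) hne he).eq_or_lt with hw | hw
    · have h3 : pullSum (Γ.contract e hne) = ∑ p : Fin (i + 2) × Fin (i + 2),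
          (Γ.1.pairs p.1 p.2 : ℚ) • Q p := by
        unfold pullSum
        rw [← Finset.sum_fiberwise Finset.univ (fun p : Fin (i + 2) × Fin (i + 2) =>
          (Γ.1.proj e p.1, Γ.1.proj e p.2))]
        refine Finset.sum_congr rfl fun q _ => ?_
        have h4 : (Γ.contract e hne).1.pairs q.1 q.2 = _ :=
          pairs_contract_of_weight_eq (n := i) (m := g + i) hne he hw.symm q
        rw [h4, Nat.cast_sum, Finset.sum_smul]
        refine Finset.sum_congr rfl fun p hp => ?_
        obtain rfl := (Finset.mem_filter.1 hp).2
        by_cases hp0 : Γ.1.pairs p.1 p.2 = 0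
        · simp [hp0]
        · obtain ⟨hab, hm, hpab, hcard⟩ := hfacts p hp0
          congr 1
          refine splitCl_eq hpab (pullSet_subset _ _ _) (hS p) ?_
          have h5 : (Γ.contract e hne).1.pullSize (Γ.1.proj e p.1) (Γ.1.proj e p.2)
              = Γ.1.pullSize p.1 p.2 :=
            pullSize_contract (n := i) (m := g + i) hne he hw.symm hab hm
          rw [hcard, ← h5]
          refine card_pullSet ?_
          have h6 : Γ.1.mult p.1 p.2 ≤ (Γ.contract e hne).1.mult (Γ.1.proj e p.1) (Γ.1.proj e p.2) :=
            mult_le_contract (n := i) (m := g + i) hne hpab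
          change (Γ.contract e hne).1.pairs (Γ.1.proj e p.1) (Γ.1.proj e p.2) ≠ 0
          unfold pairs
          rw [if_neg hpab]
          omega
      rw [h3, sub_self]
      exact Submodule.zero_mem _
    · have hw' : Γ.1.weight + 1 ≤ (Γ.contract e hne).1.weight := hw
      refine fil_anti hw' (Submodule.sub_mem _ (pullSum_mem_fil _) (Submodule.sum_mem _ fun p _ => ?_))
      by_cases hp : Γ.1.pairs p.1 p.2 = 0
      · simp [hp]
      obtain ⟨hab, hm, hpab, hcard⟩ := hfacts p hp
      refine Submodule.smul_mem _ _ (splitCl_mem_fil hpab (hS p) ?_)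
      rw [hcard]
      rcases Γ.1.pullSize_eq p.1 p.2 with h5 | h5
      · exact .inl h5
      · refine .inr ⟨h5, ?_⟩
        have h6 : Γ.1.mult p.1 p.2 ≤ (Γ.contract e hne).1.mult (Γ.1.proj e p.1) (Γ.1.proj e p.2) :=
          mult_le_contract (n := i) (m := g + i) hne hpab
        rw [pullSize_eq_ite hpab (hm.trans h6), if_pos]
        rw [pullSize_eq_ite hab hm] at h5
        have h7 : Γ.1.Antenna p.2 := by
          by_contra h
          simp [h] at h5
        exact h7.contract (n := i) (m := g + i) hne he
  · rw [contractTerm_eq_zero he, map_zero, add_zero]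
    refine Submodule.sum_mem _ fun p _ => ?_
    by_cases hp : Γ.1.pairs p.1 p.2 = 0
    · simp [hp]
    · rw [if_neg (not_thin_of_mult_ne_one hp he), sub_zero]
      exact Submodule.smul_mem _ _ (splitContractTerm_mem_fil Γ hl (card_pullSet hp) he)

/-- The anticommutator of the homotopy and the differential. -/
def laplacian (g r i : ℕ) : Graphs g r (i + 1) →ₗ[ℚ] Graphs g r (i + 1) :=
  diff g r (i + 1) ∘ₗ homotopy g r (i + 1) + homotopy g r i ∘ₗ diff g r i

/-- Up to terms of higher weight, a graph is an eigenvector. -/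
lemma laplacian_cl (Γ : Gen g r (i + 1)) (hl : Γ.1.Loopless) :
    laplacian g r i (cl Γ) - (Γ.1.eigenvalue : ℚ) • cl Γ ∈ fil g r (i + 1) (Γ.1.weight + 1) := by
  classical
  -- The splitting part of the eigenvalue cancels the contractions of new edges; its thin part is
  -- distributed over the edges `e`.
  have h1 : laplacian g r i (cl Γ) - (Γ.1.eigenvalue : ℚ) • cl Γ = ∑ e,
      (∑ p : Fin (i + 2) × Fin (i + 2), (Γ.1.pairs p.1 p.2 : ℚ) •
        (splitContractTerm Γ p.1 p.2 (Γ.1.pullSet p.1 p.2) e -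
          if Γ.1.Thin p.1 p.2 e then cl Γ else 0) +
      homotopy g r i (contractTerm Γ e)) := by
    have h2 : diff g r (i + 1) (homotopy g r (i + 1) (cl Γ)) =
        ∑ p : Fin (i + 2) × Fin (i + 2), (Γ.1.pairs p.1 p.2 : ℚ) •
          ((if Γ.1.pullSize p.1 p.2 + 2 ≤ Γ.1.valence p.1 then cl Γ else 0) +
            ∑ e, splitContractTerm Γ p.1 p.2 (Γ.1.pullSet p.1 p.2) e) := by
      rw [homotopy_cl, pullSum, map_sum]
      refine Finset.sum_congr rfl fun p _ => ?_
      rw [map_smul, diff_splitCl]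
      by_cases hp : Γ.1.pairs p.1 p.2 = 0
      · simp [hp]
      · simp only [canSplit_pullSet_iff hp]
    have h3 : (Γ.1.eigenvalue : ℚ) • cl Γ = ∑ p : Fin (i + 2) × Fin (i + 2),
        (Γ.1.pairs p.1 p.2 : ℚ) •
          ((if Γ.1.pullSize p.1 p.2 + 2 ≤ Γ.1.valence p.1 then cl Γ else 0) +
            ∑ e, if Γ.1.Thin p.1 p.2 e then cl Γ else 0) := by
      unfold eigenvalue
      push_cast
      rw [Finset.sum_smul]
      refine Finset.sum_congr rfl fun p _ => ?_
      rw [mul_smul, add_smul, Finset.sum_smul]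
      simp only [ite_smul, one_smul, zero_smul]
    rw [Finset.sum_add_distrib, Finset.sum_comm, h3, laplacian, LinearMap.add_apply,
      LinearMap.comp_apply, LinearMap.comp_apply, h2, diff_cl, map_sum, add_sub_right_comm,
      ← Finset.sum_sub_distrib]
    congr 1
    refine Finset.sum_congr rfl fun p _ => ?_
    rw [← smul_sub, add_sub_add_left_eq_sub, ← Finset.sum_sub_distrib, Finset.smul_sum]
  rw [h1]
  exact Submodule.sum_mem _ fun e _ => sum_splitContractTerm_mem_fil Γ hl e

end

/-! ### Graphs with eigenvalue zero -/

open LegGraph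

namespace LegGraph

variable {n m r : ℕ}

instance : Finite (LegGraph n m r) :=
  Finite.of_injective
    (fun Γ => ((Γ.src, Γ.tgt, Γ.leg) : (Fin m → Fin n) × (Fin m → Fin n) × (Fin r → Fin n)))
    fun Γ Γ' h => by
      simp only [Prod.mk.injEq] at h
      exact LegGraph.ext h.1 h.2.1 h.2.2

lemma exists_pairs_ne_zero_iff {Γ : LegGraph n m r} (hl : Γ.Loopless) :
    (∃ a b, Γ.pairs a b ≠ 0) ↔ ¬ Γ.Simple := by
  constructor
  · rintro ⟨a, b, h⟩ ⟨-, h'⟩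
    obtain ⟨-, h2⟩ := pullSize_le_mult h
    have h3 := Γ.pullSize_eq a b
    obtain ⟨j, hj, k, hk, hjk⟩ := Finset.one_lt_card.1 (show 1 < (Γ.bundle a b).card by
      unfold mult at h2; omega)
    refine h' j k hjk ?_
    rw [mem_bundle] at hj hk
    unfold Parallel
    grind
  · intro h
    by_contra! h0
    refine h ⟨hl, fun j k hjk hp => ?_⟩
    have h1 := h0 (Γ.src j) (Γ.tgt j)
    have h2 : 1 < (Γ.bundle (Γ.src j) (Γ.tgt j)).card := by
      refine Finset.one_lt_card.2 ⟨j, by simp [mem_bundle], k, ?_, hjk⟩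
      rw [mem_bundle]
      unfold Parallel at hp
      grind
    unfold pairs at h1
    rw [if_neg (hl j)] at h1
    unfold mult at h1
    omega

lemma weight_ne_zero_iff {Γ : LegGraph n m r} : Γ.weight ≠ 0 ↔ ∃ a b, Γ.pairs a b ≠ 0 := by
  constructor
  · intro h
    by_contra! h0
    have h1 : Γ.antennas.card ≠ 0 := by
      unfold weight at h
      simpa [h0] using h
    obtain ⟨b, hb⟩ := Finset.card_pos.1 (Nat.pos_of_ne_zero h1)
    obtain ⟨-, a, hab, hm⟩ := mem_antennas.1 hb
    have := h0 a b
    simp [pairs, hab, hm] at this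
  · rintro ⟨a, b, h⟩
    have h1 := Finset.single_le_sum (f := fun p : Fin n × Fin n => Γ.pairs p.1 p.2)
      (fun _ _ => Nat.zero_le _) (Finset.mem_univ (a, b))
    simp only at h1
    unfold weight
    omega

/-- The graphs with multiple edges and eigenvalue zero have two vertices. -/
lemma eq_two_of_eigenvalue_eq_zero {Γ : LegGraph n m r} (hc : Γ.Connected)
    (hv : ∀ v, 3 ≤ Γ.valence v) (hw : Γ.weight ≠ 0) (h0 : Γ.eigenvalue = 0) :
    n = 2 ∧ ((m = 3 ∧ r = 0) ∨ (m = 3 ∧ r = 1) ∨ (m = 2 ∧ r = 2)) := by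
  classical
  obtain ⟨a, b, hp⟩ := weight_ne_zero_iff.1 hw
  -- As all summands are natural numbers, each one vanishes: `a` cannot be split, and an edge at `a`
  -- outside the bundle would be thin.
  have key : ∀ a b, Γ.pairs a b ≠ 0 → Γ.valence a ≤ Γ.pullSize a b + 1 ∧
      ∀ j, Γ.src j = a ∨ Γ.tgt j = a → j ∈ Γ.bundle a b := by
    intro a b hp
    unfold eigenvalue at h0
    have h1 := (Finset.sum_eq_zero_iff.1 h0) (a, b) (Finset.mem_univ _)
    simp only [mul_eq_zero, hp, false_or, Nat.add_eq_zero_iff, Finset.sum_eq_zero_iff,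
      Finset.mem_univ, true_imp_iff, ite_eq_right_iff, one_ne_zero, imp_false] at h1
    refine ⟨by omega, fun j hj => ?_⟩
    by_contra hjB
    obtain ⟨hab, hm⟩ := pullSize_le_mult hp
    have := Γ.card_add_card_le_valence a (insert j (Γ.bundle a b)) ∅ (by
      intro k hk
      rcases Finset.mem_insert.1 hk with rfl | hk
      · exact hj
      · exact incident_of_mem_bundle hk) (by simp)
    rw [Finset.card_insert_of_notMem hjB] at this
    change Γ.mult a b + 1 + 0 ≤ _ at this
    exact h1.2 j ⟨by omega, hj, hjB⟩
  have hab := (pullSize_le_mult hp).1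
  have hm := (pullSize_le_mult hp).2
  obtain ⟨hva, ha⟩ := key a b hp
  obtain ⟨hvb, hb⟩ := key b a (by rwa [pairs_comm])
  -- By symmetry no edge leaves `a` or `b` other than towards each other, so connectedness leaves no
  -- further vertex.
  have huniv : ∀ v, v = a ∨ v = b := by
    have : ∀ u v, Relation.EqvGen (fun x y => ∃ j, Γ.src j = x ∧ Γ.tgt j = y) u v →
        ((u = a ∨ u = b) ↔ (v = a ∨ v = b)) := by
      intro u v h
      induction h with
      | rel x y h =>
        obtain ⟨j, rfl, rfl⟩ := h
        have h1 := ha j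
        have h2 := hb j
        rw [mem_bundle] at h1 h2
        grind
      | refl x => rfl
      | symm x y _ ih => exact ih.symm
      | trans x y z _ _ ih ih' => exact ih.trans ih'
    exact fun v => (this a v (hc a v)).1 (.inl rfl)
  have hn : n = 2 := by
    have h1 : (Finset.univ : Finset (Fin n)) = {a, b} := by
      ext v
      simpa using huniv v
    have h2 := congrArg Finset.card h1
    rwa [Finset.card_fin, Finset.card_pair hab] at h2
  have hB : ∀ j, j ∈ Γ.bundle a b := fun j => by
    rcases huniv (Γ.src j) with h | h
    · exact ha j (.inl h)
    · rw [bundle_comm]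
      exact hb j (.inl h)
  have hmult : Γ.mult a b = m := by
    rw [mult, Finset.eq_univ_of_forall hB, Finset.card_fin]
  have hval : Γ.valence a = m + ∑ l, (if Γ.leg l = a then 1 else 0) ∧
      Γ.valence b = m + ∑ l, (if Γ.leg l = b then 1 else 0) := by
    rw [valence_eq_sum, valence_eq_sum]
    constructor <;> congr 1
    all_goals
      rw [Finset.sum_congr rfl fun j _ => show _ = 1 from ?_]
      · simp
      · rcases mem_bundle.1 (hB j) with ⟨h1, h2⟩ | ⟨h1, h2⟩ <;> simp [h1, h2, hab, hab.symm]
  have hr : ∑ l, (if Γ.leg l = a then 1 else 0) + ∑ l, (if Γ.leg l = b then 1 else 0) = r := by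
    rw [← Finset.sum_add_distrib, Finset.sum_congr rfl fun l _ => show _ = 1 from ?_]
    · simp
    · rcases huniv (Γ.leg l) with h | h <;> simp [h, hab, hab.symm]
  refine ⟨hn, ?_⟩
  have h3 := hv a
  have h4 := hv b
  rw [pullSize, mult_comm] at hvb
  rw [pullSize] at hva hm
  rw [hmult] at hva hvb hm
  split_ifs at * <;> omega

end LegGraph

/-! ### Acyclicity of the non-simple graphs -/

noncomputable section

variable {g r i : ℕ}

lemma nonSimple_eq_fil (g r i : ℕ) : nonSimple g r i = fil g r i 1 := by
  refine le_antisymm (Submodule.span_le.2 ?_) (Submodule.span_le.2 ?_)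
  · rintro _ ⟨Γ, h, rfl⟩
    by_cases hl : Γ.1.Loopless
    · exact cl_mem_fil (Nat.one_le_iff_ne_zero.2
        (weight_ne_zero_iff.2 ((exists_pairs_ne_zero_iff hl).2 h)))
    · rw [cl_eq_zero_of_loop hl]
      exact Submodule.zero_mem _
  · rintro _ ⟨Γ, hl, hw, rfl⟩
    exact Submodule.subset_span ⟨Γ, (exists_pairs_ne_zero_iff hl).1
      (weight_ne_zero_iff.1 (Nat.one_le_iff_ne_zero.1 hw)), rfl⟩

lemma cl_eq_zero_of_edge (Γ : Gen g r 0) (j : Fin (g + 0)) : cl Γ = 0 :=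
  cl_eq_zero_of_loop fun h => h j (Subsingleton.elim (α := Fin 1) _ _)

/-- With a single vertex every edge is a self-edge. -/
lemma nonSimple_zero (g r : ℕ) : nonSimple g r 0 = ⊥ := by
  refine le_bot_iff.1 (Submodule.span_le.2 ?_)
  rintro _ ⟨Γ, h, rfl⟩
  refine cl_eq_zero_of_loop fun hl => h ⟨hl, fun j => ?_⟩
  exact absurd (Subsingleton.elim (α := Fin 1) _ _) (hl j)

lemma laplacian_mem_fil {k : ℕ} {x : Graphs g r (i + 1)} (hx : x ∈ fil g r (i + 1) k) :
    laplacian g r i x ∈ fil g r (i + 1) k :=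
  Submodule.add_mem _ (diff_mem_fil (homotopy_mem_fil hx)) (homotopy_mem_fil (diff_mem_fil hx))

lemma aeval_mem {V : Type} [AddCommGroup V] [Module ℚ V] {T : Module.End ℚ V} {M : Submodule ℚ V}
    (hT : ∀ x ∈ M, T x ∈ M) (p : Polynomial ℚ) {x : V} (hx : x ∈ M) :
    Polynomial.aeval T p x ∈ M := by
  induction p using Polynomial.induction_on' with
  | add p q hp hq =>
    rw [map_add]
    exact Submodule.add_mem _ hp hq
  | monomial n c =>
    rw [Polynomial.aeval_monomial]
    refine Submodule.smul_mem _ c ?_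
    induction n with
    | zero => simpa using hx
    | succ n ih =>
      rw [pow_succ']
      exact hT _ ih

/-- On non-simple graphs the Laplacian is a root of a polynomial that does not vanish at zero. -/
lemma exists_aeval_laplacian_eq_zero
    (h : ∀ Γ : Gen g r (i + 1), Γ.1.weight ≠ 0 → Γ.1.eigenvalue ≠ 0) :
    ∃ p : Polynomial ℚ, p.coeff 0 ≠ 0 ∧
      ∀ x ∈ nonSimple g r (i + 1), Polynomial.aeval (laplacian g r i : Module.End ℚ _) p x = 0 := by
  obtain ⟨B, hB⟩ := (Set.finite_range fun Γ : Gen g r (i + 1) => Γ.1.eigenvalue).bddAbove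
  obtain ⟨K, hK⟩ := (Set.finite_range fun Γ : Gen g r (i + 1) => Γ.1.weight).bddAbove
  have hB' : ∀ Γ : Gen g r (i + 1), Γ.1.eigenvalue ≤ B := fun Γ => hB ⟨Γ, rfl⟩
  have hK' : ∀ Γ : Gen g r (i + 1), Γ.1.weight ≤ K := fun Γ => hK ⟨Γ, rfl⟩
  let T : Module.End ℚ (Graphs g r (i + 1)) := laplacian g r i
  -- The roots include all eigenvalues of positive weight; by `h`, zero can be left out.
  let q : Polynomial ℚ := ∏ n ∈ Finset.Icc 1 B, (Polynomial.X - Polynomial.C (n : ℚ))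
  have hT : ∀ k, ∀ x ∈ fil g r (i + 1) k, T x ∈ fil g r (i + 1) k := fun k x hx =>
    laplacian_mem_fil hx
  -- For each generator the factor with its own eigenvalue raises the weight, and the other factors
  -- preserve the filtration.
  have step : ∀ k, ∀ x ∈ fil g r (i + 1) (k + 1),
      Polynomial.aeval T q x ∈ fil g r (i + 1) (k + 2) := by
    intro k x hx
    refine map_mem_of_mem_fil (Polynomial.aeval T q) (fun Γ hl hw => ?_) hx
    have hN : Γ.1.eigenvalue ∈ Finset.Icc 1 B :=
      Finset.mem_Icc.2 ⟨Nat.one_le_iff_ne_zero.2 (h Γ (by omega)), hB' Γ⟩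
    have hq : q = (∏ n ∈ (Finset.Icc 1 B).erase Γ.1.eigenvalue,
        (Polynomial.X - Polynomial.C (n : ℚ))) *
          (Polynomial.X - Polynomial.C (Γ.1.eigenvalue : ℚ)) :=
      (Finset.prod_erase_mul _ _ hN).symm
    rw [hq, map_mul, Module.End.mul_apply]
    refine aeval_mem (hT _) _ (fil_anti (show k + 2 ≤ Γ.1.weight + 1 by omega) ?_)
    have h1 : Polynomial.aeval T (Polynomial.X - Polynomial.C (Γ.1.eigenvalue : ℚ)) (cl Γ) =
        laplacian g r i (cl Γ) - (Γ.1.eigenvalue : ℚ) • cl Γ := by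
      rw [map_sub, Polynomial.aeval_X, Polynomial.aeval_C]
      rfl
    rw [h1]
    exact laplacian_cl Γ hl
  -- Starting at weight one, `K` applications lead beyond the maximal weight `K`.
  refine ⟨q ^ K, ?_, fun x hx => ?_⟩
  · rw [Polynomial.coeff_zero_eq_eval_zero, Polynomial.eval_pow, Polynomial.eval_prod]
    refine pow_ne_zero _ (Finset.prod_ne_zero_iff.2 fun n hn => ?_)
    have := (Finset.mem_Icc.1 hn).1
    simp
    omega
  · rw [nonSimple_eq_fil] at hx
    have : ∀ k, Polynomial.aeval T (q ^ k) x ∈ fil g r (i + 1) (k + 1) := by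
      intro k
      induction k with
      | zero => simpa using hx
      | succ k ih =>
        rw [pow_succ', map_mul]
        exact step k _ ih
    have h1 := this K
    have h2 : fil g r (i + 1) (K + 1) = ⊥ := by
      refine le_bot_iff.1 (Submodule.span_le.2 ?_)
      rintro _ ⟨Γ, -, hw, rfl⟩
      have := hK' Γ
      omega
    rw [h2] at h1
    exact h1

/-- The identity `p = X * p.divX + p(0)` inverts the Laplacian on vectors killed by `p` when the
constant term is nonzero. -/
lemma smul_add_laplacian_eq_zero {p : Polynomial ℚ} {x : Graphs g r (i + 1)}
    (h : Polynomial.aeval (laplacian g r i : Module.End ℚ _) p x = 0) :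
    p.coeff 0 • x + laplacian g r i
      (Polynomial.aeval (laplacian g r i : Module.End ℚ _) p.divX x) = 0 := by
  have h1 := congrArg (fun q => Polynomial.aeval (laplacian g r i : Module.End ℚ _) q x)
    (Polynomial.divX_mul_X_add p)
  simp only [mul_comm _ Polynomial.X, map_add, map_mul, Polynomial.aeval_X, Polynomial.aeval_C, h]
    at h1
  exact (add_comm _ _).trans h1

/-- The complex of non-simple graphs is acyclic if there are no eigenvalues zero. -/
lemma exists_diff_eq_of_mem_nonSimple
    (h : ∀ Γ : Gen g r (i + 1), Γ.1.weight ≠ 0 → Γ.1.eigenvalue ≠ 0)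
    {x : Graphs g r (i + 1)} (hx : x ∈ nonSimple g r (i + 1)) (hd : diff g r i x = 0) :
    ∃ y ∈ nonSimple g r (i + 2), diff g r (i + 1) y = x := by
  obtain ⟨p, hp, h0⟩ := exists_aeval_laplacian_eq_zero h
  have h1 := smul_add_laplacian_eq_zero (h0 x hx)
  set y := Polynomial.aeval (laplacian g r i : Module.End ℚ _) p.divX x with hy
  -- The Laplacian preserves cycles, hence so do polynomials in it. On the cycle `y` it reduces to
  -- `d h`, so `h y` gives the primitive.
  have h2 : y ∈ LinearMap.ker (diff g r i) := by
    refine aeval_mem (fun z hz => ?_) _ (LinearMap.mem_ker.2 hd)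
    rw [LinearMap.mem_ker] at hz ⊢
    simp [laplacian, diff_diff, hz]
  have h3 : y ∈ nonSimple g r (i + 1) := by
    rw [nonSimple_eq_fil] at hx ⊢
    exact aeval_mem (fun z hz => laplacian_mem_fil hz) _ hx
  have h4 : laplacian g r i y = diff g r (i + 1) (homotopy g r (i + 1) y) := by
    simp [laplacian, LinearMap.mem_ker.1 h2]
  refine ⟨-(p.coeff 0)⁻¹ • homotopy g r (i + 1) y, Submodule.smul_mem _ _ ?_, ?_⟩
  · rw [nonSimple_eq_fil] at h3 ⊢
    exact homotopy_mem_fil h3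
  · rw [h4] at h1
    rw [map_smul, neg_smul, ← smul_neg, ← eq_neg_of_add_eq_zero_left h1, smul_smul,
      inv_mul_cancel₀ hp, one_smul]

/-- The alternative `i ≠ 0` means at least three vertices; it is needed for graphs with three
vertices in the exceptional case `(2, 1)`. -/
lemma eigenvalue_ne_zero (Γ : Gen g r (i + 1)) (hw : Γ.1.weight ≠ 0)
    (h : i ≠ 0 ∨ ((g, r) ≠ (2, 0) ∧ (g, r) ≠ (2, 1) ∧ (g, r) ≠ (1, 2))) :
    Γ.1.eigenvalue ≠ 0 := by
  intro h0
  have := eq_two_of_eigenvalue_eq_zero Γ.2.1 Γ.2.2 hw h0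
  simp only [ne_eq, Prod.mk.injEq] at h
  omega

end

/-! ### From acyclicity to the quasi-isomorphism -/

open LegGraph CategoryTheory

noncomputable section

variable {g r i : ℕ}

open scoped ZeroObject in
/-- The projection of an acyclic kernel is a quasi-isomorphism. -/
lemma quasiIso_of_shortExact {S : ShortComplex (ChainComplex (ModuleCat.{0} ℚ) ℕ)}
    (hS : S.ShortExact) (h : S.X₁.Acyclic) : QuasiIso S.g := by
  -- Comparing the sequence with `0 → X₂ → X₂` makes `S.g` the third map of a morphism whose first
  -- two maps are quasi-isomorphisms.
  let S₀ : ShortComplex (ChainComplex (ModuleCat.{0} ℚ) ℕ) :=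
    ShortComplex.mk (0 : (0 : ChainComplex (ModuleCat.{0} ℚ) ℕ) ⟶ S.X₂) (𝟙 S.X₂) (by simp)
  have hS₀ : S₀.ShortExact :=
    { exact := (ShortComplex.exact_iff_mono S₀ rfl).2 (by dsimp [S₀]; infer_instance)
      mono_f := by
        dsimp [S₀]
        infer_instance
      epi_g := by
        dsimp [S₀]
        infer_instance }
  let φ : S₀ ⟶ S :=
    { τ₁ := 0
      τ₂ := 𝟙 _
      τ₃ := S.g }
  have h₁ : QuasiIso φ.τ₁ := by
    rw [quasiIso_iff]
    intro j
    rw [quasiIsoAt_iff_exactAt]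
    · exact h j
    · exact HomologicalComplex.acyclic_of_isZero _ (Limits.isZero_zero _) j
  have h₂ : QuasiIso φ.τ₂ := by
    dsimp [φ]
    infer_instance
  exact HomologicalComplex.HomologySequence.quasiIso_τ₃ φ hS₀ hS h₁ h₂

/-- The projection is a quasi-isomorphism if the non-simple graphs form an acyclic complex. -/
lemma quasiIso_chainProj (h : ∀ i, ∀ x ∈ nonSimple g r (i + 1), diff g r i x = 0 →
    ∃ y ∈ nonSimple g r (i + 2), diff g r (i + 1) y = x) : QuasiIso (chainProj g r) := by
  have hf : ∀ i, (chainProj g r).f i = ModuleCat.ofHom (nonSimple g r i).mkQ := fun i => rfl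
  have hepi : ∀ i, Epi ((chainProj g r).f i) := fun i => by
    rw [ModuleCat.epi_iff_surjective, hf]
    exact (nonSimple g r i).mkQ_surjective
  have : Epi (chainProj g r) := HomologicalComplex.epi_of_epi_f _ hepi
  let S : ShortComplex (ChainComplex (ModuleCat.{0} ℚ) ℕ) :=
    ShortComplex.mk (Limits.kernel.ι (chainProj g r)) (chainProj g r) (Limits.kernel.condition _)
  have hS : S.ShortExact :=
    { exact := ShortComplex.exact_kernel _
      mono_f := by
        dsimp [S]
        infer_instance
      epi_g := this }
  refine quasiIso_of_shortExact hS fun i => ?_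
  have hSi := (HomologicalComplex.shortExact_iff_degreewise_shortExact S).1 hS
  have hinj : ∀ i, Function.Injective (S.f.f i) := fun i =>
    (ModuleCat.mono_iff_injective _).1 (hSi i).mono_f
  -- The categorical kernel is identified degreewise with `nonSimple`, through the injections `S.f.f
  -- i`.
  have hmem : ∀ i (x : S.X₁.X i), (S.f.f i x : Graphs g r i) ∈ nonSimple g r i := by
    intro i x
    have h1 : (chainProj g r).f i (S.f.f i x) = 0 :=
      (S.map (HomologicalComplex.eval _ _ i)).moduleCat_zero_apply x
    exact (Submodule.Quotient.mk_eq_zero _).1 h1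
  have hlift : ∀ i (x : Graphs g r i), x ∈ nonSimple g r i → ∃ z : S.X₁.X i, S.f.f i z = x := by
    intro i x hx
    exact (ShortComplex.moduleCat_exact_iff _).1 (hSi i).exact x
      ((Submodule.Quotient.mk_eq_zero _).2 hx)
  have hcomm : ∀ i (x : S.X₁.X (i + 1)), S.f.f i (S.X₁.d (i + 1) i x) =
      diff g r i (S.f.f (i + 1) x) := by
    intro i x
    have h1 := congrArg (fun f => f.hom x) (S.f.comm (i + 1) i)
    have h2 : S.X₂.d (i + 1) i = ModuleCat.ofHom (diff g r i) := chain_d g r i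
    rw [h2] at h1
    exact h1.symm
  cases i with
  | zero =>
    rw [HomologicalComplex.exactAt_iff' _ 1 0 0 (by simp) (by simp),
      ShortComplex.moduleCat_exact_iff]
    intro x _
    refine ⟨0, ?_⟩
    rw [map_zero]
    refine (hinj 0 ?_).symm
    have h0 : ∀ y ∈ nonSimple g r 0, y = 0 := fun y hy => by
      rwa [nonSimple_zero, Submodule.mem_bot] at hy
    exact (h0 _ (hmem 0 x)).trans (map_zero _).symm
  | succ i =>
    rw [HomologicalComplex.exactAt_iff' _ (i + 2) (i + 1) i (by simp) (by simp),
      ShortComplex.moduleCat_exact_iff]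
    intro x hx
    obtain ⟨y, hy, hyx⟩ := h i _ (hmem (i + 1) x)
      ((hcomm i x).symm.trans ((congrArg (S.f.f i) hx).trans (map_zero _)))
    obtain ⟨z, rfl⟩ := hlift _ y hy
    refine ⟨z, hinj (i + 1) ?_⟩
    exact (hcomm (i + 1) z).trans hyx

lemma quasiIso_feynProj (h1 : (g, r) ≠ (2, 0)) (h2 : (g, r) ≠ (2, 1)) (h3 : (g, r) ≠ (1, 2)) :
    QuasiIso (feynProj g r) :=
  (HomologicalComplex.quasiIso_extendMap_iff _ _).2 <| quasiIso_chainProj fun _ _ hx hd =>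
    exists_diff_eq_of_mem_nonSimple (fun Γ hw => eigenvalue_ne_zero Γ hw (.inr ⟨h1, h2, h3⟩)) hx hd

/-! ### The exceptional cases -/

lemma subsingleton_graphs (h : ∀ Γ : Gen g r i, cl Γ = 0) : Subsingleton (Graphs g r i) :=
  subsingleton_of_forall_eq 0 fun x => graphs_induction (fun x => x = 0) rfl
    (fun x y hx hy => by rw [hx, hy, add_zero]) (fun c Γ => by rw [h, smul_zero]) x

lemma isZero_extend_X_of_subsingleton (K : ChainComplex (ModuleCat.{0} ℚ) ℕ) (j : ℤ)
    (h : ∀ i : ℕ, 2 * (g : ℤ) + r - 3 - i = j → Subsingleton (K.X i)) :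
    Limits.IsZero ((K.extend (degreeEmbedding g r)).X j) := by
  by_cases hj : ∃ i, (degreeEmbedding g r).f i = j
  · obtain ⟨i, hi⟩ := hj
    have := h i hi
    exact (ModuleCat.isZero_of_subsingleton (K.X i)).of_iso (K.extendXIso (degreeEmbedding g r) hi)
  · exact K.isZero_extend_X _ _ (by simpa using hj)

lemma isZero_homology_of_isZero_X {K : CochainComplex (ModuleCat.{0} ℚ) ℤ} {j : ℤ}
    (h : Limits.IsZero (K.X j)) : Limits.IsZero (K.homology j) :=
  (ShortComplex.exact_iff_isZero_homology _).1 (ShortComplex.exact_of_isZero_X₂ (K.sc j) h)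

/-- The cohomology of a complex that is concentrated in one degree and of dimension one. -/
lemma cohomologySpannedBy_graphElem (Γ : Gen g r i)
    (hi : ∀ j, j ≠ i → Subsingleton (Graphs g r j))
    (hspan : ∀ x : Graphs g r i, ∃ c : ℚ, x = c • cl Γ) (hne : cl Γ ≠ 0) :
    CohomologySpannedBy (feyn g r) (graphElem Γ) := by
  set k : ℤ := 2 * (g : ℤ) + r - 3 - i with hk
  have hz : ∀ j : ℤ, j ≠ k → Limits.IsZero ((feyn g r).X j) := fun j hj =>
    isZero_extend_X_of_subsingleton (chain g r) j fun l hl => hi l (by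
      rintro rfl
      exact hj hl.symm)
  refine ⟨?_, fun j hj => isZero_homology_of_isZero_X (hz j hj)⟩
  have h1 : IsIso ((feyn g r).iCycles k) :=
    (feyn g r).isIso_iCycles k (k + 1) (by simp) ((hz _ (by omega)).eq_of_tgt _ _)
  have h2 : IsIso ((feyn g r).homologyπ k) :=
    (feyn g r).isIso_homologyπ (k - 1) k (by simp) ((hz _ (by omega)).eq_of_src _ _)
  let a : (feyn g r).cycles k ≃ₗ[ℚ] (feyn g r).X k := (asIso ((feyn g r).iCycles k)).toLinearEquiv
  let p : (feyn g r).cycles k ≃ₗ[ℚ] (feyn g r).homology k :=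
    (asIso ((feyn g r).homologyπ k)).toLinearEquiv
  let b : (feyn g r).X k ≃ₗ[ℚ] Graphs g r i := ((chain g r).extendXIso (degreeEmbedding g r)
    (show (degreeEmbedding g r).f i = k from rfl)).toLinearEquiv
  let e : (feyn g r).homology k ≃ₗ[ℚ] Graphs g r i := p.symm.trans (a.trans b)
  have he : e ((feyn g r).homologyπ k (a.symm (graphElem Γ))) = cl Γ := by
    change b (a (p.symm (p (a.symm (b.symm (cl Γ)))))) = cl Γ
    simp
  refine ⟨a.symm (graphElem Γ), a.apply_symm_apply _, fun y => ?_⟩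
  obtain ⟨c, hc⟩ := hspan (e y)
  refine ⟨c, e.injective ?_, fun c' hc' => ?_⟩
  · rw [map_smul, he, hc]
  · rw [hc', map_smul, he] at hc
    exact smul_left_injective ℚ hne hc

lemma isZero_simpleFeyn_homology (h : ∀ i, nonSimple g r i = ⊤) (k : ℤ) :
    Limits.IsZero ((simpleFeyn g r).homology k) :=
  isZero_homology_of_isZero_X (isZero_extend_X_of_subsingleton (simpleChain g r) k fun i _ =>
    Submodule.Quotient.subsingleton_iff.2 (h i))

lemma sum_valence {n m : ℕ} (Γ : LegGraph n m r) : ∑ v, Γ.valence v = 2 * m + r := by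
  simp only [valence_eq_sum, Finset.sum_add_distrib]
  rw [Finset.sum_comm, Finset.sum_comm (t := Finset.univ (α := Fin m)),
    Finset.sum_comm (t := Finset.univ (α := Fin r))]
  simp
  omega

/-- There are no such graphs: the valences sum to `2 * (g + i) + r` and each of the `i + 1` valences
is at least three. -/
lemma subsingleton_graphs_of_lt (h : 2 * g + r < i + 3) : Subsingleton (Graphs g r i) := by
  refine subsingleton_graphs fun Γ => ?_
  have h1 := sum_valence Γ.1
  have h2 := Finset.sum_le_sum fun v (_ : v ∈ Finset.univ) => Γ.2.2 v
  simp at h2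
  omega

lemma subsingleton_graphs_zero (h : g ≠ 0) : Subsingleton (Graphs g r 0) :=
  subsingleton_graphs fun Γ => cl_eq_zero_of_edge Γ ⟨0, by omega⟩

/-- The graphs with two vertices and without self-edges are determined by their legs. -/
lemma exists_smul_cl_eq {Γ₀ Γ : Gen g r 1} (hs : ∀ j, Γ₀.1.src j = 0) (ht : ∀ j, Γ₀.1.tgt j = 1)
    (hleg : Γ.1.Loopless → ∃ σ : Equiv.Perm (Fin 2), ∀ l, Γ.1.leg l = σ (Γ₀.1.leg l)) :
    ∃ c : ℚ, cl Γ = c • cl Γ₀ := by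
  by_cases hl : Γ.1.Loopless
  · obtain ⟨σ, hσ⟩ := hleg hl
    have key : ∀ x y : Fin 2, x ≠ y → ∀ σ : Equiv.Perm (Fin 2),
        x = σ (if decide (x ≠ σ 0) then 1 else 0) ∧ y = σ (if decide (x ≠ σ 0) then 0 else 1) := by
      decide
    have h : IsoVia Γ₀.1 Γ.1 σ 1 fun j => decide (Γ.1.src j ≠ σ 0) := by
      refine ⟨fun j => ?_, fun j => ?_, hσ⟩
      · rw [hs, ht]
        exact (key _ _ (hl j) σ).1
      · rw [hs, ht]
        exact (key _ _ (hl j) σ).2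
    exact ⟨_, cl_eq_of_isIso h.isIso⟩
  · exact ⟨0, by rw [cl_eq_zero_of_loop hl, zero_smul]⟩

lemma exists_smul_eq {Γ₀ : Gen g r i} (h : ∀ Γ : Gen g r i, ∃ c : ℚ, cl Γ = c • cl Γ₀)
    (x : Graphs g r i) : ∃ c : ℚ, x = c • cl Γ₀ :=
  graphs_induction (fun x => ∃ c : ℚ, x = c • cl Γ₀) ⟨0, by simp⟩
    (fun x y ⟨c, hc⟩ ⟨d, hd⟩ => ⟨c + d, by rw [hc, hd, add_smul]⟩)
    (fun c Γ => by
      obtain ⟨d, hd⟩ := h Γ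
      exact ⟨c * d, by rw [hd, mul_smul]⟩) x

/-- A function that transforms like an orientation descends to a linear functional on the space of
graphs. -/
lemma cl_ne_zero_of_invariant (f : Gen g r i → ℚ)
    (hf : ∀ (Γ Γ' : Gen g r i) (τ : Equiv.Perm (Fin (g + i))) (s : ℤˣ),
      IsIso Γ.1 Γ'.1 τ s → f Γ' = ((s : ℤ) : ℚ) • f Γ) {Γ : Gen g r i} (h : f Γ ≠ 0) : cl Γ ≠ 0 := by
  intro h0
  have h1 := congrArg ((relations g r i).liftQ _ (relations_le_ker f hf)) h0
  simp [cl] at h1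
  exact h h1

/-- The product of the directions of all edges of a graph with two vertices. -/
def direction {m : ℕ} (Γ : LegGraph 2 m r) : ℚ :=
  ∏ j, (((Γ.tgt j : ℕ) : ℚ) - ((Γ.src j : ℕ) : ℚ))

lemma sub_perm_two : ∀ (σ : Equiv.Perm (Fin 2)) (x y : Fin 2),
    ((σ y : ℕ) : ℤ) - (σ x : ℕ) = (Equiv.Perm.sign σ : ℤ) * (((y : ℕ) : ℤ) - (x : ℕ)) := by
  decide

lemma sub_perm_two' (σ : Equiv.Perm (Fin 2)) (x y : Fin 2) :
    ((σ y : ℕ) : ℚ) - (σ x : ℕ) = ((Equiv.Perm.sign σ : ℤ) : ℚ) * (((y : ℕ) : ℚ) - (x : ℕ)) := by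
  exact_mod_cast congrArg (fun z : ℤ => (z : ℚ)) (sub_perm_two σ x y)

lemma direction_of_isoVia {m : ℕ} {Γ Γ' : LegGraph 2 m r} {σ : Equiv.Perm (Fin 2)}
    {τ : Equiv.Perm (Fin m)} {φ : Fin m → Bool} (h : IsoVia Γ Γ' σ τ φ) :
    direction Γ' = ((Equiv.Perm.sign σ : ℤ) : ℚ) ^ m *
      (((∏ j, (if φ j then (-1 : ℤˣ) else 1) : ℤˣ) : ℤ) : ℚ) * direction Γ := by
  unfold direction
  rw [← Equiv.prod_comp τ]
  have : ∀ j, ((Γ'.tgt (τ j) : ℕ) : ℚ) - ((Γ'.src (τ j) : ℕ) : ℚ) =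
      ((Equiv.Perm.sign σ : ℤ) : ℚ) * (((if φ j then (-1 : ℤˣ) else 1 : ℤˣ) : ℤ) : ℚ) *
        (((Γ.tgt j : ℕ) : ℚ) - ((Γ.src j : ℕ) : ℚ)) := by
    intro j
    rw [h.src, h.tgt, sub_perm_two']
    by_cases hφ : φ j
    · simp only [hφ, if_true]
      push_cast
      ring
    · simp [hφ]
  rw [Finset.prod_congr rfl fun j _ => this j, Finset.prod_mul_distrib, Finset.prod_mul_distrib]
  simp [Units.coe_prod]

lemma sign_pow_three (σ : Equiv.Perm (Fin 2)) :
    ((Equiv.Perm.sign σ : ℤ) : ℚ) ^ 3 = ((Equiv.Perm.sign σ : ℤ) : ℚ) := by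
  rcases Int.units_eq_one_or (Equiv.Perm.sign σ) with h | h <;> norm_num [h]

/-- With three edges a vertex permutation multiplies `direction` by the cube of its sign, which is
the sign required of an orientation. -/
lemma cl_ne_zero_of_direction {Γ : Gen 2 r 1} (h : direction Γ.1 ≠ 0) : cl Γ ≠ 0 := by
  refine cl_ne_zero_of_invariant (fun Γ => direction Γ.1) (fun Γ Γ' τ s hs => ?_) h
  obtain ⟨σ, φ, hv, rfl⟩ := hs.exists_isoVia
  rw [direction_of_isoVia hv, sign_pow_three]
  push_cast
  rw [smul_eq_mul]

lemma cl_theta_ne_zero : cl theta ≠ 0 :=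
  cl_ne_zero_of_direction (by simp [direction, theta])

lemma cl_thetaLeg_ne_zero : cl thetaLeg ≠ 0 :=
  cl_ne_zero_of_direction (by simp [direction, thetaLeg])

/-- Two edges contribute only the square of the sign of a vertex permutation; the difference of the
positions of the two legs supplies the missing factor. -/
lemma cl_doubleEdge_ne_zero : cl doubleEdge ≠ 0 := by
  refine cl_ne_zero_of_invariant (fun Γ : Gen 1 2 1 =>
    direction Γ.1 * (((Γ.1.leg 1 : ℕ) : ℚ) - ((Γ.1.leg 0 : ℕ) : ℚ))) (fun Γ Γ' τ s hs => ?_) ?_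
  · obtain ⟨σ, φ, hv, rfl⟩ := hs.exists_isoVia
    rw [direction_of_isoVia hv, hv.leg, hv.leg, sub_perm_two' σ, Units.val_mul,
      Int.cast_mul, smul_eq_mul]
    linear_combination (((∏ j, (if φ j then (-1 : ℤˣ) else 1) : ℤˣ) : ℤ) : ℚ) * direction Γ.1 *
      (((Γ.1.leg 1 : ℕ) : ℚ) - ((Γ.1.leg 0 : ℕ) : ℚ)) * sign_pow_three σ
  · simp [direction, doubleEdge]

lemma exists_smul_cl_theta (x : Graphs 2 0 1) : ∃ c : ℚ, x = c • cl theta :=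
  exists_smul_eq (fun _ => exists_smul_cl_eq (fun _ => rfl) (fun _ => rfl)
    fun _ => ⟨1, fun l => l.elim0⟩) x

lemma exists_smul_cl_thetaLeg (x : Graphs 2 1 1) : ∃ c : ℚ, x = c • cl thetaLeg :=
  exists_smul_eq (fun Γ => exists_smul_cl_eq (fun _ => rfl) (fun _ => rfl)
    fun _ => ⟨Equiv.swap 0 (Γ.1.leg 0), fun l => by
      rw [Subsingleton.elim l 0]
      exact (Equiv.swap_apply_left _ _).symm⟩) x

lemma exists_smul_cl_doubleEdge (x : Graphs 1 2 1) : ∃ c : ℚ, x = c • cl doubleEdge := by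
  refine exists_smul_eq (fun Γ => exists_smul_cl_eq (fun _ => rfl) (fun _ => rfl) fun hl => ?_) x
  -- If both legs sat on one vertex, the other would have valence two.
  have hne : Γ.1.leg 0 ≠ Γ.1.leg 1 := by
    intro h
    obtain ⟨v, hv⟩ : ∃ v, v ≠ Γ.1.leg 0 := exists_ne _
    have h1 := Γ.2.2 v
    have h2 : ∀ x y v : Fin 2, x ≠ y → (if x = v then 1 else 0) + (if y = v then 1 else 0) = 1 := by
      decide
    have h3 : ∀ l, Γ.1.leg l ≠ v := by
      intro l
      fin_cases l
      · exact hv.symm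
      · exact fun h' => hv (h'.symm.trans h.symm)
    rw [valence_eq_sum, Finset.sum_congr rfl fun j _ => h2 _ _ v (hl j),
      Finset.sum_eq_zero fun l _ => if_neg (h3 l)] at h1
    simp at h1
  have key : ∀ x y : Fin 2, x ≠ y → Equiv.swap 0 x 1 = y := by decide
  refine ⟨Equiv.swap 0 (Γ.1.leg 0), fun l => ?_⟩
  fin_cases l
  · exact (Equiv.swap_apply_left _ _).symm
  · exact (key _ _ hne).symm

/-- No splitting is admissible: three edges would have to be moved from the vertex of valence four,
or two from the vertex of valence three. -/
lemma homotopy_cl_thetaLeg : homotopy 2 1 1 (cl thetaLeg) = 0 := by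
  rw [homotopy_cl, pullSum]
  refine Finset.sum_eq_zero fun p _ => ?_
  by_cases hp : thetaLeg.1.pairs p.1 p.2 = 0
  · simp [hp]
  · unfold splitCl
    rw [dif_neg, smul_zero]
    rw [canSplit_pullSet_iff hp]
    revert hp p
    decide

lemma not_simple_of_two_one_two (Γ : Gen 2 1 2) (hl : Γ.1.Loopless) : ¬ Γ.1.Simple := by
  rintro ⟨-, h⟩
  -- Four edges on three vertices: modulo three, the sum of two different vertices determines the
  -- unordered pair, so two edges are parallel.
  obtain ⟨j, k, hjk, he⟩ := Fintype.exists_ne_map_eq_of_card_lt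
    (fun j : Fin 4 => Γ.1.src j + Γ.1.tgt j) (by simp)
  have key : ∀ a b c d : Fin 3, a ≠ b → c ≠ d → a + b = c + d →
      (a = c ∧ b = d) ∨ (a = d ∧ b = c) := by
    decide
  exact h j k hjk (key _ _ _ _ (hl j) (hl k) he)

lemma nonSimple_two_one_two : nonSimple 2 1 2 = ⊤ := by
  refine top_le_iff.1 fun x _ => graphs_induction (fun x => x ∈ nonSimple 2 1 2)
    (Submodule.zero_mem _) (fun _ _ => Submodule.add_mem _) (fun c Γ => ?_) x
  refine Submodule.smul_mem _ _ ?_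
  by_cases hl : Γ.1.Loopless
  · exact Submodule.subset_span ⟨Γ, not_simple_of_two_one_two Γ hl, rfl⟩
  · rw [cl_eq_zero_of_loop hl]
    exact Submodule.zero_mem _

/-- All these graphs are non-simple, so the Laplacian is invertible. But it is also zero: there are
no graphs with four vertices, and the homotopy kills the theta graph with a leg, which spans the
graphs with two vertices. -/
lemma subsingleton_graphs_two_one_two : Subsingleton (Graphs 2 1 2) := by
  obtain ⟨p, hp, h0⟩ := exists_aeval_laplacian_eq_zero (g := 2) (r := 1) (i := 1)
    fun Γ hw => eigenvalue_ne_zero Γ hw (.inl one_ne_zero)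
  have h3 : Subsingleton (Graphs 2 1 3) := subsingleton_graphs_of_lt (by norm_num)
  have hT : ∀ x, laplacian 2 1 1 x = 0 := by
    intro x
    obtain ⟨c, hc⟩ := exists_smul_cl_thetaLeg (diff 2 1 1 x)
    rw [laplacian, LinearMap.add_apply, LinearMap.comp_apply, LinearMap.comp_apply, hc, map_smul,
      homotopy_cl_thetaLeg, Subsingleton.elim (homotopy 2 1 2 x) 0]
    simp
  refine subsingleton_of_forall_eq 0 fun x => ?_
  have h1 := smul_add_laplacian_eq_zero (h0 x (nonSimple_two_one_two ▸ Submodule.mem_top))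
  rw [hT, add_zero] at h1
  exact (smul_eq_zero.1 h1).resolve_left hp

lemma subsingleton_graphs_two_zero (j : ℕ) (hj : j ≠ 1) : Subsingleton (Graphs 2 0 j) := by
  rcases Nat.eq_zero_or_pos j with rfl | h
  · exact subsingleton_graphs_zero two_ne_zero
  · exact subsingleton_graphs_of_lt (by omega)

lemma subsingleton_graphs_two_one (j : ℕ) (hj : j ≠ 1) : Subsingleton (Graphs 2 1 j) := by
  rcases Nat.eq_zero_or_pos j with rfl | h
  · exact subsingleton_graphs_zero two_ne_zero
  · by_cases h2 : j = 2
    · subst h2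
      exact subsingleton_graphs_two_one_two
    · exact subsingleton_graphs_of_lt (by omega)

lemma subsingleton_graphs_one_two (j : ℕ) (hj : j ≠ 1) : Subsingleton (Graphs 1 2 j) := by
  rcases Nat.eq_zero_or_pos j with rfl | h
  · exact subsingleton_graphs_zero one_ne_zero
  · exact subsingleton_graphs_of_lt (by omega)

lemma nonSimple_eq_top {Γ₀ : Gen g r 1} (h : ∀ j, j ≠ 1 → Subsingleton (Graphs g r j))
    (hspan : ∀ x : Graphs g r 1, ∃ c : ℚ, x = c • cl Γ₀) (hΓ : ¬ Γ₀.1.Simple) (j : ℕ) :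
    nonSimple g r j = ⊤ := by
  by_cases hj : j = 1
  · subst hj
    refine top_le_iff.1 fun x _ => ?_
    obtain ⟨c, rfl⟩ := hspan x
    exact Submodule.smul_mem _ _ (Submodule.subset_span ⟨Γ₀, hΓ, rfl⟩)
  · have := h j hj
    exact Subsingleton.elim _ _

lemma not_simple_of_src_tgt {Γ : Gen g r 1} (hg : g ≠ 0) (hs : ∀ j, Γ.1.src j = 0)
    (ht : ∀ j, Γ.1.tgt j = 1) : ¬ Γ.1.Simple := by
  rintro ⟨-, h⟩
  exact h ⟨0, by omega⟩ ⟨1, by omega⟩ (by simp) (.inl ⟨by rw [hs, hs], by rw [ht, ht]⟩)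

end

end OddGraph

theorem mainTheorem6 :
    -- the projection is a quasi-isomorphism outside three exceptional cases
    (∀ g r : ℕ, (g, r) ≠ (2, 0) → (g, r) ≠ (2, 1) → (g, r) ≠ (1, 2) →
      QuasiIso (OddGraph.feynProj g r)) ∧
    -- the cohomology in the exceptional cases
    OddGraph.CohomologySpannedBy (OddGraph.feyn 2 0)
      (OddGraph.graphElem OddGraph.theta) ∧
    OddGraph.CohomologySpannedBy (OddGraph.feyn 2 1)
      (OddGraph.graphElem OddGraph.thetaLeg) ∧
    OddGraph.CohomologySpannedBy (OddGraph.feyn 1 2)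
      (OddGraph.graphElem OddGraph.doubleEdge) ∧
    -- the cohomology of the simple version in the exceptional cases
    (∀ k : ℤ, CategoryTheory.Limits.IsZero ((OddGraph.simpleFeyn 2 0).homology k)) ∧
    (∀ k : ℤ, CategoryTheory.Limits.IsZero ((OddGraph.simpleFeyn 2 1).homology k)) ∧
    (∀ k : ℤ, CategoryTheory.Limits.IsZero ((OddGraph.simpleFeyn 1 2).homology k)) := by
  refine ⟨fun g r h1 h2 h3 => OddGraph.quasiIso_feynProj h1 h2 h3, ?_, ?_, ?_, ?_, ?_, ?_⟩
  · exact OddGraph.cohomologySpannedBy_graphElem _ OddGraph.subsingleton_graphs_two_zero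
      OddGraph.exists_smul_cl_theta OddGraph.cl_theta_ne_zero
  · exact OddGraph.cohomologySpannedBy_graphElem _ OddGraph.subsingleton_graphs_two_one
      OddGraph.exists_smul_cl_thetaLeg OddGraph.cl_thetaLeg_ne_zero
  · exact OddGraph.cohomologySpannedBy_graphElem _ OddGraph.subsingleton_graphs_one_two
      OddGraph.exists_smul_cl_doubleEdge OddGraph.cl_doubleEdge_ne_zero
  · exact OddGraph.isZero_simpleFeyn_homology (OddGraph.nonSimple_eq_top
      OddGraph.subsingleton_graphs_two_zero OddGraph.exists_smul_cl_theta
      (OddGraph.not_simple_of_src_tgt two_ne_zero (fun _ => rfl) fun _ => rfl))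
  · exact OddGraph.isZero_simpleFeyn_homology (OddGraph.nonSimple_eq_top
      OddGraph.subsingleton_graphs_two_one OddGraph.exists_smul_cl_thetaLeg
      (OddGraph.not_simple_of_src_tgt two_ne_zero (fun _ => rfl) fun _ => rfl))
  · exact OddGraph.isZero_simpleFeyn_homology (OddGraph.nonSimple_eq_top
      OddGraph.subsingleton_graphs_one_two OddGraph.exists_smul_cl_doubleEdge
      (OddGraph.not_simple_of_src_tgt one_ne_zero (fun _ => rfl) fun _ => rfl))
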